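/- **Hopf diagrams.** Let $\mathcal D^S$ be the strict braided category generated by one object $*$ and morphisms $\Delta:*\to *\otimes *$, $\varepsilon:*\to\mathbf 1$, $\omega_\pm:*\otimes *\to\mathbf 1$, $\theta_\pm:*\to\mathbf 1$, $S^{\pm1}:*\to *$, subject to: $(*,\Delta,\varepsilon)$ is a coalgebra; $SS^{-1}=\mathrm{id}=S^{-1}S$; $\Delta S=(S\otimes S)\tau_{*,*}\Delta$; $\varepsilon S=\varepsilon$; $\theta_\pm S=\theta_\pm$; $\omega_+(S\otimes\mathrm{id})=\omega_-=\omega_+(\mathrm{id}\otimes S)$; $\omega_+(S^{-1}\otimes\mathrm{id})=\omega_-\tau_{*,*}=\omega_+(\mathrm{id}\otimes S^{-1})$, where $\tau$ is the braiding. The monoidal category $\mathcal Diag^S$ has objects $0,1,2,\dots$, no morphism $m\to n$ for $m\ne n$, and $\mathrm{End}(n)=\mathrm{Hom}_{\mathcal D^S}(*^{\otimes n},\mathbf 1)$ with composition the convolution product $f\circ g=(f\otimes g)\Delta_{*^{\otimes n}}$, identity $\varepsilon^{\otimes n}$, and tensor product $m\otimes n=m+n$, $f\otimes g$. **Ribbon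 tangles** are given by plane diagrams (blackboard framing, read from bottom to top) up to plane deformation and the ribbon Reidemeister moves. A *ribbon $n$-string link* is an $(n,n)$-tangle without closed components whose $k$-th arc joins the $k$-th bottom endpoint to the $k$-th top endpoint; a *ribbon $n$-handle* is a $(2n,0)$-tangle without closed components whose $k$-th arc joins the bottom endpoints $2k-1$ and $2k$. The monoidal category $\mathrm{RSL}$ has objects $0,1,2,\dots$, endomorphisms of $n$ the isotopy classes of ribbon $n$-string links (and no other morphisms), composition by stacking ($T'\circ T$ has $T'$ on top), and juxtaposition as tensor product. The monoidal category $\mathrm{RHand}$ has objects $0,1,2,\dots$, endomorphisms of $n$ the isotopy classes of ribbon $n$-handles (and no other morphisms), the identity being $n$ caps, juxtaposition as tensor product, and composition $T\circ T'=(T\otimes T')\circ\Delta_n$. Here $\Delta_n$ is the $(2n,4n)$-tangle which doubles every pair of bottom strands by inserting a cup between its two strands and then brings all left copies, in order, to the left of all right copies, the right copies passing over by positive crossings. **The functor $G$.** For a diagram $T$ of a ribbon $n$-handle, $G_T$ is the diagram obtained from $T$ as follows: the bottom endpoint $2k$ of $T$ is extended downwards to the $k$-th bottom endpoint of $G_T$;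 from the bottom endpoint $2k-1$ of $T$ a cup starts to the left, and its other branch is led to the left behind the strands ending at the first $2k-2$ bottom endpoints of $T$ and then upwards, to the left of $T$, to the $k$-th top endpoint of $G_T$. **The rule.** To a diagram $D$ of a morphism $*^{\otimes m}\to *^{\otimes n}$ built from the generators and $\tau_{*,*}^{\pm1}$, associate the plane diagram $\phi_D$ with $2m$ bottom and $2n$ top endpoints obtained by replacing each strand by two parallel strands and each generator as follows. Let $x_i$ be the positive crossing of the strands at the positions $i,i+1$ (from the left; the strand going from bottom left to top right is over), $x_i^{-1}$ the negative one, $\cap_i$ the cap joining the strands at the positions $i,i+1$, and $\cup_i$ the cup creating two strands at the positions $i,i+1$; products are stacked from bottom to top, the leftmost factor being at the bottom: $$\Delta\mapsto\cup_2,\qquad \varepsilon\mapsto\cap_1,\qquad S\mapsto x_1\cup_1x_2\cap_1,\qquad S^{-1}\mapsto\cup_1x_2^{-1}\cap_1x_1^{-1},$$ $$\omega_-\mapsto x_2x_2\cap_1\cap_1,\qquad \omega_+\mapsto(\cup_1x_2^{-1}\cap_1x_1^{-1})\,x_2x_2\cap_1\cap_1,\qquad \theta_\pm\mapsto\cup_3x_2^{\pm1}\cap_3\cap_1,$$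 and $\tau_{*,*}\mapsto x_2x_3x_1x_2$ (the positive crossing of two pairs of strands), $\tau_{*,*}^{-1}\mapsto x_2^{-1}x_1^{-1}x_3^{-1}x_2^{-1}$. **Proposition 3.1.** 1. If two diagrams $D,D'$ represent the same morphism $*^{\otimes m}\to *^{\otimes n}$ of $\mathcal D^S$, then $\phi_D$ and $\phi_{D'}$ represent isotopic ribbon tangles (every defining relation becomes an isotopy). 2. If $n=0$, then $\phi_D$ is a diagram of a ribbon $m$-handle. There is a strict monoidal functor $\phi:\mathcal Diag^S\to\mathrm{RHand}$, identity on objects, which sends the class of every such $D$ to the isotopy class of $\phi_D$. 3. For each diagram $T$ of a ribbon $n$-handle, $G_T$ is a diagram of a ribbon $n$-string link, and $T\mapsto G_T$ induces a strict monoidal functor $G:\mathrm{RHand}\to\mathrm{RSL}$, identity on objects. Consequently there is a well-defined strict monoidal functor $\psi:\mathcal Diag^S\to\mathrm{RSL}$, identity on objects, which sends the class of $D$ to the isotopy class of $\psi_D=G_{\phi_D}$, and $\psi=G\circ\phi$. -/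

import Mathlib

open CategoryTheory MonoidalCategory

set_option linter.unusedSectionVars false

namespace HopfDiag

/-! ## Strict monoidal categories of layered plane diagrams -/

/-- Generators and relations for a strict monoidal category with objects `0, 1, 2, …` (powers of
one object `1`). A generator `g` has `src g` inputs and `tgt g` outputs. -/
structure Presentation where
  Gen : Type
  src : Gen → ℕ
  tgt : Gen → ℕ
  Rel : List (ℕ × Gen) → List (ℕ × Gen) → Prop

/-- Put `k` vertical strands on the left of a word. -/
def shift {G : Type} (k : ℕ) (w : List (ℕ × G)) : List (ℕ × G) :=
  w.map fun s => (k + s.1, s.2)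

namespace Presentation

variable (P : Presentation)

/-- A plane diagram cut into horizontal layers, listed from bottom to top. The layer `(k, g)` is
the generator `g` with `k` vertical strands on its left (and the remaining ones on its right). -/
abbrev Word := List (ℕ × P.Gen)

/-- `P.Typed m w n`: the word `w` is a diagram with `m` inputs (bottom) and `n` outputs (top). -/
def Typed : ℕ → P.Word → ℕ → Prop
  | m, [], n => m = n
  | m, (k, g) :: w, n => ∃ r, m = k + P.src g + r ∧ Typed (k + P.tgt g + r) w n

/-- Diagrams with `m` inputs and `n` outputs. -/
structure Diagram (m n : ℕ) where
  word : P.Word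
  typed : P.Typed m word n

/-- Elementary local moves: the given relations, and the exchange of the heights of two distant
generators (with `d` vertical strands between them). -/
inductive Move : P.Word → P.Word → Prop
  | rel {l r : P.Word} : P.Rel l r → Move l r
  | exchange (g h : P.Gen) (d : ℕ) :
      Move [(0, g), (P.tgt g + d, h)] [(P.src g + d, h), (0, g)]

/-- Two diagrams differ by a move applied to some consecutive layers, away from `k` vertical
strands on the left (and any number on the right). -/
def Step {m n : ℕ} (D D' : P.Diagram m n) : Prop :=
  ∃ (k : ℕ) (u v l r : P.Word), P.Move l r ∧
    D.word = u ++ shift k l ++ v ∧ D'.word = u ++ shift k r ++ v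

/-- Objects of the presented category: `n` stands for the `n`-th tensor power of the generator. -/
def Cat (_ : Presentation) : Type := ℕ

/-- Morphisms: diagrams up to the equivalence relation generated by the moves. -/
def Hom (m n : ℕ) : Type := Quot (P.Step (m := m) (n := n))

variable {P}

/-- The class of a diagram. -/
def cls {m n : ℕ} (D : P.Diagram m n) : P.Hom m n := Quot.mk _ D

theorem typed_append {m n : ℕ} {u v : P.Word} :
    P.Typed m (u ++ v) n ↔ ∃ a, P.Typed m u a ∧ P.Typed a v n := by
  induction u generalizing m with
  | nil => simp [Typed]
  | cons s u ih =>
    obtain ⟨k, g⟩ := s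
    simp only [List.cons_append, Typed, ih]
    constructor
    · rintro ⟨r, h, a, h1, h2⟩; exact ⟨a, ⟨r, h, h1⟩, h2⟩
    · rintro ⟨a, ⟨r, h, h1⟩, h2⟩; exact ⟨r, h, a, h1, h2⟩

theorem typed_cons {m n k : ℕ} {g : P.Gen} {w : P.Word} :
    P.Typed m ((k, g) :: w) n ↔
      k + P.src g ≤ m ∧ P.Typed (k + P.tgt g + (m - (k + P.src g))) w n := by
  constructor
  · rintro ⟨r, rfl, h⟩
    exact ⟨by omega, by rwa [Nat.add_sub_cancel_left]⟩
  · rintro ⟨h, h'⟩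
    exact ⟨_, by omega, h'⟩

instance decTyped : (m : ℕ) → (w : P.Word) → (n : ℕ) → Decidable (P.Typed m w n)
  | m, [], n => inferInstanceAs (Decidable (m = n))
  | _, (_, _) :: w, n =>
    haveI := fun m => decTyped m w n
    decidable_of_iff _ typed_cons.symm

theorem Typed.append {m a n : ℕ} {u v : P.Word} (hu : P.Typed m u a) (hv : P.Typed a v n) :
    P.Typed m (u ++ v) n := typed_append.2 ⟨a, hu, hv⟩

theorem Typed.left {m n : ℕ} {w : P.Word} (h : P.Typed m w n) (k : ℕ) :
    P.Typed (k + m) (shift k w) (k + n) := by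
  induction w generalizing m with
  | nil => simpa [Typed, shift] using h
  | cons s w ih =>
    obtain ⟨j, g⟩ := s
    obtain ⟨r, rfl, h⟩ := h
    refine ⟨r, by simp; omega, ?_⟩
    have := ih h
    rw [show k + (j + P.tgt g + r) = k + j + P.tgt g + r by omega] at this
    exact this

theorem Typed.right {m n : ℕ} {w : P.Word} (h : P.Typed m w n) (k : ℕ) :
    P.Typed (m + k) w (n + k) := by
  induction w generalizing m with
  | nil => simpa [Typed] using h
  | cons s w ih =>
    obtain ⟨j, g⟩ := s
    obtain ⟨r, rfl, h⟩ := h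
    refine ⟨r + k, by omega, ?_⟩
    have := ih h
    rwa [show j + P.tgt g + r + k = j + P.tgt g + (r + k) by omega] at this

theorem Typed.cast {m n m' n' : ℕ} {w : P.Word} (h : P.Typed m w n) (hm : m = m')
    (hn : n = n') : P.Typed m' w n' := by subst hm hn; exact h

theorem typed_nil {m n : ℕ} (h : m = n) : P.Typed m [] n := h

theorem typed_gen (k : ℕ) (g : P.Gen) (r : ℕ) :
    P.Typed (k + P.src g + r) [(k, g)] (k + P.tgt g + r) := ⟨r, rfl, rfl⟩

@[simp] theorem shift_nil {G : Type} (k : ℕ) : shift k ([] : List (ℕ × G)) = [] := rfl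

@[simp] theorem shift_cons {G : Type} (k : ℕ) (s : ℕ × G) (w : List (ℕ × G)) :
    shift k (s :: w) = (k + s.1, s.2) :: shift k w := rfl

@[simp] theorem shift_append {G : Type} (k : ℕ) (u v : List (ℕ × G)) :
    shift k (u ++ v) = shift k u ++ shift k v := by simp [shift]

@[simp] theorem shift_shift {G : Type} (j k : ℕ) (w : List (ℕ × G)) :
    shift j (shift k w) = shift (j + k) w := by
  simp [shift, Function.comp_def, Nat.add_assoc]

@[simp] theorem shift_zero {G : Type} (w : List (ℕ × G)) : shift 0 w = w := by
  simp [shift]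

namespace Diagram

/-- The trivial diagram. -/
def id (m : ℕ) : P.Diagram m m := ⟨[], rfl⟩

/-- Stacking: `E` is put on top of `D`. -/
def comp {m a n : ℕ} (D : P.Diagram m a) (E : P.Diagram a n) : P.Diagram m n :=
  ⟨D.word ++ E.word, D.typed.append E.typed⟩

/-- `k` vertical strands on the left. -/
def whiskerLeft (k : ℕ) {m n : ℕ} (D : P.Diagram m n) : P.Diagram (k + m) (k + n) :=
  ⟨shift k D.word, D.typed.left k⟩

/-- `k` vertical strands on the right. -/
def whiskerRight {m n : ℕ} (D : P.Diagram m n) (k : ℕ) : P.Diagram (m + k) (n + k) :=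
  ⟨D.word, D.typed.right k⟩

end Diagram

theorem cls_eq {m n : ℕ} {D E : P.Diagram m n} (h : D.word = E.word) : cls D = cls E := by
  cases D; cases E; cases h; rfl

namespace Hom

def comp {m a n : ℕ} (f : P.Hom m a) (g : P.Hom a n) : P.Hom m n :=
  Quot.map₂ Diagram.comp
    (fun D E E' ⟨k, u, v, l, r, h, h1, h2⟩ =>
      ⟨k, D.word ++ u, v, l, r, h, by simp [Diagram.comp, h1], by simp [Diagram.comp, h2]⟩)
    (fun D D' E ⟨k, u, v, l, r, h, h1, h2⟩ =>
      ⟨k, u, v ++ E.word, l, r, h, by simp [Diagram.comp, h1], by simp [Diagram.comp, h2]⟩) f g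

def whiskerLeft (k : ℕ) {m n : ℕ} (f : P.Hom m n) : P.Hom (k + m) (k + n) :=
  Quot.map (Diagram.whiskerLeft k)
    (fun D D' ⟨j, u, v, l, r, h, h1, h2⟩ =>
      ⟨k + j, shift k u, shift k v, l, r, h, by simp [Diagram.whiskerLeft, h1],
        by simp [Diagram.whiskerLeft, h2]⟩) f

def whiskerRight {m n : ℕ} (f : P.Hom m n) (k : ℕ) : P.Hom (m + k) (n + k) :=
  Quot.map (fun D => D.whiskerRight k)
    (fun _ _ ⟨j, u, v, l, r, h, h1, h2⟩ => ⟨j, u, v, l, r, h, h1, h2⟩) f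

end Hom

instance : Category P.Cat where
  Hom m n := P.Hom m n
  id m := cls (Diagram.id (P := P) m)
  comp f g := Hom.comp f g
  id_comp := by rintro m n ⟨D⟩; exact cls_eq rfl
  comp_id := by rintro m n ⟨D⟩; exact cls_eq (by simp [Diagram.comp, Diagram.id])
  assoc := by rintro a b c d ⟨D⟩ ⟨E⟩ ⟨F⟩; exact cls_eq (by simp [Diagram.comp])

/-- Words representing the same morphism `m ⟶ n`. -/
def Eqv (m n : ℕ) (w w' : P.Word) : Prop :=
  ∃ (h : P.Typed m w n) (h' : P.Typed m w' n), cls ⟨w, h⟩ = cls ⟨w', h'⟩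

namespace Eqv

theorem refl {m n : ℕ} {w : P.Word} (h : P.Typed m w n) : Eqv m n w w := ⟨h, h, rfl⟩

theorem symm {m n : ℕ} {w w' : P.Word} (h : Eqv m n w w') : Eqv m n w' w :=
  ⟨h.2.1, h.1, h.2.2.symm⟩

theorem trans {m n : ℕ} {w w' w'' : P.Word} (h : Eqv m n w w') (h' : Eqv m n w' w'') :
    Eqv m n w w'' := ⟨h.1, h'.2.1, h.2.2.trans h'.2.2⟩

theorem append {m a n : ℕ} {u u' v v' : P.Word} (h : Eqv m a u u') (h' : Eqv a n v v') :
    Eqv m n (u ++ v) (u' ++ v') :=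
  ⟨h.1.append h'.1, h.2.1.append h'.2.1, congrArg₂ Hom.comp h.2.2 h'.2.2⟩

theorem left {m n : ℕ} {w w' : P.Word} (h : Eqv m n w w') (k : ℕ) :
    Eqv (k + m) (k + n) (shift k w) (shift k w') :=
  ⟨h.1.left k, h.2.1.left k, congrArg (Hom.whiskerLeft k) h.2.2⟩

theorem right {m n : ℕ} {w w' : P.Word} (h : Eqv m n w w') (k : ℕ) :
    Eqv (m + k) (n + k) w w' :=
  ⟨h.1.right k, h.2.1.right k, congrArg (fun f => Hom.whiskerRight f k) h.2.2⟩

theorem cast {m n m' n' : ℕ} {w w' : P.Word} (h : Eqv m n w w') (hm : m = m')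
    (hn : n = n') : Eqv m' n' w w' := by subst hm hn; exact h

theorem move {m n : ℕ} {l r : P.Word} (h : P.Move l r) (hl : P.Typed m l n)
    (hr : P.Typed m r n) : Eqv m n l r :=
  ⟨hl, hr, Quot.sound ⟨0, [], [], l, r, h, by simp, by simp⟩⟩

theorem exchange (g h : P.Gen) (d : ℕ) (r : ℕ) :
    Eqv (P.src g + d + P.src h + r) (P.tgt g + d + P.tgt h + r)
      [(0, g), (P.tgt g + d, h)] [(P.src g + d, h), (0, g)] := by
  refine move (.exchange g h d) ?_ ?_
  · exact ⟨d + P.src h + r, by omega, r, by omega, rfl⟩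
  · exact ⟨r, by omega, d + P.tgt h + r, by omega, by simp [Typed]; omega⟩

/-- exchange of a generator with a diagram far on its right -/
theorem exchange_gen (g : P.Gen) {c d : ℕ} {v : P.Word} (hv : P.Typed c v d) :
    Eqv (P.src g + c) (P.tgt g + d) ([(0, g)] ++ shift (P.tgt g) v)
      (shift (P.src g) v ++ [(0, g)]) := by
  induction v generalizing c with
  | nil =>
    obtain rfl : c = d := hv
    exact refl ⟨c, by omega, by simp [Typed]⟩
  | cons s v ih =>
    obtain ⟨k, h⟩ := s
    obtain ⟨r, rfl, hv⟩ := hv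
    have e1 : Eqv (P.src g + (k + P.src h + r)) (P.tgt g + (k + P.tgt h + r))
        [(0, g), (P.tgt g + k, h)] [(P.src g + k, h), (0, g)] :=
      (exchange g h k r).cast (by omega) (by omega)
    have e2 := e1.append (refl (hv.left (P.tgt g)))
    have e3 : Eqv (P.src g + (k + P.src h + r)) (P.src g + (k + P.tgt h + r))
        [(P.src g + k, h)] [(P.src g + k, h)] :=
      refl ((typed_gen (P.src g + k) h r).cast (by omega) (by omega))
    have e4 := e3.append (ih hv)
    simpa using e2.trans e4

/-- Exchange of two diagrams side by side. -/
theorem interchange {a b c d : ℕ} {u v : P.Word} (hu : P.Typed a u b) (hv : P.Typed c v d) :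
    Eqv (a + c) (b + d) (u ++ shift b v) (shift a v ++ u) := by
  induction u generalizing a with
  | nil =>
    obtain rfl : a = b := hu
    simpa using refl (hv.left a)
  | cons s u ih =>
    obtain ⟨k, g⟩ := s
    obtain ⟨r, rfl, hu⟩ := hu
    have e1 : Eqv (k + P.src g + r + c) (k + P.tgt g + r + c) [(k, g)] [(k, g)] :=
      refl ((typed_gen k g (r + c)).cast (by omega) (by omega))
    have e2 := e1.append (ih hu)
    have e3 := ((exchange_gen g (hv.left r)).left k).append
      (refl ((hu.right d).cast (m' := k + (P.tgt g + (r + d))) (by omega) rfl))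
    have e4 := e3.cast (m' := k + P.src g + r + c) (by omega) rfl
    simp only [shift_append, shift_shift, shift_cons, shift_nil, Nat.add_zero, ← Nat.add_assoc]
      at e2 e4
    simpa using e2.trans (by simpa using e4)

end Eqv

theorem hom_ext_word {m n : ℕ} {D E : P.Diagram m n} (h : Eqv m n D.word E.word) :
    cls D = cls E := h.2.2

theorem tensor_comp_aux {a b c d e f : ℕ} (D : P.Diagram a b) (E : P.Diagram d e)
    (F : P.Diagram b c) (H : P.Diagram e f) :
    Eqv (a + d) (c + f) ((D.word ++ shift b E.word) ++ (F.word ++ shift c H.word))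
      ((D.word ++ F.word) ++ shift c (E.word ++ H.word)) := by
  have e := Eqv.interchange F.typed E.typed
  have e1 := ((Eqv.refl (D.typed.right _)).append e.symm).append (Eqv.refl (H.typed.left _))
  simpa using e1

theorem assoc_aux (y z : ℕ) (u v w : P.Word) :
    ((u ++ shift y v) ++ shift (y + z) w) ++ [] =
      [] ++ (u ++ shift y (v ++ shift z w)) := by simp

/-- The presented category is a (strict) monoidal category; the tensor product is juxtaposition. -/
instance : MonoidalCategory P.Cat where
  tensorObj m n := (Nat.add m n : ℕ)
  tensorUnit := (0 : ℕ)
  whiskerLeft k _ _ f := Hom.whiskerLeft k f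
  whiskerRight f k := Hom.whiskerRight f k
  tensorHom {a b c d} f g := Hom.comp (Hom.whiskerRight f c) (Hom.whiskerLeft b g)
  associator a b c :=
    { hom := cls ⟨[], Nat.add_assoc a b c⟩
      inv := cls ⟨[], (Nat.add_assoc a b c).symm⟩
      hom_inv_id := rfl
      inv_hom_id := rfl }
  leftUnitor a :=
    { hom := cls ⟨[], Nat.zero_add a⟩
      inv := cls ⟨[], (Nat.zero_add a).symm⟩
      hom_inv_id := rfl
      inv_hom_id := rfl }
  rightUnitor a :=
    { hom := cls ⟨[], Nat.add_zero a⟩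
      inv := cls ⟨[], (Nat.add_zero a).symm⟩
      hom_inv_id := rfl
      inv_hom_id := rfl }
  tensorHom_def := by intros; rfl
  id_tensorHom_id := by intros; rfl
  tensorHom_comp_tensorHom := by
    rintro a b c d e f ⟨D⟩ ⟨E⟩ ⟨F⟩ ⟨H⟩
    exact hom_ext_word (P := P) (tensor_comp_aux D E F H)
  whiskerLeft_id := by intros; rfl
  id_whiskerRight := by intros; rfl
  associator_naturality := by
    rintro _ _ _ _ _ _ ⟨D⟩ ⟨E⟩ ⟨F⟩
    exact cls_eq (P := P) (assoc_aux _ _ D.word E.word F.word)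
  leftUnitor_naturality := by
    rintro _ _ ⟨D⟩
    exact cls_eq (P := P) (by simp [Diagram.comp, Diagram.whiskerLeft])
  rightUnitor_naturality := by
    rintro _ _ ⟨D⟩
    exact cls_eq (P := P) (by simp [Diagram.comp, Diagram.whiskerRight])
  pentagon := by intros; rfl
  triangle := by intros; rfl


/-! ## Braidings -/

/-- The `n` crossings `x` by which the strand on the left of `n` strands goes to their right. -/
def passRight {G : Type} (x : G) (n : ℕ) : List (ℕ × G) := (List.range n).map fun i => (i, x)

/-- The `n` crossings `x` by which the strand on the right of `n` strands goes to their left. -/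
def passLeft {G : Type} (x : G) (n : ℕ) : List (ℕ × G) := (passRight x n).reverse

/-- The crossing of `m` strands with `n` strands, all elementary crossings being `x`. -/
def braidWord {G : Type} (x : G) : ℕ → ℕ → List (ℕ × G)
  | 0, _ => []
  | m + 1, n => shift m (passRight x n) ++ braidWord x m n

/-- Crossings `pos` and `neg` in a presentation which make the presented category braided. -/
class Braids (P : Presentation) where
  pos : P.Gen
  neg : P.Gen
  src_pos : P.src pos = 2
  tgt_pos : P.tgt pos = 2
  src_neg : P.src neg = 2
  tgt_neg : P.tgt neg = 2
  pos_neg : Eqv (P := P) 2 2 [(0, pos), (0, neg)] []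
  neg_pos : Eqv (P := P) 2 2 [(0, neg), (0, pos)] []
  pass_over (g : P.Gen) : Eqv (P := P) (1 + P.src g) (P.tgt g + 1)
    ([(1, g)] ++ passRight pos (P.tgt g)) (passRight pos (P.src g) ++ [(0, g)])
  pass_under (g : P.Gen) : Eqv (P := P) (P.src g + 1) (1 + P.tgt g)
    ([(0, g)] ++ passLeft pos (P.tgt g)) (passLeft pos (P.src g) ++ [(1, g)])

theorem passRight_succ {G : Type} (x : G) (n : ℕ) :
    passRight x (n + 1) = passRight x n ++ [(n, x)] := by
  simp [passRight, List.range_succ]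

theorem passRight_add {G : Type} (x : G) (a b : ℕ) :
    passRight x (a + b) = passRight x a ++ shift a (passRight x b) := by
  induction b with
  | zero => simp [passRight]
  | succ b ih => rw [← Nat.add_assoc, passRight_succ, ih, passRight_succ]; simp

theorem passLeft_add {G : Type} (x : G) (a b : ℕ) :
    passLeft x (a + b) = shift a (passLeft x b) ++ passLeft x a := by
  simp [passLeft, passRight_add, shift]

theorem braidWord_one {G : Type} (x : G) (m : ℕ) : braidWord x m 1 = passLeft x m := by
  induction m with
  | zero => rfl
  | succ m ih => rw [passLeft_add, braidWord, ih]; rfl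

theorem braidWord_zero {G : Type} (x : G) (m : ℕ) : braidWord x m 0 = [] := by
  induction m with
  | zero => rfl
  | succ m ih => rw [braidWord, ih]; rfl

theorem braidWord_add_left {G : Type} (x : G) (a b n : ℕ) :
    braidWord x (a + b) n = shift a (braidWord x b n) ++ braidWord x a n := by
  induction b with
  | zero => simp [braidWord]
  | succ b ih => rw [← Nat.add_assoc, braidWord, ih, braidWord]; simp

section Braids

variable [B : Braids P]

theorem typed_passRight (n : ℕ) : P.Typed (1 + n) (passRight B.pos n) (n + 1) := by
  induction n with
  | zero => rfl
  | succ n ih =>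
    rw [passRight_succ]
    exact ((ih.right 1).cast (by omega) rfl).append
      ((typed_gen n B.pos 0).cast (by simp [B.src_pos]) (by simp [B.tgt_pos]))

theorem typed_passLeft (n : ℕ) : P.Typed (n + 1) (passLeft B.pos n) (1 + n) := by
  induction n with
  | zero => rfl
  | succ n ih =>
    rw [passLeft_add]
    refine Typed.append (a := n + 2) ?_ ((ih.right 1).cast (by omega) (by omega))
    exact (typed_gen n B.pos 0).cast (by simp [B.src_pos]) (by simp [B.tgt_pos])

theorem typed_braidWord (m n : ℕ) : P.Typed (m + n) (braidWord B.pos m n) (n + m) := by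
  induction m with
  | zero => exact Nat.zero_add n
  | succ m ih =>
    exact ((((typed_passRight n).left m).cast (by omega) rfl).append
      ((ih.right 1).cast (by omega) (by omega)))

theorem eqv_over {a b : ℕ} {w : P.Word} (h : P.Typed a w b) :
    Eqv (1 + a) (b + 1) (shift 1 w ++ passRight B.pos b) (passRight B.pos a ++ w) := by
  induction w generalizing a with
  | nil =>
    obtain rfl : a = b := h
    simpa using Eqv.refl (typed_passRight a)
  | cons s w ih =>
    obtain ⟨k, g⟩ := s
    obtain ⟨r, rfl, h⟩ := h
    have hg : Eqv (1 + (k + P.src g + r)) (1 + (k + P.tgt g + r)) [(1 + k, g)] [(1 + k, g)] :=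
      .refl ((typed_gen (1 + k) g r).cast (by omega) (by omega))
    refine (hg.append (ih h)).trans ?_
    -- commute the generator past the crossings
    have t1 : Eqv (1 + k + P.src g) (k + 1 + P.tgt g)
        (passRight B.pos k ++ shift (k + 1) [(0, g)]) (shift (1 + k) [(0, g)] ++ passRight B.pos k) :=
      Eqv.interchange (typed_passRight k) ((typed_gen 0 g 0).cast (by omega) (by omega))
    have t2 := (B.pass_over g).left k
    have t3 : Eqv (P.src g + (1 + r)) (P.tgt g + (r + 1))
        ([(0, g)] ++ shift (P.tgt g) (passRight B.pos r))
        (shift (P.src g) (passRight B.pos r) ++ [(0, g)]) :=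
      Eqv.interchange ((typed_gen 0 g 0).cast (by omega) (by omega)) (typed_passRight r)
    rw [passRight_add _ (k + P.tgt g), passRight_add _ k, passRight_add _ (k + P.src g),
      passRight_add _ k]
    have s1 : Eqv (1 + (k + P.src g + r)) (k + P.tgt g + r + 1)
        (((shift (1 + k) [(0, g)] ++ passRight B.pos k) ++ shift k (passRight B.pos (P.tgt g))) ++
          shift (k + P.tgt g) (passRight B.pos r))
        (((passRight B.pos k ++ shift (k + 1) [(0, g)]) ++ shift k (passRight B.pos (P.tgt g))) ++
          shift (k + P.tgt g) (passRight B.pos r)) := by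
      refine Eqv.append (a := k + P.tgt g + (1 + r)) (Eqv.append (a := k + 1 + P.tgt g + r) ?_ ?_) ?_
      · exact (t1.symm.right r).cast (by omega) (by omega)
      · exact .refl ((((typed_passRight (P.tgt g)).left k).right r).cast (by omega) (by omega))
      · exact .refl (((typed_passRight r).left (k + P.tgt g)).cast (by omega) (by omega))
    have s2 : Eqv (1 + (k + P.src g + r)) (k + P.tgt g + r + 1)
        ((passRight B.pos k ++ shift k ([(1, g)] ++ passRight B.pos (P.tgt g))) ++
          shift (k + P.tgt g) (passRight B.pos r))
        ((passRight B.pos k ++ shift k (passRight B.pos (P.src g) ++ [(0, g)])) ++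
          shift (k + P.tgt g) (passRight B.pos r)) := by
      refine Eqv.append (a := k + P.tgt g + (1 + r))
        (Eqv.append (a := k + 1 + P.src g + r) ?_ ?_) ?_
      · exact .refl (((typed_passRight k).right (P.src g + r)).cast (by omega) (by omega))
      · exact (t2.right r).cast (by omega) (by omega)
      · exact .refl (((typed_passRight r).left (k + P.tgt g)).cast (by omega) (by omega))
    have s3 : Eqv (1 + (k + P.src g + r)) (k + P.tgt g + r + 1)
        ((passRight B.pos k ++ shift k (passRight B.pos (P.src g))) ++
          shift k ([(0, g)] ++ shift (P.tgt g) (passRight B.pos r)))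
        ((passRight B.pos k ++ shift k (passRight B.pos (P.src g))) ++
          shift k (shift (P.src g) (passRight B.pos r) ++ [(0, g)])) := by
      refine Eqv.append (a := k + (P.src g + (1 + r)))
        (Eqv.append (a := k + 1 + P.src g + r) ?_ ?_) ?_
      · exact .refl (((typed_passRight k).right (P.src g + r)).cast (by omega) (by omega))
      · exact .refl ((((typed_passRight (P.src g)).left k).right r).cast (by omega) (by omega))
      · exact (t3.left k).cast (by omega) (by omega)
    have e : Eqv (k + P.tgt g + r + 1) (b + 1) w w := .refl (h.right 1)
    have s4 := (s1.trans ((by simpa [Nat.add_comm 1 k] using s2))).trans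
      (by simpa [Nat.add_comm 1 k] using s3)
    have s5 := (s4.append e)
    simpa using s5

theorem eqv_under {a b : ℕ} {w : P.Word} (h : P.Typed a w b) :
    Eqv (a + 1) (1 + b) (w ++ passLeft B.pos b) (passLeft B.pos a ++ shift 1 w) := by
  induction w generalizing a with
  | nil =>
    obtain rfl : a = b := h
    simpa using Eqv.refl (typed_passLeft a)
  | cons s w ih =>
    obtain ⟨k, g⟩ := s
    obtain ⟨r, rfl, h⟩ := h
    have hg : Eqv (k + P.src g + r + 1) (k + P.tgt g + r + 1) [(k, g)] [(k, g)] :=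
      .refl ((typed_gen k g (r + 1)).cast (by omega) (by omega))
    refine (hg.append (ih h)).trans ?_
    have t1 : Eqv (k + 1 + P.src g) (1 + k + P.tgt g)
        (passLeft B.pos k ++ shift (1 + k) [(0, g)]) (shift (k + 1) [(0, g)] ++ passLeft B.pos k) :=
      Eqv.interchange (typed_passLeft k) ((typed_gen 0 g 0).cast (by omega) (by omega))
    have t2 := (B.pass_under g).left k
    have t3 : Eqv (P.src g + (r + 1)) (P.tgt g + (1 + r))
        ([(0, g)] ++ shift (P.tgt g) (passLeft B.pos r))
        (shift (P.src g) (passLeft B.pos r) ++ [(0, g)]) :=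
      Eqv.interchange ((typed_gen 0 g 0).cast (by omega) (by omega)) (typed_passLeft r)
    rw [passLeft_add _ (k + P.tgt g), passLeft_add _ k, passLeft_add _ (k + P.src g),
      passLeft_add _ k]
    have s1 : Eqv (k + P.src g + r + 1) (1 + (k + P.tgt g + r))
        (shift k ([(0, g)] ++ shift (P.tgt g) (passLeft B.pos r)) ++
          (shift k (passLeft B.pos (P.tgt g)) ++ passLeft B.pos k))
        (shift k (shift (P.src g) (passLeft B.pos r) ++ [(0, g)]) ++
          (shift k (passLeft B.pos (P.tgt g)) ++ passLeft B.pos k)) := by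
      refine Eqv.append (a := k + (P.tgt g + (1 + r))) ?_
        (Eqv.append (a := k + 1 + P.tgt g + r) ?_ ?_)
      · exact (t3.left k).cast (by omega) (by omega)
      · exact .refl ((((typed_passLeft (P.tgt g)).left k).right r).cast (by omega) (by omega))
      · exact .refl (((typed_passLeft k).right (P.tgt g + r)).cast (by omega) (by omega))
    have s2 : Eqv (k + P.src g + r + 1) (1 + (k + P.tgt g + r))
        (shift (k + P.src g) (passLeft B.pos r) ++
          (shift k ([(0, g)] ++ passLeft B.pos (P.tgt g)) ++ passLeft B.pos k))
        (shift (k + P.src g) (passLeft B.pos r) ++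
          (shift k (passLeft B.pos (P.src g) ++ [(1, g)]) ++ passLeft B.pos k)) := by
      refine Eqv.append (a := k + P.src g + (1 + r)) ?_
        (Eqv.append (a := k + 1 + P.tgt g + r) ?_ ?_)
      · exact .refl (((typed_passLeft r).left (k + P.src g)).cast (by omega) (by omega))
      · exact (t2.right r).cast (by omega) (by omega)
      · exact .refl (((typed_passLeft k).right (P.tgt g + r)).cast (by omega) (by omega))
    have s3 : Eqv (k + P.src g + r + 1) (1 + (k + P.tgt g + r))
        (shift (k + P.src g) (passLeft B.pos r) ++
          (shift k (passLeft B.pos (P.src g)) ++ (shift (k + 1) [(0, g)] ++ passLeft B.pos k)))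
        (shift (k + P.src g) (passLeft B.pos r) ++
          (shift k (passLeft B.pos (P.src g)) ++ (passLeft B.pos k ++ shift (1 + k) [(0, g)]))) := by
      refine Eqv.append (a := k + P.src g + (1 + r)) ?_
        (Eqv.append (a := k + 1 + P.src g + r) ?_ ?_)
      · exact .refl (((typed_passLeft r).left (k + P.src g)).cast (by omega) (by omega))
      · exact .refl ((((typed_passLeft (P.src g)).left k).right r).cast (by omega) (by omega))
      · exact (t1.symm.right r).cast (by omega) (by omega)
    have e : Eqv (1 + (k + P.tgt g + r)) (1 + b) (shift 1 w) (shift 1 w) := .refl (h.left 1)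
    have s4 := (s1.trans ((by simpa [Nat.add_comm 1 k] using s2))).trans
      (by simpa [Nat.add_comm 1 k] using s3)
    have s5 := (s4.append e)
    simpa [Nat.add_comm 1 k] using s5

theorem braid_natural_right (m : ℕ) {a b : ℕ} {w : P.Word} (h : P.Typed a w b) :
    Eqv (m + a) (b + m) (shift m w ++ braidWord B.pos m b) (braidWord B.pos m a ++ w) := by
  induction m with
  | zero => simpa [braidWord] using Eqv.refl (h.cast (Nat.zero_add a).symm rfl)
  | succ m ih =>
    have e1 := (eqv_over h).left m
    have e2 := Eqv.append (e1.cast rfl (by omega)) (.refl ((typed_braidWord m b).right 1))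
    have e3 := Eqv.append (.refl ((typed_passRight a).left m))
      ((ih.right 1).cast (m' := m + (a + 1)) (by omega) rfl)
    have e4 := e2.trans (by simpa using e3)
    simpa [braidWord] using e4.cast (m' := m + 1 + a) (n' := b + (m + 1)) (by omega) (by omega)

theorem braidWord_succ_right (m n : ℕ) :
    Eqv (m + (n + 1)) (n + 1 + m) (braidWord B.pos m (n + 1))
      (braidWord B.pos m n ++ shift n (braidWord B.pos m 1)) := by
  induction m with
  | zero => exact .refl (typed_braidWord 0 (n + 1))
  | succ m ih =>
    have e0 : Eqv (m + 1 + (n + 1)) (m + (n + 1) + 1) (shift m (passRight B.pos (n + 1)))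
        (shift m (passRight B.pos (n + 1))) :=
      .refl (((typed_passRight (n + 1)).left m).cast (by omega) (by omega))
    have e1 := e0.append ((ih.right 1).cast (m' := m + (n + 1) + 1) (by omega) rfl)
    have e2 : Eqv (m + n + 2) (n + m + 2) (braidWord B.pos m n ++ shift (n + m) [(0, B.pos)])
        (shift (m + n) [(0, B.pos)] ++ braidWord B.pos m n) :=
      Eqv.interchange (typed_braidWord m n)
        ((typed_gen 0 B.pos 0).cast (by simp [B.src_pos]) (by simp [B.tgt_pos]))
    have e3 : Eqv (m + 1 + (n + 1)) (m + n + 2) (shift m (passRight B.pos n))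
        (shift m (passRight B.pos n)) :=
      .refl ((((typed_passRight n).left m).right 1).cast (by omega) (by omega))
    have e4 : Eqv (n + m + 2) (n + 1 + (m + 1)) (shift n (braidWord B.pos m 1))
        (shift n (braidWord B.pos m 1)) :=
      .refl ((((typed_braidWord m 1).left n).right 1).cast (by omega) (by omega))
    have e5 := (e3.append (e2.symm.append e4)).cast (n' := n + 1 + (m + 1)) rfl rfl
    have e6 := (e1.cast (n' := n + 1 + (m + 1)) rfl (by omega)).trans
      (w'' := shift m (passRight B.pos n) ++ ((braidWord B.pos m n ++
        shift (n + m) [(0, B.pos)]) ++ shift n (braidWord B.pos m 1)))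
      (by simpa [passRight_succ] using e5)
    have e7 : braidWord B.pos (m + 1) 1 = [(m, B.pos)] ++ braidWord B.pos m 1 := by
      simp [braidWord, passRight]
    rw [e7]
    simpa [braidWord] using e6

theorem braidWord_add_right (m n k : ℕ) :
    Eqv (m + (n + k)) (n + k + m) (braidWord B.pos m (n + k))
      (braidWord B.pos m n ++ shift n (braidWord B.pos m k)) := by
  induction k with
  | zero => simpa [braidWord_zero] using Eqv.refl (typed_braidWord m n)
  | succ k ih =>
    have e1 := braidWord_succ_right (B := B) m (n + k)
    have e2 := Eqv.append ((ih.right 1).cast (m' := m + (n + (k + 1)))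
        (n' := n + k + (m + 1)) (by omega) (by omega))
      (.refl ((typed_braidWord (B := B) m 1).left (n + k)))
    have e3 := Eqv.append (.refl (((typed_braidWord (B := B) m n).right (k + 1)).cast
        (n' := n + m + (k + 1)) rfl rfl))
      (((braidWord_succ_right (B := B) m k).left n).cast (m' := n + m + (k + 1)) (by omega) rfl)
    have e4 := (e1.trans (e2.cast (n' := n + (k + 1) + m) rfl (by omega))).trans
      (w'' := braidWord B.pos m n ++ (shift n (braidWord B.pos m k) ++
        shift (n + k) (braidWord B.pos m 1)))
      (by simpa [Nat.add_assoc] using Eqv.refl ((e2.cast (n' := n + (k + 1) + m) rfl (by omega)).2.1))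
    refine e4.trans ?_
    simpa [Nat.add_assoc] using (e3.cast (m' := m + (n + (k + 1))) (n' := n + (k + 1) + m) (by omega)
      (by omega)).symm

theorem braid_natural_left (m : ℕ) {a b : ℕ} {w : P.Word} (h : P.Typed a w b) :
    Eqv (a + m) (m + b) (w ++ braidWord B.pos b m) (braidWord B.pos a m ++ shift m w) := by
  induction m with
  | zero => simpa [braidWord_zero] using Eqv.refl (h.cast rfl (Nat.zero_add b).symm)
  | succ m ih =>
    have e1 := Eqv.append (.refl (h.right (m + 1))) (braidWord_succ_right (B := B) b m)
    have e2 := Eqv.append (ih.right 1)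
      (.refl (((typed_braidWord (B := B) b 1).left m).cast (by omega) rfl))
    have e3 := Eqv.append (.refl ((typed_braidWord (B := B) a m).right 1))
      (((eqv_under h).left m).cast (m' := m + a + 1) (by omega) rfl)
    have e4 := Eqv.append (braidWord_succ_right (B := B) a m)
      (.refl ((h.left (m + 1)).cast (by omega : _ = m + 1 + a) rfl))
    have e5 := e2.trans (by simpa [braidWord_one] using e3)
    have e6 := e1.trans (by simpa using e5.cast (by omega) (by omega))
    exact e6.trans (by simpa [braidWord_one] using e4.symm)

/-- The inverse of a braid word all of whose crossings are positive. -/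
def revNeg (w : P.Word) : P.Word := (w.map fun s => (s.1, B.neg)).reverse

theorem revNeg_inv {a b : ℕ} {w : P.Word} (h : P.Typed a w b) (hw : ∀ s ∈ w, s.2 = B.pos) :
    P.Typed b (revNeg w) a ∧ Eqv a a (w ++ revNeg w) [] ∧ Eqv b b (revNeg w ++ w) [] := by
  induction w generalizing a with
  | nil =>
    obtain rfl : a = b := h
    exact ⟨rfl, .refl rfl, .refl rfl⟩
  | cons s w ih =>
    obtain ⟨k, g⟩ := s
    obtain rfl : g = B.pos := hw (k, g) (by simp)
    obtain ⟨r, rfl, h⟩ := h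
    obtain ⟨t, h1, h2⟩ := ih h (fun s hs => hw s (by simp [hs]))
    have tp : P.Typed (k + P.src B.pos + r) [(k, B.pos)] (k + P.tgt B.pos + r) := typed_gen _ _ _
    have tn : P.Typed (k + P.tgt B.pos + r) [(k, B.neg)] (k + P.src B.pos + r) :=
      (typed_gen k B.neg r).cast (by simp [B.src_neg, B.tgt_pos]) (by simp [B.tgt_neg, B.src_pos])
    have e : revNeg (B := B) ((k, B.pos) :: w) = revNeg w ++ [(k, B.neg)] := by simp [revNeg]
    have pn := ((B.pos_neg.left k).right r).cast (m' := k + P.src B.pos + r)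
      (n' := k + P.src B.pos + r) (by simp [B.src_pos]) (by simp [B.src_pos])
    have np := ((B.neg_pos.left k).right r).cast (m' := k + P.tgt B.pos + r)
      (n' := k + P.tgt B.pos + r) (by simp [B.tgt_pos]) (by simp [B.tgt_pos])
    simp only [shift_cons, shift_nil, Nat.add_zero] at pn np
    rw [e]
    refine ⟨t.append tn, ?_, ?_⟩
    · have := Eqv.append (Eqv.append (.refl tp) h1) (.refl tn)
      simpa using this.trans (by simpa using pn)
    · have := Eqv.append (Eqv.append (.refl t) np) (.refl h)
      simpa using this.trans (by simpa using h2)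

theorem mem_braidWord {m n : ℕ} : ∀ s ∈ braidWord B.pos m n, s.2 = B.pos := by
  induction m with
  | zero => simp [braidWord]
  | succ m ih =>
    intro s hs
    rw [braidWord, List.mem_append] at hs
    rcases hs with hs | hs
    · simp only [shift, passRight, List.map_map, List.mem_map] at hs
      obtain ⟨i, -, rfl⟩ := hs
      rfl
    · exact ih s hs

theorem hexagon_forward_aux (m n k : ℕ) : Eqv (m + n + k) (n + (k + m))
    ([] ++ (braidWord B.pos m (n + k) ++ []))
    (braidWord B.pos m n ++ ([] ++ shift n (braidWord B.pos m k))) := by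
  have e := (braidWord_add_right (B := B) m n k).cast (m' := m + n + k) (n' := n + (k + m))
    (Nat.add_assoc m n k).symm (Nat.add_assoc n k m)
  simpa using e

theorem hexagon_reverse_aux (m n k : ℕ) : Eqv (m + (n + k)) (k + m + n)
    ([] ++ (braidWord B.pos (m + n) k ++ []))
    (shift m (braidWord B.pos n k) ++ ([] ++ braidWord B.pos m k)) := by
  have e : Eqv (P := P) (m + (n + k)) (k + m + n) (braidWord B.pos (m + n) k)
      (shift m (braidWord B.pos n k) ++ braidWord B.pos m k) := by
    rw [← braidWord_add_left]
    exact .refl ((typed_braidWord (m + n) k).cast (Nat.add_assoc m n k)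
      (Nat.add_assoc k m n).symm)
  simpa using e

/-- The braiding: `m` strands cross `n` strands, all crossings being positive. -/
instance : BraidedCategory P.Cat where
  braiding m n :=
    { hom := cls ⟨braidWord B.pos m n, typed_braidWord (B := B) m n⟩
      inv := cls ⟨revNeg (braidWord B.pos m n), (revNeg_inv (typed_braidWord m n) mem_braidWord).1⟩
      hom_inv_id := (revNeg_inv (typed_braidWord m n) mem_braidWord).2.1.2.2
      inv_hom_id := (revNeg_inv (typed_braidWord m n) mem_braidWord).2.2.2.2 }
  braiding_naturality_right := by
    rintro m _ _ ⟨D⟩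
    exact hom_ext_word (P := P) (braid_natural_right m D.typed)
  braiding_naturality_left := by
    rintro _ _ ⟨D⟩ m
    exact hom_ext_word (P := P) (braid_natural_left m D.typed)
  hexagon_forward m n k := hom_ext_word (P := P) (hexagon_forward_aux (B := B) m n k)
  hexagon_reverse m n k := hom_ext_word (P := P) (hexagon_reverse_aux (B := B) m n k)

end Braids
end Presentation

open Presentation

/-! ## The category of Hopf diagrams -/

/-- The generators of the braided category of antipodal Hopf diagrams: the coproduct `Δ`, the counit
`ε`, `S`, `S⁻¹`, `ω₊ = omega true`, `ω₋ = omega false`, `θ₊ = theta true`, `θ₋ = theta false`, and the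
braiding `τ = tau true` of the generating object with itself and its inverse `tau false`. -/
inductive HopfGen
  | comul | counit | antipode | antipodeInv | omega (s : Bool) | theta (s : Bool) | tau (s : Bool)

namespace HopfGen

def src : HopfGen → ℕ
  | omega _ | tau _ => 2
  | _ => 1

def tgt : HopfGen → ℕ
  | comul | tau _ => 2
  | antipode | antipodeInv => 1
  | _ => 0

end HopfGen

open HopfGen in
/-- The defining relations (words are read from bottom to top, so that the layer applied first
comes first). The first three say that `tau true` is invertible and that each generator can be
moved below or above a strand through the crossings `tau true`, on both sides; since the objects are
the powers of one object, this presents the free strict braided category on the other generators.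
The other relations are those of a coalgebra with `S`, `ω` and `θ`. -/
inductive HopfRel : List (ℕ × HopfGen) → List (ℕ × HopfGen) → Prop
  | tau_inv (s : Bool) : HopfRel [(0, tau s), (0, tau !s)] []
  | natural_right (g : HopfGen) : HopfRel ([(1, g)] ++ passRight (tau true) g.tgt)
      (passRight (tau true) g.src ++ [(0, g)])
  | natural_left (g : HopfGen) : HopfRel ([(0, g)] ++ passLeft (tau true) g.tgt)
      (passLeft (tau true) g.src ++ [(1, g)])
  | coassoc : HopfRel [(0, comul), (1, comul)] [(0, comul), (0, comul)]
  | counit_right : HopfRel [(0, comul), (1, counit)] []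
  | counit_left : HopfRel [(0, comul), (0, counit)] []
  | antipode_inv : HopfRel [(0, antipodeInv), (0, antipode)] []
  | inv_antipode : HopfRel [(0, antipode), (0, antipodeInv)] []
  | antipode_comul : HopfRel [(0, antipode), (0, comul)]
      [(0, comul), (0, tau true), (0, antipode), (1, antipode)]
  | antipode_counit : HopfRel [(0, antipode), (0, counit)] [(0, counit)]
  | antipode_theta (s : Bool) : HopfRel [(0, antipode), (0, theta s)] [(0, theta s)]
  | antipode_omega_left : HopfRel [(0, antipode), (0, omega true)] [(0, omega false)]
  | antipode_omega_right : HopfRel [(1, antipode), (0, omega true)] [(0, omega false)]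
  | inv_omega_left : HopfRel [(0, antipodeInv), (0, omega true)] [(0, tau true), (0, omega false)]
  | inv_omega_right : HopfRel [(1, antipodeInv), (0, omega true)] [(0, tau true), (0, omega false)]

/-- The presentation of the strict braided category generated by one object and the morphisms `Δ`,
`ε`, `ω₊`, `ω₋`, `θ₊`, `θ₋`, `S`, `S⁻¹`, subject to the relations of Hopf diagrams. -/
def hopf : Presentation := ⟨HopfGen, HopfGen.src, HopfGen.tgt, HopfRel⟩

instance : Braids hopf where
  pos := .tau true
  neg := .tau false
  src_pos := rfl
  tgt_pos := rfl
  src_neg := rfl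
  tgt_neg := rfl
  pos_neg := .move (.rel (.tau_inv true)) (by decide) (by decide)
  neg_pos := .move (.rel (.tau_inv false)) (by decide) (by decide)
  pass_over g := .move (.rel (.natural_right g)) (by cases g <;> decide +revert) (by cases g <;> decide +revert)
  pass_under g := .move (.rel (.natural_left g)) (by cases g <;> decide +revert) (by cases g <;> decide +revert)

theorem hopf_counit_comul : Eqv (P := hopf) 1 1 [(0, .comul), (0, .counit)] [] :=
  .move (.rel .counit_left) (by decide) (by decide)

theorem hopf_comul_counit : Eqv (P := hopf) 1 1 [(0, .comul), (1, .counit)] [] :=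
  .move (.rel .counit_right) (by decide) (by decide)

theorem hopf_coassoc : Eqv (P := hopf) 1 3 [(0, .comul), (1, .comul)]
    [(0, .comul), (0, .comul)] :=
  .move (.rel .coassoc) (by decide) (by decide)

/-- The generating object is a coalgebra. -/
instance : ComonObj (C := hopf.Cat) (1 : ℕ) where
  counit := cls (P := hopf) ⟨[(0, .counit)], ⟨0, rfl, rfl⟩⟩
  comul := cls (P := hopf) ⟨[(0, .comul)], ⟨0, rfl, rfl⟩⟩
  counit_comul := hopf_counit_comul.2.2
  comul_counit := hopf_comul_counit.2.2
  comul_assoc := hopf_coassoc.2.2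

/-! ## Ribbon tangles -/

/-- The elementary plane diagrams of (unoriented) tangles with blackboard framing: `cup` is a local
minimum, `cap` a local maximum, and `cross s` a crossing in which the strand going from the bottom
left to the top right passes over for `s = true` (positive crossing, when both strands are oriented
upwards) and under for `s = false`. -/
inductive TangleGen
  | cup | cap | cross (s : Bool)

namespace TangleGen

def src : TangleGen → ℕ
  | cup => 0
  | _ => 2

def tgt : TangleGen → ℕ
  | cap => 0
  | _ => 2

end TangleGen

open TangleGen in
/-- Isotopy of ribbon tangles on layered plane diagrams: plane deformations (`zigzag_left`,
`zigzag_right`, `cap_slide`, `cup_slide`, besides the exchange of heights, which belongs to `Move`)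
and the ribbon Reidemeister moves `curl` (the curls with the same crossing on the left and on the
right of a strand are equivalent), `cancel` and `triple`. -/
inductive TangleRel : List (ℕ × TangleGen) → List (ℕ × TangleGen) → Prop
  | zigzag_left : TangleRel [(0, cup), (1, cap)] []
  | zigzag_right : TangleRel [(1, cup), (0, cap)] []
  | cap_slide (s : Bool) : TangleRel [(1, cross s), (0, cap)] [(0, cross !s), (1, cap)]
  | cup_slide (s : Bool) : TangleRel [(0, cup), (1, cross s)] [(1, cup), (0, cross !s)]
  | curl (s : Bool) : TangleRel [(1, cup), (0, cross s), (1, cap)] [(0, cup), (1, cross s), (0, cap)]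
  | cancel (s : Bool) : TangleRel [(0, cross s), (0, cross !s)] []
  | triple : TangleRel [(0, cross true), (1, cross true), (0, cross true)]
      [(1, cross true), (0, cross true), (1, cross true)]

/-- The category of ribbon tangles: `m ⟶ n` are the isotopy classes of ribbon tangles with `m` bottom
endpoints and `n` top endpoints. -/
def tangle : Presentation := ⟨TangleGen, TangleGen.src, TangleGen.tgt, TangleRel⟩

theorem tangle_move {m n : ℕ} {w w' : tangle.Word} (k : ℕ) (u v l r : tangle.Word)
    (h : TangleRel l r) (e : w = u ++ shift k l ++ v) (e' : w' = u ++ shift k r ++ v)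
    (t : tangle.Typed m w n) (t' : tangle.Typed m w' n) : Eqv m n w w' :=
  ⟨t, t', Quot.sound ⟨k, u, v, l, r, .rel h, e, e'⟩⟩

section

open TangleGen

theorem over_cup : Eqv (P := tangle) 1 3 [(1, cup), (0, cross true), (1, cross true)]
    [(0, cup)] :=
  (tangle_move (w := [(0, cup), (1, cross false), (1, cross true)]) 0 [] [(1, cross true)] _ _
    (.cup_slide false) rfl rfl (by decide) (by decide)).symm.trans
    (tangle_move 1 [(0, cup)] [] _ _ (.cancel false) rfl rfl (by decide) (by decide))

theorem under_cup : Eqv (P := tangle) 1 3 [(0, cup), (1, cross true), (0, cross true)]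
    [(1, cup)] :=
  (tangle_move (w' := [(1, cup), (0, cross false), (0, cross true)]) 0 [] [(0, cross true)] _ _
    (.cup_slide true) rfl rfl (by decide) (by decide)).trans
    (tangle_move 0 [(1, cup)] [] _ _ (.cancel false) rfl rfl (by decide) (by decide))

theorem over_cap : Eqv (P := tangle) 3 1 [(1, cap)]
    [(0, cross true), (1, cross true), (0, cap)] :=
  ((tangle_move (w' := [(0, cross true), (0, cross false), (1, cap)]) 0 [(0, cross true)] [] _ _
    (.cap_slide true) rfl rfl (by decide) (by decide)).trans
    (tangle_move 0 [] [(1, cap)] _ _ (.cancel true) rfl rfl (by decide) (by decide))).symm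

theorem under_cap : Eqv (P := tangle) 3 1 [(0, cap)]
    [(1, cross true), (0, cross true), (1, cap)] :=
  ((tangle_move (w := [(1, cross true), (1, cross false), (0, cap)]) 0 [(1, cross true)] [] _ _
    (.cap_slide false) rfl rfl (by decide) (by decide)).symm.trans
    (tangle_move 1 [] [(0, cap)] _ _ (.cancel true) rfl rfl (by decide) (by decide))).symm

theorem triple : Eqv (P := tangle) 3 3 [(0, cross true), (1, cross true), (0, cross true)]
    [(1, cross true), (0, cross true), (1, cross true)] :=
  .move (.rel .triple) (by decide) (by decide)

theorem over_neg : Eqv (P := tangle) 3 3 [(1, cross false), (0, cross true), (1, cross true)]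
    [(0, cross true), (1, cross true), (0, cross false)] :=
  (tangle_move (w := [(1, cross false), (0, cross true), (1, cross true), (0, cross true),
      (0, cross false)]) 0 [(1, cross false), (0, cross true), (1, cross true)] [] _ _
    (.cancel true) rfl rfl (by decide) (by decide)).symm.trans
  ((tangle_move (w' := [(1, cross false), (1, cross true), (0, cross true), (1, cross true),
      (0, cross false)]) 0 [(1, cross false)] [(0, cross false)] _ _
    .triple rfl rfl (by decide) (by decide)).trans
  (tangle_move 1 [] [(0, cross true), (1, cross true), (0, cross false)] _ _
    (.cancel false) rfl rfl (by decide) (by decide)))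

theorem under_neg : Eqv (P := tangle) 3 3 [(0, cross false), (1, cross true), (0, cross true)]
    [(1, cross true), (0, cross true), (1, cross false)] :=
  (tangle_move (w := [(0, cross false), (1, cross true), (0, cross true), (1, cross true),
      (1, cross false)]) 1 [(0, cross false), (1, cross true), (0, cross true)] [] _ _
    (.cancel true) rfl rfl (by decide) (by decide)).symm.trans
  ((tangle_move (w := [(0, cross false), (0, cross true), (1, cross true), (0, cross true),
      (1, cross false)]) 0 [(0, cross false)] [(1, cross false)] _ _
    .triple rfl rfl (by decide) (by decide)).symm.trans
  (tangle_move 0 [] [(1, cross true), (0, cross true), (1, cross false)] _ _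
    (.cancel false) rfl rfl (by decide) (by decide)))

instance : Braids tangle where
  pos := cross true
  neg := cross false
  src_pos := rfl
  tgt_pos := rfl
  src_neg := rfl
  tgt_neg := rfl
  pos_neg := .move (.rel (.cancel true)) (by decide) (by decide)
  neg_pos := .move (.rel (.cancel false)) (by decide) (by decide)
  pass_over
    | cup => over_cup
    | cap => over_cap
    | cross true => triple.symm
    | cross false => over_neg
  pass_under
    | cup => under_cup
    | cap => under_cap
    | cross true => triple
    | cross false => under_neg

theorem tangle_counit_comul : Eqv (P := tangle) 2 2 [(1, cup), (0, cap)] [] :=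
  .move (.rel .zigzag_right) (by decide) (by decide)

theorem tangle_comul_counit : Eqv (P := tangle) 2 2 [(1, cup), (2, cap)] [] :=
  tangle_move 1 [] [] _ _ .zigzag_left rfl rfl (by decide) (by decide)

theorem tangle_coassoc : Eqv (P := tangle) 2 6 [(1, cup), (3, cup)] [(1, cup), (1, cup)] := by
  have h : tangle.Move [(0, cup), (2, cup)] [(0, cup), (0, cup)] :=
    Move.exchange (P := tangle) cup cup 0
  exact ⟨by decide, by decide, Quot.sound ⟨1, [], [], _, _, h, rfl, rfl⟩⟩

/-- A pair of neighbouring strands is a coalgebra, with a cup inserted between the two strands as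
coproduct and a cap as counit. -/
instance : ComonObj (C := tangle.Cat) (2 : ℕ) where
  counit := cls (P := tangle) ⟨[(0, cap)], ⟨0, rfl, rfl⟩⟩
  comul := cls (P := tangle) ⟨[(1, cup)], ⟨1, rfl, rfl⟩⟩
  counit_comul := tangle_counit_comul.2.2
  comul_counit := tangle_comul_counit.2.2
  comul_assoc := tangle_coassoc.2.2

end


/-! ## Monoidal categories with objects `0, 1, 2, …` and only endomorphisms -/

/-- Monoids `M 0, M 1, …` with a strictly associative and unital product `M m × M n → M (m + n)`
compatible with the multiplications. -/
class TensorMonoids (M : ℕ → Type) [∀ n, Monoid (M n)] where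
  tmul {m n : ℕ} : M m → M n → M (m + n)
  tmul_mul {m n : ℕ} (a a' : M m) (b b' : M n) : tmul (a * a') (b * b') = tmul a b * tmul a' b'
  one_tmul_one (m n : ℕ) : tmul (1 : M m) (1 : M n) = 1
  tmul_assoc {m n k : ℕ} (a : M m) (b : M n) (c : M k) :
    HEq (tmul (tmul a b) c) (tmul a (tmul b c))
  one_tmul {n : ℕ} (a : M n) : HEq (tmul (1 : M 0) a) a
  tmul_one {n : ℕ} (a : M n) : HEq (tmul a (1 : M 0)) a

/-- The category with objects the natural numbers, without morphisms `m ⟶ n` for `m ≠ n`, and in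
which the endomorphisms of `n` form the monoid `M n`. -/
def EndoCat (_ : ℕ → Type) : Type := ℕ

namespace EndoCat

variable {M : ℕ → Type}

/-- The morphisms. -/
inductive Hom (M : ℕ → Type) : ℕ → ℕ → Type
  | of {n : ℕ} (a : M n) : Hom M n n

/-- The object `n`. -/
def obj (M : ℕ → Type) (n : ℕ) : EndoCat M := n

section

variable [∀ n, Monoid (M n)]

def Hom.id (n : ℕ) : Hom M n n := .of 1

/-- The composition is the product of the monoid: first `a`, then `b` is `b * a`. -/
def Hom.comp {m n k : ℕ} : Hom M m n → Hom M n k → Hom M m k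
  | .of a, .of b => .of (b * a)

theorem Hom.id_comp {m n : ℕ} (f : Hom M m n) : (Hom.id m).comp f = f := by
  obtain ⟨a⟩ := f; exact congrArg Hom.of (mul_one a)

theorem Hom.comp_id {m n : ℕ} (f : Hom M m n) : f.comp (Hom.id n) = f := by
  obtain ⟨a⟩ := f; exact congrArg Hom.of (one_mul a)

theorem Hom.assoc {m n k l : ℕ} (f : Hom M m n) (g : Hom M n k) (h : Hom M k l) :
    (f.comp g).comp h = f.comp (g.comp h) := by
  obtain ⟨a⟩ := f; obtain ⟨b⟩ := g; obtain ⟨c⟩ := h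
  exact congrArg Hom.of (mul_assoc c b a).symm

instance : Category (EndoCat M) where
  Hom m n := Hom M m n
  id n := Hom.id n
  comp f g := Hom.comp f g
  id_comp f := Hom.id_comp f
  comp_id f := Hom.comp_id f
  assoc f g h := Hom.assoc f g h

/-- An element of `M n` as an endomorphism of `n`. -/
def of {n : ℕ} (a : M n) : obj M n ⟶ obj M n := Hom.of a

end

section

variable [∀ n, Monoid (M n)]

/-- The identity of `m = n`. -/
def Hom.ofEq {m n : ℕ} (h : m = n) : Hom M m n := h ▸ Hom.id m

theorem Hom.ofEq_comp {m n k : ℕ} (h : m = n) (h' : n = k) :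
    (Hom.ofEq h : Hom M m n).comp (Hom.ofEq h') = Hom.ofEq (h.trans h') := by
  subst h h'; exact Hom.id_comp _

theorem Hom.of_comp_ofEq {m n : ℕ} {a : M m} {b : M n} (h : m = n) (hab : HEq a b) :
    (Hom.of a).comp (Hom.ofEq h) = (Hom.ofEq h).comp (Hom.of b) := by
  subst h
  obtain rfl := eq_of_heq hab
  exact (Hom.comp_id _).trans (Hom.id_comp _).symm

def isoOfEq {m n : ℕ} (h : m = n) : Iso (C := EndoCat M) m n where
  hom := Hom.ofEq h
  inv := Hom.ofEq h.symm
  hom_inv_id := Hom.ofEq_comp h h.symm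
  inv_hom_id := Hom.ofEq_comp h.symm h

variable [T : TensorMonoids M]

def Hom.tensor {a b c d : ℕ} : Hom M a b → Hom M c d → Hom M (a + c) (b + d)
  | .of x, .of y => .of (T.tmul x y)

theorem Hom.tensor_id (m n : ℕ) : Hom.tensor (Hom.id (M := M) m) (Hom.id n) = Hom.id (m + n) :=
  congrArg Hom.of (T.one_tmul_one m n)

theorem Hom.tensor_comp {a b c a' b' c' : ℕ} (f : Hom M a b) (f' : Hom M a' b') (g : Hom M b c)
    (g' : Hom M b' c') :
    (f.tensor f').comp (g.tensor g') = (f.comp g).tensor (f'.comp g') := by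
  obtain ⟨a⟩ := f; obtain ⟨b⟩ := g; obtain ⟨c⟩ := f'; obtain ⟨d⟩ := g'
  exact congrArg Hom.of (T.tmul_mul b a d c).symm

theorem Hom.ofEq_tensor {a b c d : ℕ} (h : a = b) (h' : c = d) :
    (Hom.ofEq h : Hom M a b).tensor (Hom.ofEq h') = Hom.ofEq (congrArg₂ (· + ·) h h') := by
  subst h h'; exact Hom.tensor_id _ _

theorem Hom.assoc_natural {a b c a' b' c' : ℕ} (f : Hom M a a') (g : Hom M b b')
    (h : Hom M c c') :
    ((f.tensor g).tensor h).comp (Hom.ofEq (Nat.add_assoc a' b' c')) =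
      (Hom.ofEq (Nat.add_assoc a b c)).comp (f.tensor (g.tensor h)) := by
  obtain ⟨x⟩ := f; obtain ⟨y⟩ := g; obtain ⟨z⟩ := h
  exact of_comp_ofEq _ (T.tmul_assoc x y z)

theorem Hom.left_natural {a a' : ℕ} (f : Hom M a a') :
    ((Hom.id 0).tensor f).comp (Hom.ofEq (Nat.zero_add a')) =
      (Hom.ofEq (Nat.zero_add a)).comp f := by
  obtain ⟨x⟩ := f
  exact of_comp_ofEq _ (T.one_tmul x)

theorem Hom.right_natural {a a' : ℕ} (f : Hom M a a') :
    (f.tensor (Hom.id 0)).comp (Hom.ofEq (Nat.add_zero a')) =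
      (Hom.ofEq (Nat.add_zero a)).comp f := by
  obtain ⟨x⟩ := f
  exact of_comp_ofEq _ (T.tmul_one x)

/-- The monoidal category; its associativity and unit isomorphisms are identities. -/
instance : MonoidalCategory (EndoCat M) where
  tensorObj m n := (Nat.add m n : ℕ)
  tensorUnit := (0 : ℕ)
  tensorHom f g := Hom.tensor f g
  whiskerLeft m _ _ f := Hom.tensor (Hom.id m) f
  whiskerRight f m := Hom.tensor f (Hom.id m)
  associator a b c := isoOfEq (Nat.add_assoc a b c)
  leftUnitor a := isoOfEq (Nat.zero_add a)
  rightUnitor a := isoOfEq (Nat.add_zero a)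
  tensorHom_def f g := by
    exact ((Hom.tensor_comp f (Hom.id _) (Hom.id _) g).trans
      (congrArg₂ Hom.tensor (Hom.comp_id f) (Hom.id_comp g))).symm
  id_tensorHom_id _ _ := Hom.tensor_id _ _
  tensorHom_comp_tensorHom f g f' g' := Hom.tensor_comp f g f' g'
  whiskerLeft_id _ _ := Hom.tensor_id _ _
  id_whiskerRight _ _ := Hom.tensor_id _ _
  associator_naturality f g h := Hom.assoc_natural f g h
  leftUnitor_naturality f := Hom.left_natural f
  rightUnitor_naturality f := Hom.right_natural f
  pentagon a b c d := by
    have h1 := Hom.ofEq_tensor (M := M) (Nat.add_assoc a b c) (Eq.refl d)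
    have h2 := Hom.ofEq_tensor (M := M) (Eq.refl a) (Nat.add_assoc b c d)
    have h3 := (Hom.ofEq_comp (M := M) (Nat.add_assoc a (Nat.add b c) d)
      (congrArg (Nat.add a) (Nat.add_assoc b c d)))
    have h4 := Hom.ofEq_comp (M := M) (congrArg (fun x => Nat.add x d) (Nat.add_assoc a b c))
      ((Nat.add_assoc a (Nat.add b c) d).trans (congrArg (Nat.add a) (Nat.add_assoc b c d)))
    have h5 := Hom.ofEq_comp (M := M) (Nat.add_assoc (Nat.add a b) c d)
      (Nat.add_assoc a b (Nat.add c d))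
    exact (congrArg₂ Hom.comp h1 ((congrArg (Hom.comp _) h2).trans h3)).trans (h4.trans h5.symm)
  triangle a b := by
    have h1 := Hom.ofEq_tensor (M := M) (Nat.add_zero a) (Eq.refl b)
    have h2 := Hom.ofEq_tensor (M := M) (Eq.refl a) (Nat.zero_add b)
    have h3 := Hom.ofEq_comp (M := M) (Nat.add_assoc a 0 b)
      (congrArg (Nat.add a) (Nat.zero_add b))
    exact ((congrArg (Hom.comp _) h2).trans h3).trans h1.symm

end

end EndoCat


/-! ## Convolution categories -/

section Convolution

variable (P : Presentation) [B : Braids P] (c : ℕ) [C : ComonObj (C := P.Cat) c]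

/-- The `n`-th tensor power of the object `c`. -/
def pow (n : ℕ) : P.Cat := Nat.mul c n

attribute [local instance] ComonObj.instTensorUnit in
/-- Tensor powers of a coalgebra are coalgebras. -/
instance powComon : (n : ℕ) → ComonObj (pow P c n)
  | 0 => inferInstanceAs (ComonObj (𝟙_ P.Cat))
  | n + 1 =>
    haveI := powComon n
    haveI : ComonObj (C := P.Cat) c := C
    inferInstanceAs (ComonObj (pow P c n ⊗ (show P.Cat from c)))

/-- The morphisms from the `n`-th power of the coalgebra `c` to the unit object (an algebra),
a monoid for the convolution product. -/
def ConvEnd (n : ℕ) : Type := Conv (pow P c n) (𝟙_ P.Cat)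

instance (n : ℕ) : Monoid (ConvEnd P c n) := inferInstanceAs (Monoid (Conv (pow P c n) (𝟙_ P.Cat)))

/-- The identity `pow (m + n) = pow m ⊗ pow n` -/
def powAdd (m n : ℕ) : pow P c (m + n) ⟶ pow P c m ⊗ pow P c n := cls ⟨[], Nat.mul_add c m n⟩

open scoped ComonObj in
theorem isComonHom_assoc {V : Type} [Category.{0} V] [MonoidalCategory V] [BraidedCategory V]
    {Z A B D : V} [ComonObj Z] [ComonObj A] [ComonObj B] [ComonObj D] (f : Z ⟶ A ⊗ B)
    [IsComonHom f] : IsComonHom ((f ▷ D) ≫ (α_ A B D).hom) := by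
  let F : Comon.mk Z ⟶ Comon.mk A ⊗ Comon.mk B := Comon.Hom.mk (N := Comon.mk (A ⊗ B)) f
  have h := ((F ▷ Comon.mk D) ≫ (α_ (Comon.mk A) (Comon.mk B) (Comon.mk D)).hom).isComonHom_hom
  rw [Comon.comp_hom', Comon.monoidal_whiskerRight_hom, Comon.monoidal_associator_hom_hom] at h
  have e : f ▷ D ≫ 𝟙 (A ⊗ B) ▷ D ≫ (α_ A B D).hom ≫ A ◁ 𝟙 (B ⊗ D) =
      f ▷ D ≫ (α_ A B D).hom := by simp
  rw [← e]
  exact h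

attribute [local instance] ComonObj.instTensorUnit in
theorem powAdd_comon (m n : ℕ) : IsComonHom (powAdd P c m n) := by
  induction n with
  | zero =>
    exact inferInstanceAs (IsComonHom (ρ_ (Comon.mk (pow P c m))).inv.hom)
  | succ n ih =>
    exact isComonHom_assoc (D := (show P.Cat from c)) (powAdd P c m n)

open scoped ComonObj in
theorem conv_interchange {V : Type} [Category.{0} V] [MonoidalCategory V] [BraidedCategory V]
    {Z X Y : V} [ComonObj Z] [ComonObj X] [ComonObj Y] (F : Z ⟶ X ⊗ Y) [IsComonHom F]
    (f f' : X ⟶ 𝟙_ V) (g g' : Y ⟶ 𝟙_ V) :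
    F ≫ ((Δ[X] ≫ (f ⊗ₘ f') ≫ (λ_ _).hom) ⊗ₘ (Δ[Y] ≫ (g ⊗ₘ g') ≫ (λ_ _).hom)) ≫ (λ_ _).hom =
      Δ[Z] ≫ ((F ≫ (f ⊗ₘ g) ≫ (λ_ _).hom) ⊗ₘ (F ≫ (f' ⊗ₘ g') ≫ (λ_ _).hom)) ≫ (λ_ _).hom := by
  have h : tensorμ (𝟙_ V) (𝟙_ V) (𝟙_ V) (𝟙_ V) ≫ ((λ_ (𝟙_ V)).hom ⊗ₘ (λ_ (𝟙_ V)).hom) ≫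
      (λ_ (𝟙_ V)).hom = ((λ_ (𝟙_ V)).hom ⊗ₘ (λ_ (𝟙_ V)).hom) ≫ (λ_ (𝟙_ V)).hom := by
    have e := tensor_left_unitality (𝟙_ V) (𝟙_ V)
    rw [← cancel_epi ((λ_ (𝟙_ V)).inv ▷ (𝟙_ V ⊗ 𝟙_ V))]
    rw [← Category.assoc _ (_ ⊗ₘ _), ← Category.assoc _ (tensorμ _ _ _ _ ≫ _), ← e]
    monoidal
  have hF := IsComonHom.hom_comul F
  rw [Comon.tensorObj_comul] at hF
  have e : Δ[Z] ≫ ((F ≫ (f ⊗ₘ g) ≫ (λ_ _).hom) ⊗ₘ (F ≫ (f' ⊗ₘ g') ≫ (λ_ _).hom)) ≫ (λ_ _).hom =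
      (Δ[Z] ≫ (F ⊗ₘ F)) ≫ ((f ⊗ₘ g) ⊗ₘ (f' ⊗ₘ g')) ≫
        ((λ_ (𝟙_ V)).hom ⊗ₘ (λ_ (𝟙_ V)).hom) ≫ (λ_ (𝟙_ V)).hom := by
    simp only [Category.assoc, tensorHom_comp_tensorHom_assoc]
  rw [e, ← hF]
  simp only [Category.assoc]
  rw [← tensorμ_natural_assoc, h]
  simp only [tensorHom_comp_tensorHom_assoc]

theorem cls_heq {P : Presentation} {m n m' n' : ℕ} {D : P.Diagram m n} {E : P.Diagram m' n'}
    (hm : m = m') (hn : n = n') (h : D.word = E.word) : HEq (cls D) (cls E) := by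
  subst hm hn; exact heq_of_eq (cls_eq h)

namespace ConvEnd

variable {P c}

/-- The underlying morphism. -/
def hom {n : ℕ} (a : ConvEnd P c n) : pow P c n ⟶ 𝟙_ P.Cat := a

theorem mul_def {n : ℕ} (a b : ConvEnd P c n) :
    a * b = (ComonObj.comul (X := pow P c n) ≫ (a.hom ⊗ₘ b.hom) ≫ (λ_ (𝟙_ P.Cat)).hom :
      pow P c n ⟶ 𝟙_ P.Cat) := by
  rw [MonoidalCategory.tensorHom_def, Category.assoc]; rfl

/-- The product `a ⊗ b`, followed by the identity `1 ⊗ 1 = 1`. -/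
def tmul {m n : ℕ} (a : ConvEnd P c m) (b : ConvEnd P c n) : ConvEnd P c (m + n) :=
  (powAdd P c m n ≫ (a.hom ⊗ₘ b.hom) ≫ (λ_ (𝟙_ P.Cat)).hom : pow P c (m + n) ⟶ 𝟙_ P.Cat)

theorem tmul_mul {m n : ℕ} (a a' : ConvEnd P c m) (b b' : ConvEnd P c n) :
    tmul (a * a') (b * b') = tmul a b * tmul a' b' := by
  have := powAdd_comon P c m n
  rw [mul_def, mul_def, mul_def]
  exact conv_interchange (powAdd P c m n) a a' b b'

theorem one_def {n : ℕ} :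
    (1 : ConvEnd P c n) = (ComonObj.counit (X := pow P c n) : pow P c n ⟶ 𝟙_ P.Cat) :=
  Category.comp_id (ComonObj.counit (X := pow P c n))

theorem one_tmul_one (m n : ℕ) : tmul (1 : ConvEnd P c m) (1 : ConvEnd P c n) = 1 := by
  have := powAdd_comon P c m n
  rw [one_def, one_def, one_def]
  exact IsComonHom.hom_counit (powAdd P c m n)

/-- The class of a diagram with `c * n` inputs and no outputs. -/
def ofDiagram {n : ℕ} (D : P.Diagram (c * n) 0) : ConvEnd P c n := cls D

theorem ofDiagram_surj {n : ℕ} (a : ConvEnd P c n) :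
    ∃ D : P.Diagram (c * n) 0, ofDiagram D = a := Quot.exists_rep a

theorem typed_tmul {m n : ℕ} (D : P.Diagram (c * m) 0) (E : P.Diagram (c * n) 0) :
    P.Typed (c * (m + n)) (D.word ++ E.word) 0 :=
  ((D.typed.right (c * n)).cast (Nat.mul_add c m n).symm (Nat.zero_add _)).append E.typed

theorem tmul_cls {m n : ℕ} (D : P.Diagram (c * m) 0) (E : P.Diagram (c * n) 0) :
    tmul (ofDiagram D) (ofDiagram E) = ofDiagram ⟨D.word ++ E.word, typed_tmul D E⟩ :=
  cls_eq (P := P) (D := ⟨[] ++ ((D.word ++ shift 0 E.word) ++ []), by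
    change P.Typed (c * (m + n)) _ 0
    simpa using typed_tmul D E⟩) (by simp)

theorem one_zero : (1 : ConvEnd P c 0) = ofDiagram ⟨[], Nat.mul_zero c⟩ := one_def

instance : TensorMonoids (ConvEnd P c) where
  tmul := tmul
  tmul_mul := tmul_mul
  one_tmul_one := one_tmul_one
  tmul_assoc := by
    intro m n k a b c
    obtain ⟨D, rfl⟩ := ofDiagram_surj a
    obtain ⟨E, rfl⟩ := ofDiagram_surj b
    obtain ⟨F, rfl⟩ := ofDiagram_surj c
    rw [tmul_cls, tmul_cls, tmul_cls, tmul_cls]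
    exact cls_heq (by rw [Nat.add_assoc]) rfl (List.append_assoc _ _ _)
  one_tmul := by
    intro n a
    obtain ⟨D, rfl⟩ := ofDiagram_surj a
    rw [one_zero, tmul_cls]
    exact cls_heq (by rw [Nat.zero_add]) rfl rfl
  tmul_one := by
    intro n a
    obtain ⟨D, rfl⟩ := ofDiagram_surj a
    rw [one_zero, tmul_cls]
    exact cls_heq rfl rfl (List.append_nil _)

end ConvEnd

end Convolution

/-- The category of Hopf diagrams: the convolution category of the coalgebra `1` and the trivial
algebra `𝟙_` in the braided category presented by `hopf`. -/
abbrev DiagS : Type := EndoCat (ConvEnd hopf 1)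

/-! ## The components of a tangle diagram

The points of the diagram of a word are the pairs `(i, p)`, where `i` is a level (the layer number
`i` lies between the levels `i` and `i + 1`, counted from `0`) and `p` is a position from left to
right, counted from `0`. The diagram is extended on its right by infinitely many vertical
strands. -/

/-- Points joined by an arc of the layer `(k, g)` between the levels `i` and `i + 1`. -/
inductive Link (i k : ℕ) : TangleGen → ℕ × ℕ → ℕ × ℕ → Prop
  | left (g : TangleGen) {p : ℕ} : p < k → Link i k g (i, p) (i + 1, p)
  | right (g : TangleGen) (p : ℕ) : Link i k g (i, k + g.src + p) (i + 1, k + g.tgt + p)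
  | cup : Link i k .cup (i + 1, k) (i + 1, k + 1)
  | cap : Link i k .cap (i, k) (i, k + 1)
  | crossRight (s : Bool) : Link i k (.cross s) (i, k) (i + 1, k + 1)
  | crossLeft (s : Bool) : Link i k (.cross s) (i, k + 1) (i + 1, k)

/-- Two points of the diagram of a word lie on the same component. -/
def Joined (w : List (ℕ × TangleGen)) : ℕ × ℕ → ℕ × ℕ → Prop :=
  Relation.EqvGen fun a b => ∃ (i k : ℕ) (g : TangleGen), w[i]? = some (k, g) ∧ Link i k g a b

/-- There are no components without a bottom endpoint. -/
def Rooted (w : List (ℕ × TangleGen)) : Prop :=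
  ∀ i ≤ w.length, ∀ p, ∃ k, Joined w (i, p) (0, k)

namespace Joined

variable {u v w : List (ℕ × TangleGen)} {a b c : ℕ × ℕ}

theorem refl (a : ℕ × ℕ) : Joined w a a := Relation.EqvGen.refl a

theorem symm (h : Joined w a b) : Joined w b a := Relation.EqvGen.symm _ _ h

theorem trans (h : Joined w a b) (h' : Joined w b c) : Joined w a c :=
  Relation.EqvGen.trans _ _ _ h h'

theorem map (f : ℕ × ℕ → ℕ × ℕ)
    (hf : ∀ i k g a b, v[i]? = some (k, g) → Link i k g a b → Joined w (f a) (f b))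
    (h : Joined v a b) : Joined w (f a) (f b) := by
  induction h with
  | rel a b h => obtain ⟨i, k, g, h1, h2⟩ := h; exact hf i k g a b h1 h2
  | refl a => exact refl _
  | symm a b _ ih => exact ih.symm
  | trans a b c _ _ ih1 ih2 => exact ih1.trans ih2

theorem of_link {i k : ℕ} {g : TangleGen} (h : w[i]? = some (k, g)) (h' : Link i k g a b) :
    Joined w a b := .rel _ _ ⟨i, k, g, h, h'⟩

theorem append_left (v : List (ℕ × TangleGen)) (h : Joined u a b) : Joined (u ++ v) a b := by
  refine map id (fun i k g a b h1 h2 => of_link ?_ h2) h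
  rw [List.getElem?_append_left ((List.getElem?_eq_some_iff.1 h1).1), h1]

theorem append_right (u : List (ℕ × TangleGen)) {i p j q : ℕ} (h : Joined v (i, p) (j, q)) :
    Joined (u ++ v) (u.length + i, p) (u.length + j, q) := by
  refine map (fun a => (u.length + a.1, a.2)) (fun i k g a b h1 h2 => ?_) h
  refine of_link (i := u.length + i) (k := k) (g := g) ?_ ?_
  · rw [List.getElem?_append_right (by omega), Nat.add_sub_cancel_left, h1]
  · cases h2 with
    | left g hp => exact .left g hp
    | right g p => exact .right g p
    | cup => exact .cup
    | cap => exact .cap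
    | crossRight s => exact .crossRight s
    | crossLeft s => exact .crossLeft s

theorem getElem_shift (k i : ℕ) (w : List (ℕ × TangleGen)) :
    (shift k w)[i]? = (w[i]?).map fun s => (k + s.1, s.2) := by simp [shift]

theorem shift_right (k : ℕ) {i p j q : ℕ} (h : Joined w (i, p) (j, q)) :
    Joined (shift k w) (i, k + p) (j, k + q) := by
  refine map (fun a => (a.1, k + a.2)) (fun i l g a b h1 h2 => ?_) h
  refine of_link (i := i) (k := k + l) (g := g) (by rw [getElem_shift, h1]; rfl) ?_
  cases h2 with
  | left g hp => exact .left g (by omega)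
  | right g p =>
    have := Link.right (i := i) (k := k + l) g p
    simpa only [Nat.add_assoc] using this
  | cup => exact .cup
  | cap => exact .cap
  | crossRight s => exact .crossRight s
  | crossLeft s => exact .crossLeft s

theorem shift_left {k p : ℕ} (hp : p < k) {i : ℕ} (hi : i ≤ w.length) :
    Joined (shift k w) (0, p) (i, p) := by
  induction i with
  | zero => exact refl _
  | succ i ih =>
    refine (ih (by omega)).trans (of_link (i := i) (k := k + (w[i]).1) (g := (w[i]).2) ?_ ?_)
    · rw [getElem_shift, List.getElem?_eq_getElem (by omega)]; rfl
    · exact .left _ (by omega)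

theorem through {m n : ℕ} (h : tangle.Typed m w n) (q : ℕ) :
    Joined w (0, m + q) (w.length, n + q) := by
  induction w generalizing m with
  | nil => obtain rfl : m = n := h; exact refl _
  | cons s w ih =>
    obtain ⟨k, g⟩ := s
    obtain ⟨r, rfl, h⟩ := h
    have h1 : Joined ((k, g) :: w) (0, k + TangleGen.src g + (r + q))
        (0 + 1, k + TangleGen.tgt g + (r + q)) := of_link (i := 0) rfl (.right g (r + q))
    have h2 : Joined ((k, g) :: w) (0 + 1, k + TangleGen.tgt g + (r + q)) (1 + w.length, n + q) := by
      have := append_right [(k, g)] (ih h)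
      rwa [show k + tangle.tgt g + r + q = k + TangleGen.tgt g + (r + q) from Nat.add_assoc _ _ _]
        at this
    rw [show k + tangle.src g + r + q = k + TangleGen.src g + (r + q) from Nat.add_assoc _ _ _,
      List.length_cons, Nat.add_comm w.length]
    exact h1.trans h2

end Joined

theorem Rooted.append {u v : List (ℕ × TangleGen)} (hu : Rooted u) (hv : Rooted v) : Rooted (u ++ v) := by
  intro i hi p
  by_cases h : i ≤ u.length
  · obtain ⟨k, hk⟩ := hu i h p
    exact ⟨k, hk.append_left v⟩
  · obtain ⟨j, rfl⟩ := Nat.exists_eq_add_of_le (Nat.le_of_not_le h)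
    obtain ⟨k, hk⟩ := hv j (by simp at hi; omega) p
    obtain ⟨l, hl⟩ := hu u.length le_rfl k
    exact ⟨l, (hk.append_right u).trans (hl.append_left v)⟩

theorem Rooted.shift {w : List (ℕ × TangleGen)} (h : Rooted w) (k : ℕ) : Rooted (shift k w) := by
  intro i hi p
  have hi' : i ≤ w.length := by simpa [HopfDiag.shift] using hi
  by_cases hp : p < k
  · exact ⟨p, (Joined.shift_left hp hi').symm⟩
  · obtain ⟨q, rfl⟩ := Nat.exists_eq_add_of_le (Nat.le_of_not_lt hp)
    obtain ⟨l, hl⟩ := h i hi' q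
    exact ⟨k + l, hl.shift_right k⟩

/-- The word `w` is a diagram of an `n`-string link: the `k`-th bottom endpoint is joined to the
`k`-th top endpoint, and there are no closed components. -/
def IsStringLink (n : ℕ) (w : List (ℕ × TangleGen)) : Prop :=
  (∀ k < n, Joined w (0, k) (w.length, k)) ∧ Rooted w

/-- The word `w` is a diagram of an `n`-handle: the two bottom endpoints `2k` and `2k + 1` are joined
(counting from `0`), and there are no closed components. -/
def IsHandle (n : ℕ) (w : List (ℕ × TangleGen)) : Prop :=
  (∀ k < n, Joined w (0, 2 * k) (0, 2 * k + 1)) ∧ Rooted w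

theorem rooted_nil : Rooted [] := fun i hi p => by
  obtain rfl : i = 0 := Nat.le_zero.1 hi
  exact ⟨p, .refl _⟩

/-- All components of a side by side composition are those of the factors. -/
theorem Joined.tensor_right {m m' : ℕ} {u v : List (ℕ × TangleGen)} (hu : tangle.Typed m u m')
    {p q : ℕ} (h : Joined v (0, p) (v.length, q)) :
    Joined (u ++ shift m' v) (0, m + p) ((u ++ shift m' v).length, m' + q) := by
  have h1 := (through hu p).append_left (shift m' v)
  have h2 := (h.shift_right m').append_right u
  have := h1.trans h2
  simpa [shift] using this

/-! ## Ribbon string links -/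

theorem IsStringLink.append {n : ℕ} {u v : List (ℕ × TangleGen)} (hu : IsStringLink n u)
    (hv : IsStringLink n v) : IsStringLink n (u ++ v) := by
  refine ⟨fun k hk => ?_, hu.2.append hv.2⟩
  have h1 := (hu.1 k hk).append_left v
  have h2 := (hv.1 k hk).append_right u
  rw [List.length_append]
  exact h1.trans h2

theorem IsStringLink.tensor {m n : ℕ} {u v : List (ℕ × TangleGen)} (t : tangle.Typed m u m)
    (hu : IsStringLink m u) (hv : IsStringLink n v) : IsStringLink (m + n) (u ++ shift m v) := by
  refine ⟨fun k hk => ?_, hu.2.append (hv.2.shift m)⟩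
  by_cases h : k < m
  · have h1 := (hu.1 k h).append_left (shift m v)
    have h2 := (Joined.shift_left (w := v) h le_rfl).append_right u
    have := h1.trans h2
    simpa [shift] using this
  · obtain ⟨q, rfl⟩ := Nat.exists_eq_add_of_le (Nat.le_of_not_lt h)
    exact (hv.1 q (by omega)).tensor_right t

/-- The object `n` of the category of ribbon tangles. -/
def tobj (n : ℕ) : tangle.Cat := n

/-- The monoid of isotopy classes of `n`-string links. In the product `a * b`, the string link `a`
is put on top of `b`. -/
def stringLinks (n : ℕ) : Submonoid (End (tobj n)) where
  carrier := {t | ∃ D : tangle.Diagram n n, cls D = t ∧ IsStringLink n D.word}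
  one_mem' := ⟨Diagram.id n, rfl, fun _ _ => .refl _, rooted_nil⟩
  mul_mem' := by
    rintro _ _ ⟨D, rfl, hD⟩ ⟨E, rfl, hE⟩
    exact ⟨E.comp D, rfl, hE.append hD⟩

/-- The class of a string link diagram. -/
def slClass {n : ℕ} (D : tangle.Diagram n n) (h : IsStringLink n D.word) : stringLinks n :=
  ⟨cls D, D, rfl, h⟩

theorem slClass_surj {n : ℕ} (a : stringLinks n) :
    ∃ (D : tangle.Diagram n n) (h : IsStringLink n D.word), a = slClass D h := by
  obtain ⟨_, D, rfl, h⟩ := a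
  exact ⟨D, h, rfl⟩

/-- Juxtaposition of string links. -/
def slTensor {m n : ℕ} (a : stringLinks m) (b : stringLinks n) : stringLinks (m + n) :=
  ⟨Hom.comp (Hom.whiskerRight a.1 n) (Hom.whiskerLeft m b.1), by
    obtain ⟨_, D, rfl, hD⟩ := a
    obtain ⟨_, E, rfl, hE⟩ := b
    exact ⟨(D.whiskerRight n).comp (E.whiskerLeft m), rfl, hD.tensor D.typed hE⟩⟩

theorem slTensor_class {m n : ℕ} {D : tangle.Diagram m m} {E : tangle.Diagram n n}
    (hD : IsStringLink m D.word) (hE : IsStringLink n E.word) :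
    slTensor (slClass D hD) (slClass E hE) =
      slClass ((D.whiskerRight n).comp (E.whiskerLeft m)) (hD.tensor D.typed hE) := rfl

theorem slClass_heq {m n : ℕ} {D : tangle.Diagram m m} {E : tangle.Diagram n n}
    (hD : IsStringLink m D.word) (hE : IsStringLink n E.word) (h : m = n)
    (e : D.word = E.word) : HEq (slClass D hD) (slClass E hE) := by
  subst h
  exact heq_of_eq (Subtype.ext (cls_eq e))

theorem slTensor_mul {m n : ℕ} (a a' : stringLinks m) (b b' : stringLinks n) :
    slTensor (a * a') (b * b') = slTensor a b * slTensor a' b' := by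
  obtain ⟨D, _, rfl⟩ := slClass_surj a
  obtain ⟨D', _, rfl⟩ := slClass_surj a'
  obtain ⟨E, _, rfl⟩ := slClass_surj b
  obtain ⟨E', _, rfl⟩ := slClass_surj b'
  refine Subtype.ext (hom_ext_word (P := tangle) ?_)
  exact (tensor_comp_aux D' E' D E).symm

instance : TensorMonoids (fun n => stringLinks n) where
  tmul := slTensor
  tmul_mul := slTensor_mul
  one_tmul_one _ _ := rfl
  tmul_assoc := by
    intro m n k a b c
    obtain ⟨D, hD, rfl⟩ := slClass_surj a
    obtain ⟨E, hE, rfl⟩ := slClass_surj b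
    obtain ⟨F, hF, rfl⟩ := slClass_surj c
    exact slClass_heq ((hD.tensor D.typed hE).tensor ((D.whiskerRight n).comp (E.whiskerLeft m)).typed hF)
      (hD.tensor D.typed (hE.tensor E.typed hF)) (Nat.add_assoc m n k)
      (by simp [Diagram.comp, Diagram.whiskerLeft, Diagram.whiskerRight])
  one_tmul := by
    intro n a
    obtain ⟨D, hD, rfl⟩ := slClass_surj a
    exact slClass_heq (D := (Diagram.whiskerRight (Diagram.id 0) n).comp (D.whiskerLeft 0))
      (by simpa [Diagram.comp, Diagram.whiskerLeft, Diagram.whiskerRight, Diagram.id] using hD) _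
      (Nat.zero_add n)
      (by simp [Diagram.comp, Diagram.whiskerLeft, Diagram.whiskerRight, Diagram.id])
  tmul_one := by
    intro n a
    obtain ⟨D, hD, rfl⟩ := slClass_surj a
    exact slClass_heq (D := (D.whiskerRight 0).comp (Diagram.whiskerLeft n (Diagram.id 0)))
      (by simpa [Diagram.comp, Diagram.whiskerLeft, Diagram.whiskerRight, Diagram.id] using hD) _
      (Nat.add_zero n)
      (by simp [Diagram.comp, Diagram.whiskerLeft, Diagram.whiskerRight, Diagram.id])

/-- The monoidal category of ribbon string links. -/
abbrev RSL : Type := EndoCat (fun n => stringLinks n)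

/-! ## Ribbon handles -/

theorem IsHandle.tensor {m n : ℕ} {u v : List (ℕ × TangleGen)} (t : tangle.Typed (2 * m) u 0)
    (hu : IsHandle m u) (hv : IsHandle n v) : IsHandle (m + n) (u ++ v) := by
  refine ⟨fun k hk => ?_, hu.2.append hv.2⟩
  by_cases h : k < m
  · exact (hu.1 k h).append_left v
  · obtain ⟨q, rfl⟩ := Nat.exists_eq_add_of_le (Nat.le_of_not_lt h)
    have h1 := (Joined.through t (2 * q)).append_left v
    have h2 := (Joined.through t (2 * q + 1)).append_left v
    have h3 := (hv.1 q (by omega)).append_right u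
    simp only [Nat.zero_add, Nat.add_zero] at h1 h2 h3
    rw [show 2 * (m + q) = 2 * m + 2 * q by ring, Nat.add_assoc]
    exact (h1.trans h3).trans h2.symm

/-- The word of the coproduct of `n` neighbouring pairs of strands. -/
def comulWord : ℕ → List (ℕ × TangleGen)
  | 0 => []
  | n + 1 => comulWord n ++ [(4 * n + 1, .cup)] ++ shift (2 * n) (braidWord (.cross true) (2 * n) 2)

theorem typed_comulWord (n : ℕ) : tangle.Typed (2 * n) (comulWord n) (2 * n + 2 * n) := by
  induction n with
  | zero => rfl
  | succ n ih =>
    refine Typed.append (a := 2 * n + (2 * n + 2) + 2) (Typed.append (a := 2 * n + 2 * n + 2) ?_ ?_) ?_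
    · exact (ih.right 2).cast (by omega) (by omega)
    · exact ((typed_gen (P := tangle) (4 * n + 1) .cup 1).cast (by simp [tangle, TangleGen.src]; omega)
        (by simp [tangle, TangleGen.tgt]; omega))
    · exact ((((typed_braidWord (P := tangle) (2 * n) 2).left (2 * n)).right 2).cast (by omega)
        (by omega))

/-- A pair of strands. -/
def pair : tangle.Cat := (2 : ℕ)

instance : ComonObj pair := inferInstanceAs (ComonObj (C := tangle.Cat) (2 : ℕ))

theorem comul_succ (n : ℕ) : (ComonObj.comul (X := pow tangle 2 (n + 1)) :
      pow tangle 2 (n + 1) ⟶ pow tangle 2 (n + 1) ⊗ pow tangle 2 (n + 1)) =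
      (ComonObj.comul (X := pow tangle 2 n) ⊗ₘ ComonObj.comul (X := pair)) ≫
        tensorμ (pow tangle 2 n) (pow tangle 2 n) pair pair :=
  Comon.tensorObj_comul (pow tangle 2 n) pair

theorem comulWord_aux (n : ℕ) (w : List (ℕ × TangleGen)) :
    (w ++ shift (2 * n + 2 * n) [(1, TangleGen.cup)]) ++
      ([] ++ ([] ++ (shift (2 * n) (braidWord (TangleGen.cross true) (2 * n) 2) ++ ([] ++ [])))) =
    w ++ [(4 * n + 1, .cup)] ++ shift (2 * n) (braidWord (TangleGen.cross true) (2 * n) 2) := by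
  simp [show 2 * n + 2 * n + 1 = 4 * n + 1 by omega]

theorem comul_eq (n : ℕ) : (ComonObj.comul (X := pow tangle 2 n) :
    pow tangle 2 n ⟶ pow tangle 2 n ⊗ pow tangle 2 n) =
      cls (P := tangle) ⟨comulWord n, typed_comulWord n⟩ := by
  induction n with
  | zero => rfl
  | succ n ih =>
    rw [comul_succ, ih]
    exact cls_eq (P := tangle) (comulWord_aux n (comulWord n))

/-- The diagram of a convolution product. -/
theorem ofDiagram_mul {n : ℕ} {u v : List (ℕ × TangleGen)} (hu : tangle.Typed (2 * n) u 0)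
    (hv : tangle.Typed (2 * n) v 0) :
    ∃ h : tangle.Typed (2 * n) (comulWord n ++ (u ++ v)) 0,
      (ConvEnd.ofDiagram ⟨u, hu⟩ * ConvEnd.ofDiagram ⟨v, hv⟩ : ConvEnd tangle 2 n) =
        ConvEnd.ofDiagram ⟨comulWord n ++ (u ++ v), h⟩ := by
  have h : tangle.Typed (2 * n) (comulWord n ++ (u ++ v)) 0 :=
    (typed_comulWord n).append (((hu.right (2 * n)).cast rfl (Nat.zero_add _)).append hv)
  have e : comulWord n ++ (u ++ v) = comulWord n ++ ((u ++ shift 0 v) ++ []) := by simp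
  have h' : tangle.Typed (2 * n) (comulWord n ++ ((u ++ shift 0 v) ++ [])) 0 := e ▸ h
  refine ⟨h, ?_⟩
  rw [ConvEnd.mul_def, comul_eq]
  exact cls_eq (P := tangle) (D := ⟨_, h'⟩) e.symm

theorem joined_passRight (n : ℕ) :
    Joined (passRight (.cross true) n) (0, 0) (n, n) ∧
      ∀ q < n, Joined (passRight (.cross true) n) (0, 1 + q) (n, q) := by
  have hl : ∀ n, (passRight (TangleGen.cross true) n).length = n := by simp [passRight]
  have hg : ∀ n, (passRight (TangleGen.cross true) (n + 1))[n]? = some (n, .cross true) := by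
    simp [passRight]
  induction n with
  | zero => exact ⟨.refl _, by simp⟩
  | succ n ih =>
    have e := passRight_succ (TangleGen.cross true) n
    have app : ∀ {a b : ℕ × ℕ}, Joined (passRight (.cross true) n) a b →
        Joined (passRight (.cross true) (n + 1)) a b := by
      intro a b h
      rw [e]
      exact h.append_left _
    refine ⟨(app ih.1).trans (.of_link (hg n) (.crossRight true)), fun q hq => ?_⟩
    by_cases h : q < n
    · exact (app (ih.2 q h)).trans (.of_link (hg n) (.left _ h))
    · obtain rfl : q = n := by omega
      have h1 : Joined (passRight (.cross true) q) (0, 1 + q + 0)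
          ((passRight (TangleGen.cross true) q).length, q + 1 + 0) :=
        Joined.through (typed_passRight (P := tangle) q) 0
      rw [hl] at h1
      exact (app h1).trans (.of_link (hg q) (.crossLeft true))

theorem joined_braidWord (m n : ℕ) :
    (∀ p < m, Joined (braidWord (.cross true) m n) (0, p)
      ((braidWord (TangleGen.cross true) m n).length, p + n)) ∧
    ∀ q < n, Joined (braidWord (.cross true) m n) (0, m + q)
      ((braidWord (TangleGen.cross true) m n).length, q) := by
  have hl : ∀ n, (passRight (TangleGen.cross true) n).length = n := by simp [passRight]
  induction m with
  | zero => exact ⟨by simp, fun q _ => by simpa [braidWord] using Joined.refl _⟩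
  | succ m ih =>
    obtain ⟨h1, h2⟩ := joined_passRight n
    have app : ∀ {p q r : ℕ}, Joined (shift m (passRight (.cross true) n)) (0, p) (n, q) →
        Joined (braidWord (.cross true) m n) (0, q)
          ((braidWord (TangleGen.cross true) m n).length, r) →
        Joined (braidWord (.cross true) (m + 1) n) (0, p)
          ((braidWord (TangleGen.cross true) (m + 1) n).length, r) := by
      intro p q r a b
      have a' := a.append_left (braidWord (.cross true) m n)
      have b' := b.append_right (shift m (passRight (.cross true) n))
      simp only [shift, List.length_map, hl] at b' a'
      have := a'.trans b'
      simpa [braidWord, shift, hl] using this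
    refine ⟨fun p hp => ?_, fun q hq => ?_⟩
    · by_cases h : p < m
      · exact app (.shift_left h (by rw [hl])) (ih.1 p h)
      · obtain rfl : p = m := by omega
        have h3 : Joined (braidWord (.cross true) p n) (0, p + n + 0)
            ((braidWord (TangleGen.cross true) p n).length, n + p + 0) :=
          Joined.through (typed_braidWord (P := tangle) p n) 0
        rw [Nat.add_comm n p] at h3
        exact app (h1.shift_right p) h3
    · have := app ((h2 q hq).shift_right m) (ih.2 q hq)
      rwa [← Nat.add_assoc] at this

/-- Coproduct of the pairs: first and second copies. -/
theorem joined_comulWord (n : ℕ) : ∀ k < n,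
    Joined (comulWord n) (0, 2 * k) ((comulWord n).length, 2 * k) ∧
    Joined (comulWord n) (0, 2 * k + 1) ((comulWord n).length, 2 * n + 2 * k + 1) ∧
    Joined (comulWord n) ((comulWord n).length, 2 * k + 1)
      ((comulWord n).length, 2 * n + 2 * k) := by
  induction n with
  | zero => simp
  | succ n ih =>
    set A := comulWord n with hA
    set B := shift (2 * n) (braidWord (TangleGen.cross true) (2 * n) 2) with hB
    have hlen : (comulWord (n + 1)).length = A.length + 1 + B.length := by
      simp [comulWord, hA, hB, Nat.add_assoc, Nat.add_comm 1]
    have hw : comulWord (n + 1) = (A ++ [(4 * n + 1, .cup)]) ++ B := rfl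
    have hA1 : ∀ {a b}, Joined A a b → Joined (comulWord (n + 1)) a b := fun h => by
      rw [hw]; exact (h.append_left _).append_left _
    have hB1 : ∀ {p q}, Joined B (0, p) (B.length, q) →
        Joined (comulWord (n + 1)) (A.length + 1, p) ((comulWord (n + 1)).length, q) := fun h => by
      have := h.append_right (A ++ [(4 * n + 1, .cup)])
      rw [hlen, hw]
      simpa using this
    have hcup : (comulWord (n + 1))[A.length]? = some (4 * n + 1, .cup) := by
      rw [hw]; simp
    have hleft : ∀ p, p < 4 * n + 1 → Joined (comulWord (n + 1)) (A.length, p) (A.length + 1, p) :=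
      fun p hp => .of_link hcup (.left _ hp)
    have hright : ∀ p, Joined (comulWord (n + 1)) (A.length, 4 * n + 1 + p)
      (A.length + 1, 4 * n + 1 + 2 + p) := fun p => .of_link hcup (.right _ p)
    obtain ⟨b1, b2⟩ := joined_braidWord (2 * n) 2
    have bl : B.length = (braidWord (TangleGen.cross true) (2 * n) 2).length := by
      simp [hB, shift]
    have s0 : ∀ p < 2 * n, Joined B (0, p) (B.length, p) := fun p hp => by
      rw [bl]; exact .shift_left hp le_rfl
    have s1 : ∀ p < 2 * n, Joined B (0, 2 * n + p) (B.length, 2 * n + (p + 2)) := fun p hp => by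
      rw [bl]; exact (b1 p hp).shift_right _
    have s2 : ∀ q < 2, Joined B (0, 2 * n + (2 * n + q)) (B.length, 2 * n + q) := fun p hp => by
      rw [bl]; exact (b2 p hp).shift_right _
    have s3 : ∀ q, Joined B (0, 2 * n + (2 * n + 2 + q)) (B.length, 2 * n + (2 + 2 * n + q)) :=
      fun q => by
        rw [bl]; exact (Joined.through (typed_braidWord (P := tangle) (2 * n) 2) q).shift_right _
    have t : ∀ q, Joined A (0, 2 * n + q) (A.length, 2 * n + 2 * n + q) :=
      Joined.through (typed_comulWord n)
    intro k hk
    by_cases h : k < n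
    · obtain ⟨h1, h2, h3⟩ := ih k h
      refine ⟨?_, ?_, ?_⟩
      · exact (hA1 h1).trans ((hleft _ (by omega)).trans (hB1 (s0 _ (by omega))))
      · have := (hA1 h2).trans ((hleft _ (by omega)).trans
          (hB1 (by rw [Nat.add_assoc]; exact s1 (2 * k + 1) (by omega))))
        convert this using 2; omega
      · have := ((hleft _ (by omega)).trans (hB1 (s0 (2 * k + 1) (by omega)))).symm.trans
          ((hA1 h3).trans ((hleft _ (by omega)).trans (hB1 (s1 (2 * k) (by omega)))))
        convert this using 2; omega
    · obtain rfl : k = n := by omega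
      refine ⟨?_, ?_, ?_⟩
      · have a := (hA1 (t 0)).trans (hleft _ (by omega))
        have b := hB1 (s2 0 (by omega))
        have := a.trans (by convert b using 2; omega)
        exact this
      · have a := hA1 (t 1)
        have a' := hright 0
        have b := hB1 (s3 1)
        have := a.trans ((by convert a' using 2; omega : Joined _ _ _).trans
          (by convert b using 2; omega : Joined _ (_, 4 * k + 1 + 2 + 0) _))
        convert this using 2; omega
      · have a : Joined (comulWord (k + 1)) (A.length + 1, 4 * k + 1) (A.length + 1, 4 * k + 1 + 1) :=
          .of_link hcup .cup
        have b := hB1 (s2 1 (by omega))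
        have b' := hB1 (s3 0)
        have := b.symm.trans ((by convert a using 2; omega : Joined _ _ (_, 4 * k + 1 + 1)).trans
          (by convert b' using 2; omega : Joined _ (_, 4 * k + 1 + 1) _))
        convert this using 2; omega


theorem joined_top {w : List (ℕ × TangleGen)} (h : ∀ s ∈ w, s.2 ≠ .cap) {i : ℕ}
    (hi : i ≤ w.length) (p : ℕ) : ∃ q, Joined w (i, p) (w.length, q) := by
  obtain ⟨j, hj⟩ := Nat.exists_eq_add_of_le hi
  induction j generalizing i p with
  | zero => obtain rfl : i = w.length := hj.symm; exact ⟨p, .refl _⟩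
  | succ j ih =>
    have hi' : i < w.length := by omega
    have hg := h w[i] (List.getElem_mem hi')
    obtain ⟨q, hq⟩ : ∃ q, Joined w (i, p) (i + 1, q) := by
      have hw : w[i]? = some ((w[i]).1, (w[i]).2) := List.getElem?_eq_getElem hi'
      generalize (w[i]).1 = k at hw
      generalize (w[i]).2 = g at hw hg
      by_cases h1 : p < k
      · exact ⟨_, .of_link hw (.left _ h1)⟩
      by_cases h2 : k + g.src ≤ p
      · obtain ⟨r, rfl⟩ := Nat.exists_eq_add_of_le h2
        exact ⟨_, .of_link hw (.right _ r)⟩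
      cases g with
      | cup => simp [TangleGen.src] at h2; omega
      | cap => exact absurd rfl hg
      | cross s =>
        simp only [TangleGen.src] at h2
        obtain rfl | rfl : p = k ∨ p = k + 1 := by omega
        · exact ⟨_, .of_link hw (.crossRight s)⟩
        · exact ⟨_, .of_link hw (.crossLeft s)⟩
    obtain ⟨r, hr⟩ := ih (by omega : i + 1 ≤ w.length) q (by omega)
    exact ⟨r, hq.trans hr⟩

theorem comulWord_ne_cap (n : ℕ) : ∀ s ∈ comulWord n, s.2 ≠ .cap := by
  have hb : ∀ m : ℕ, ∀ s ∈ braidWord (TangleGen.cross true) m 2, s.2 = .cross true :=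
    fun m => mem_braidWord (P := tangle)
  induction n with
  | zero => simp [comulWord]
  | succ n ih =>
    intro s hs
    simp only [comulWord, shift, List.mem_append, List.mem_map, List.mem_singleton] at hs
    rcases hs with (hs | rfl) | ⟨t, ht, rfl⟩
    · exact ih s hs
    · simp
    · simp [hb _ t ht]

theorem IsHandle.mul {n : ℕ} {u v : List (ℕ × TangleGen)} (t : tangle.Typed (2 * n) u 0)
    (hu : IsHandle n u) (hv : IsHandle n v) : IsHandle n (comulWord n ++ (u ++ v)) := by
  have H := hu.tensor t hv
  set W := comulWord n with hW
  have hl : ∀ {a b}, Joined W a b → Joined (W ++ (u ++ v)) a b := fun h => h.append_left _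
  have hr : ∀ {p i q}, Joined (u ++ v) (i, p) (0, q) →
      Joined (W ++ (u ++ v)) (W.length + i, p) (W.length, q) := fun h => h.append_right W
  have j1 : ∀ k < n, Joined (W ++ (u ++ v)) (W.length, 2 * k) (W.length, 2 * k + 1) :=
    fun k hk => hr (H.1 k (by omega))
  have j2 : ∀ k < n, Joined (W ++ (u ++ v)) (W.length, 2 * n + 2 * k)
      (W.length, 2 * n + 2 * k + 1) := fun k hk => by
    have := hr (H.1 (n + k) (by omega))
    rwa [show 2 * (n + k) = 2 * n + 2 * k by ring] at this
  have c := joined_comulWord n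
  have top : ∀ p, ∃ q, Joined (W ++ (u ++ v)) (W.length, p) (0, q) := by
    intro p
    by_cases h1 : p < 2 * n
    · obtain ⟨k, rfl | rfl⟩ := Nat.even_or_odd' p
      · exact ⟨_, (hl (c k (by omega)).1).symm⟩
      · exact ⟨_, (j1 k (by omega)).symm.trans (hl (c k (by omega)).1).symm⟩
    by_cases h2 : p < 2 * n + 2 * n
    · obtain ⟨r, rfl⟩ := Nat.exists_eq_add_of_le (Nat.le_of_not_lt h1)
      obtain ⟨k, rfl | rfl⟩ := Nat.even_or_odd' r
      · exact ⟨_, (j2 k (by omega)).trans (hl (c k (by omega)).2.1).symm⟩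
      · exact ⟨_, (hl (c k (by omega)).2.1).symm⟩
    · obtain ⟨q, rfl⟩ := Nat.exists_eq_add_of_le (Nat.le_of_not_lt h2)
      exact ⟨_, (hl (Joined.through (typed_comulWord n) q)).symm⟩
  refine ⟨fun k hk => ?_, fun i hi p => ?_⟩
  · obtain ⟨c1, c2, c3⟩ := c k hk
    exact (hl c1).trans ((j1 k hk).trans ((hl c3).trans ((j2 k hk).trans (hl c2).symm)))
  · by_cases h : i ≤ W.length
    · obtain ⟨q, hq⟩ := joined_top (comulWord_ne_cap n) h p
      obtain ⟨r, hr⟩ := top q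
      exact ⟨r, (hl hq).trans hr⟩
    · obtain ⟨j, rfl⟩ := Nat.exists_eq_add_of_le (Nat.le_of_not_le h)
      obtain ⟨q, hq⟩ := H.2 j (by rw [List.length_append] at hi; omega) p
      obtain ⟨r, hr'⟩ := top q
      exact ⟨r, (hr hq).trans hr'⟩

/-- The class `a` of ribbon tangles with `2n` bottom endpoints and no top endpoint consists of ribbon
`n`-handles. -/
def IsHandleClass {n : ℕ} (a : ConvEnd tangle 2 n) : Prop :=
  ∃ D : tangle.Diagram (2 * n) 0, ConvEnd.ofDiagram D = a ∧ IsHandle n D.word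

theorem IsHandleClass.tmul {m n : ℕ} {a : ConvEnd tangle 2 m} {b : ConvEnd tangle 2 n}
    (ha : IsHandleClass a) (hb : IsHandleClass b) : IsHandleClass (ConvEnd.tmul a b) := by
  obtain ⟨D, rfl, hD⟩ := ha
  obtain ⟨E, rfl, hE⟩ := hb
  exact ⟨_, (ConvEnd.tmul_cls D E).symm, hD.tensor D.typed hE⟩

theorem IsHandleClass.mul {n : ℕ} {a b : ConvEnd tangle 2 n}
    (ha : IsHandleClass a) (hb : IsHandleClass b) : IsHandleClass (a * b) := by
  obtain ⟨D, rfl, hD⟩ := ha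
  obtain ⟨E, rfl, hE⟩ := hb
  obtain ⟨h, e⟩ := ofDiagram_mul D.typed E.typed
  exact ⟨_, e.symm, hD.mul D.typed hE⟩

theorem isHandle_cap : IsHandle 1 [(0, .cap)] := by
  have hw : [((0 : ℕ), TangleGen.cap)][0]? = some (0, .cap) := rfl
  refine ⟨fun k hk => ?_, fun i hi p => ?_⟩
  · obtain rfl : k = 0 := by omega
    exact .of_link hw .cap
  · obtain rfl | rfl : i = 0 ∨ i = 1 := by simp at hi; omega
    · exact ⟨p, .refl _⟩
    · refine ⟨2 + p, .symm (.of_link hw ?_)⟩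
      simpa [TangleGen.src, TangleGen.tgt] using Link.right (i := 0) (k := 0) .cap p

theorem isHandleClass_one (n : ℕ) : IsHandleClass (1 : ConvEnd tangle 2 n) := by
  induction n with
  | zero => exact ⟨⟨[], rfl⟩, ConvEnd.one_zero.symm, fun k hk => absurd hk (Nat.not_lt_zero k), rooted_nil⟩
  | succ n ih =>
    rw [← ConvEnd.one_tmul_one n 1]
    exact ih.tmul ⟨⟨[(0, .cap)], 0, rfl, rfl⟩, by rw [ConvEnd.one_def]; rfl, isHandle_cap⟩

/-- The monoid of isotopy classes of ribbon `n`-handles. The product `a * b` is the convolution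
product: each bottom pair of strands is doubled by inserting a cup between its two strands, the left
one of the resulting pairs is connected to `a`, and the right one, passing over, is connected to
`b`. -/
def handles (n : ℕ) : Submonoid (ConvEnd tangle 2 n) where
  carrier := {a | IsHandleClass a}
  one_mem' := isHandleClass_one n
  mul_mem' ha hb := ha.mul hb

theorem handles_heq {m n : ℕ} {a : handles m} {b : handles n} (h : m = n)
    (e : HEq a.1 b.1) : HEq a b := by
  subst h
  exact heq_of_eq (Subtype.ext (eq_of_heq e))

instance : TensorMonoids (fun n => handles n) where
  tmul a b := ⟨ConvEnd.tmul a.1 b.1, IsHandleClass.tmul a.2 b.2⟩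
  tmul_mul a a' b b' := Subtype.ext (ConvEnd.tmul_mul a.1 a'.1 b.1 b'.1)
  one_tmul_one m n := Subtype.ext (ConvEnd.one_tmul_one m n)
  tmul_assoc a b c := handles_heq (Nat.add_assoc _ _ _) (TensorMonoids.tmul_assoc a.1 b.1 c.1)
  one_tmul a := handles_heq (Nat.zero_add _) (TensorMonoids.one_tmul a.1)
  tmul_one a := handles_heq (Nat.add_zero _) (TensorMonoids.tmul_one a.1)

/-- The monoidal category of ribbon handles. The tensor product is juxtaposition. -/
abbrev RHand : Type := EndoCat (fun n => handles n)

/-! ## From Hopf diagrams to ribbon handles -/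

/-- The image of `S`: the two strands of a pair are exchanged by a positive crossing, and then the
strand on the left gets a curl of framing `+1`. -/
def antipodeWord : List (ℕ × TangleGen) :=
  [(0, .cross true), (0, .cup), (1, .cross true), (0, .cap)]

/-- The image of `S⁻¹`: the strand on the left gets a curl of framing `-1`, and then the two strands
are exchanged by a negative crossing. -/
def antipodeInvWord : List (ℕ × TangleGen) :=
  [(0, .cup), (1, .cross false), (0, .cap), (0, .cross false)]

/-- The image of `ω₋`: two caps which are clasped, the right strand of the first pair and the left
strand of the second pair making a positive full twist. -/
def claspWord : List (ℕ × TangleGen) :=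
  [(1, .cross true), (1, .cross true), (0, .cap), (0, .cap)]

/-- The rule sending the generators of Hopf diagrams to pieces of ribbon tangles. A strand of a Hopf
diagram becomes a pair of strands; `Δ` becomes a cup inserted between the two strands, `ε` a cap,
`θ_±` a cap with one curl of framing `±1`, and the braiding the crossing of two pairs of strands. -/
def rule : HopfGen → List (ℕ × TangleGen)
  | .comul => [(1, .cup)]
  | .counit => [(0, .cap)]
  | .antipode => antipodeWord
  | .antipodeInv => antipodeInvWord
  | .omega false => claspWord
  | .omega true => antipodeInvWord ++ claspWord
  | .theta s => [(2, .cup), (1, .cross s), (2, .cap), (0, .cap)]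
  | .tau true => braidWord (.cross true) 2 2
  | .tau false => ((braidWord (TangleGen.cross true) 2 2).map fun s => (s.1, .cross false)).reverse

instance decTangle (m n : ℕ) (w : List (ℕ × TangleGen)) : Decidable (tangle.Typed m w n) :=
  decTyped (P := tangle) m w n

theorem typed_rule (g : HopfGen) : tangle.Typed (2 * g.src) (rule g) (2 * g.tgt) := by
  cases g <;> decide +revert

/-- The word obtained by replacing each generator by its image. -/
def phiWord (w : List (ℕ × HopfGen)) : List (ℕ × TangleGen) :=
  w.flatMap fun s => shift (2 * s.1) (rule s.2)

theorem typed_phiWord {m n : ℕ} {w : hopf.Word} (h : hopf.Typed m w n) :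
    tangle.Typed (2 * m) (phiWord w) (2 * n) := by
  induction w generalizing m with
  | nil => obtain rfl : m = n := h; rfl
  | cons s w ih =>
    obtain ⟨k, g⟩ := s
    obtain ⟨r, rfl, h⟩ := h
    exact ((((typed_rule g).left (2 * k)).right (2 * r)).cast
      (m' := 2 * (k + HopfGen.src g + r)) (n' := 2 * (k + HopfGen.tgt g + r))
      (by ring) (by ring)).append (ih h)

/-- The plane diagram `φ_D` of a Hopf diagram `D`, obtained by the rules and stacking. -/
def phi {m n : ℕ} (D : hopf.Diagram m n) : tangle.Diagram (2 * m) (2 * n) :=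
  ⟨phiWord D.word, typed_phiWord D.typed⟩

/-! ## From ribbon handles to string links -/

/-- The tangle with `n` bottom endpoints and `n + 2n` top endpoints, of which the first `n` are
`t_1, …, t_n` and the last ones `l_1, r_1, …, l_n, r_n`: the `k`-th bottom endpoint is joined to `r_k`
by a vertical strand, and `t_k` is joined to `l_k` by a cup on the left of this strand, the branch
towards `t_k` passing behind the strands `l_1, r_1, …, l_(k-1), r_(k-1)`. -/
def openWord : ℕ → List (ℕ × TangleGen)
  | 0 => []
  | n + 1 => openWord n ++ [(3 * n, .cup)] ++ shift n (braidWord (.cross true) (2 * n) 1)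

theorem typed_openWord (n : ℕ) : tangle.Typed n (openWord n) (n + 2 * n) := by
  induction n with
  | zero => rfl
  | succ n ih =>
    refine Typed.append (a := n + (2 * n + 1) + 2) (Typed.append (a := n + 2 * n + 1)
      (ih.right 1) ?_) ?_
    · exact (typed_gen (P := tangle) (3 * n) .cup 1).cast (by simp [tangle, TangleGen.src]; omega)
        (by simp [tangle, TangleGen.tgt]; omega)
    · exact (((typed_braidWord (P := tangle) (2 * n) 1).left n).right 2).cast rfl (by omega)

/-- The word of the string link obtained from a handle, see `openWord`. -/
def toStringLinkWord (n : ℕ) (w : List (ℕ × TangleGen)) : List (ℕ × TangleGen) :=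
  openWord n ++ shift n w

/-- The string link diagram `G_T` of a handle diagram `T`: the diagram `T` closes the last `2n` top
endpoints of `openWord n`. -/
def toStringLink {n : ℕ} (T : tangle.Diagram (2 * n) 0) : tangle.Diagram n n :=
  ⟨toStringLinkWord n T.word, (typed_openWord n).append (T.typed.left n)⟩

/-! ## Classes -/

/-- The morphism `n ⟶ n` of `DiagS` represented by a diagram. -/
def hopfClass {n : ℕ} (D : hopf.Diagram n 0) : ConvEnd hopf 1 n :=
  ConvEnd.ofDiagram ⟨D.word, D.typed.cast (Nat.one_mul n).symm rfl⟩

/-- The isotopy class of a handle diagram. -/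
def handleClass {n : ℕ} (T : tangle.Diagram (2 * n) 0) (h : IsHandle n T.word) : handles n :=
  ⟨ConvEnd.ofDiagram T, T, rfl, h⟩

/-- A functor between such categories is the identity on the objects, and is a monoidal functor whose
structure isomorphisms are identities (strict monoidal functor). -/
structure IsStrictMonoidal {M N : ℕ → Type} [∀ n, Monoid (M n)] [∀ n, Monoid (N n)]
    [TensorMonoids M] [TensorMonoids N] (F : EndoCat M ⥤ EndoCat N) : Prop where
  obj : ∀ n, F.obj (EndoCat.obj M n) = EndoCat.obj N n
  monoidal : ∃ _ : F.Monoidal, (∃ h, Functor.LaxMonoidal.ε F = eqToHom h) ∧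
    ∀ m n, ∃ h, Functor.LaxMonoidal.μ F (EndoCat.obj M m) (EndoCat.obj M n) = eqToHom h

/-- The functor `F` sends the endomorphism `a` of `n` to the endomorphism `b` of `n = F(n)`. -/
def Sends {M N : ℕ → Type} [∀ n, Monoid (M n)] [∀ n, Monoid (N n)]
    (F : EndoCat M ⥤ EndoCat N) {n : ℕ} (a : M n) (b : N n) : Prop :=
  ∃ h : F.obj (EndoCat.obj M n) = EndoCat.obj N n,
    F.map (X := EndoCat.obj M n) (Y := EndoCat.obj M n) (EndoCat.of a) =
      eqToHom h ≫ (show EndoCat.obj N n ⟶ EndoCat.obj N n from EndoCat.of b) ≫ eqToHom h.symm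


end HopfDiag

open CategoryTheory MonoidalCategory HopfDiag Presentation

/-!
The image `φ_D` of a Hopf diagram is a word in cups, caps and crossings, so each assertion is an
isotopy between explicit words (`Isotopic`), or a statement about the components of one.

The relations of Hopf diagrams. Axioms of a coalgebra become zigzags and an exchange of heights,
and naturality of the braiding becomes the sliding of a band over or below a diagram. The antipode
is a crossing of the two strands of a pair with a curl on one of them; as curls become crossings
below caps (`curl_cap`) and slide through crossings (`slide_left`, `slide_right`), and curls of
opposite framings cancel (`curl_curl`), the antipode is absorbed by a cap (`antipode_cap`), and
`S ⊗ S` after the crossing of two pairs is, up to curls, the half twist of four strands. Over a cup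
the half twist turns the cup over, which gives `ΔS = (S ⊗ S)τΔ` (`antipode_comul`). It commutes
with the crossing of the two inner strands, hence with the full twist of the clasp, and caps
absorb it; so the clasp is invariant under it (`pairCross_antipode_clasp`). Together with the
symmetry of the clasp under `S` (`antipode_clasp`), this yields the relations with `S⁻¹`. A
relation applied to some strands of a larger diagram then becomes an isotopy of the larger diagram
(`phiWord_step`).

Components. Each generator whose pairs of top strands are closed by caps is a handle
(`isHandle_rule`, a finite check), and the caps may be replaced by another handle
(`IsHandle.comp`), so `φ_D` is a handle by induction. In `G_T`, the bottom endpoints and the top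
endpoints are led to the right and left ends of the arcs of `T`, so that `G_T` is a string link
(`IsHandle.isStringLink`).

The functor `G`. The word `openWord n`, from which `G_T` arises by closing its last `2n` strands
with `T`, makes `n` strands a right comodule over the coalgebra of `n` pairs of strands: splitting
all strands twice is the same as splitting them once and applying the coproduct
(`openWord_coassoc`). The induction step rests on the fact that everything to the left of a strand
which is split slides in front of its new branch (`splitWord_natural`). Hence a convolution
product becomes a composition of string links. Counitality of the comodule is a zigzag
(`toStringLinkWord_caps`), and compatibility with juxtaposition is the decomposition
`openWord_add` of `openWord (m + n)`.

Finally, a family of monoid homomorphisms which respects the tensor products is a strict monoidal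
functor (`EndoCat.functor_isStrictMonoidal`); `ψ` comes from the composite family.
-/

open CategoryTheory MonoidalCategory HopfDiag Presentation

set_option linter.unusedSectionVars false

namespace HopfDiag

namespace Presentation.Eqv

variable {P : Presentation}

/-- A local equivalence, applied to consecutive layers of a larger diagram, with `k` vertical
strands on the left and `q` on the right of the part that changes. -/
theorem context {a b : ℕ} {l r : P.Word} (h : Eqv a b l r) (k : ℕ) (u v : P.Word) (q : ℕ)
    {m n : ℕ} (hu : P.Typed m u (k + a + q) := by decide +revert)
    (hv : P.Typed (k + b + q) v n := by decide +revert) :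
    Eqv m n (u ++ shift k l ++ v) (u ++ shift k r ++ v) :=
  ((refl hu).append ((h.left k).right q)).append (refl hv)

end Presentation.Eqv

/-! ### Curls -/

open TangleGen Eqv

/-- Isotopy of the ribbon tangles represented by two words, with `m` bottom and `n` top
endpoints. -/
abbrev Isotopic (m n : ℕ) (w w' : List (ℕ × TangleGen)) : Prop := Eqv (P := tangle) m n w w'

/-- The word `w` is a diagram with `m` bottom and `n` top endpoints. -/
abbrev IsTangle (m : ℕ) (w : List (ℕ × TangleGen)) (n : ℕ) : Prop := tangle.Typed m w n

instance (m n : ℕ) : Trans (Isotopic m n) (Isotopic m n) (Isotopic m n) where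
  trans := Eqv.trans

namespace Isotopic

theorem refl {m n : ℕ} {w : List (ℕ × TangleGen)} (h : IsTangle m w n) : Isotopic m n w w :=
  Eqv.refl h

theorem symm {m n : ℕ} {w w' : List (ℕ × TangleGen)} (h : Isotopic m n w w') :
    Isotopic m n w' w := Eqv.symm h

theorem trans {m n : ℕ} {w w' w'' : List (ℕ × TangleGen)} (h : Isotopic m n w w')
    (h' : Isotopic m n w' w'') : Isotopic m n w w'' := Eqv.trans h h'

theorem append {m a n : ℕ} {u u' v v' : List (ℕ × TangleGen)} (h : Isotopic m a u u')
    (h' : Isotopic a n v v') : Isotopic m n (u ++ v) (u' ++ v') := Eqv.append h h'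

end Isotopic

local notation:50 w:51 " ≈[" m ", " n "] " w':51 => Isotopic m n w w'

/-- The layer with a local minimum at the position `k`. -/
abbrev cu (k : ℕ) : ℕ × TangleGen := (k, cup)

/-- The layer with a local maximum at the position `k`. -/
abbrev ca (k : ℕ) : ℕ × TangleGen := (k, cap)

/-- The layer with a crossing of sign `s` at the position `k`. -/
abbrev cr (s : Bool) (k : ℕ) : ℕ × TangleGen := (k, cross s)

/-- A strand with one curl of framing `±1`, turning to its left. -/
def curl (s : Bool) : List (ℕ × TangleGen) := [cu 0, cr s 1, ca 0]

theorem zigzag_left : [cu 0, ca 1] ≈[1, 1] [] :=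
  .move (.rel .zigzag_left) (by decide) (by decide)

theorem zigzag_right : [cu 1, ca 0] ≈[1, 1] [] :=
  .move (.rel .zigzag_right) (by decide) (by decide)

theorem cross_cap_right (s : Bool) : [cr s 1, ca 0] ≈[3, 1] [cr (!s) 0, ca 1] :=
  .move (.rel (.cap_slide s)) (by decide +revert) (by decide +revert)

theorem cross_cap_left (s : Bool) : [cr s 0, ca 1] ≈[3, 1] [cr (!s) 1, ca 0] := by
  simpa using (cross_cap_right (!s)).symm

theorem cup_cross_left (s : Bool) : [cu 0, cr s 1] ≈[1, 3] [cu 1, cr (!s) 0] :=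
  .move (.rel (.cup_slide s)) (by decide +revert) (by decide +revert)

theorem cup_cross_right (s : Bool) : [cu 1, cr s 0] ≈[1, 3] [cu 0, cr (!s) 1] := by
  simpa using (cup_cross_left (!s)).symm

theorem cross_cancel (s : Bool) : [cr s 0, cr (!s) 0] ≈[2, 2] [] :=
  .move (.rel (.cancel s)) (by decide +revert) (by decide +revert)

theorem curl_eqv (s : Bool) : curl s ≈[1, 1] [cu 1, cr s 0, ca 1] :=
  .symm (.move (.rel (.curl s)) (by decide +revert) (by decide +revert))

theorem typed_curl (s : Bool) : tangle.Typed 1 (curl s) 1 := by decide +revert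

theorem cap_cap : [ca 0, ca 0] ≈[4, 0] [ca 2, ca 0] := exchange (P := tangle) cap cap 0 0

theorem cup_cup : [cu 0, cu 2] ≈[0, 4] [cu 0, cu 0] := exchange (P := tangle) cup cup 0 0

/-- Exchange of the heights of a generator `g` on the left and a diagram `w` on the right. -/
theorem exchange_left {c d : ℕ} (g : TangleGen) {w : List (ℕ × TangleGen)}
    (h : tangle.Typed c w d) :
    [(0, g)] ++ shift (tangle.tgt g) w ≈[tangle.src g + c, tangle.tgt g + d]
      shift (tangle.src g) w ++ [(0, g)] :=
  exchange_gen g h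

/-- Exchange of the heights of a diagram `w` on the left and a generator `g` on the right. -/
theorem exchange_right {a b : ℕ} {w : List (ℕ × TangleGen)} (h : tangle.Typed a w b)
    (g : TangleGen) :
    w ++ [(b, g)] ≈[a + tangle.src g, b + tangle.tgt g] [(a, g)] ++ w :=
  interchange h (v := [(0, g)]) ((typed_gen (P := tangle) 0 g 0).cast (Nat.zero_add _)
    (Nat.zero_add _))

theorem curl_cap (s : Bool) : curl s ++ [ca 0] ≈[2, 0] [cr (!s) 0, ca 0] :=
  calc [cu 0, cr s 1, ca 0, ca 0]
    _ ≈[2, 0] [cu 0, cr s 1, ca 2, ca 0] := cap_cap.context 0 [cu 0, cr s 1] [] 0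
    _ ≈[2, 0] [cu 0, cr (!s) 2, ca 1, ca 0] := (cross_cap_left s).context 1 [cu 0] [ca 0] 0
    _ ≈[2, 0] [cr (!s) 0, cu 0, ca 1, ca 0] :=
      (exchange (P := tangle) cup (cross !s) 0 0).context 0 [] [ca 1, ca 0] 0
    _ ≈[2, 0] [cr (!s) 0, ca 0] := zigzag_left.context 0 [cr (!s) 0] [ca 0] 1

theorem curl_cap_right (s : Bool) : shift 1 (curl s) ++ [ca 0] ≈[2, 0] [cr (!s) 0, ca 0] :=
  calc shift 1 (curl s) ++ [ca 0]
    _ ≈[2, 0] [cu 2, cr s 1, ca 2, ca 0] := (curl_eqv s).context 1 [] [ca 0] 0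
    _ ≈[2, 0] [cu 2, cr s 1, ca 0, ca 0] := cap_cap.symm.context 0 [cu 2, cr s 1] [] 0
    _ ≈[2, 0] [cu 2, cr (!s) 0, ca 1, ca 0] := (cross_cap_right s).context 0 [cu 2] [ca 0] 1
    _ ≈[2, 0] [cr (!s) 0, cu 2, ca 1, ca 0] :=
      (exchange (P := tangle) (cross !s) cup 0 0).symm.context 0 [] [ca 1, ca 0] 0
    _ ≈[2, 0] [cr (!s) 0, ca 0] := zigzag_right.context 1 [cr (!s) 0] [ca 0] 0

theorem cup_curl (s : Bool) : [cu 0] ++ curl s ≈[0, 2] [cu 0, cr (!s) 0] :=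
  calc [cu 0, cu 0, cr s 1, ca 0]
    _ ≈[0, 2] [cu 0, cu 2, cr s 1, ca 0] := cup_cup.symm.context 0 [] [cr s 1, ca 0] 0
    _ ≈[0, 2] [cu 0, cu 1, cr (!s) 2, ca 0] := (cup_cross_right s).context 1 [cu 0] [ca 0] 0
    _ ≈[0, 2] [cu 0, cu 1, ca 0, cr (!s) 0] :=
      (exchange (P := tangle) cap (cross !s) 0 0).symm.context 0 [cu 0, cu 1] [] 0
    _ ≈[0, 2] [cu 0, cr (!s) 0] := zigzag_right.context 0 [cu 0] [cr (!s) 0] 1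

theorem cup_curl_right (s : Bool) : [cu 0] ++ shift 1 (curl s) ≈[0, 2] [cu 0, cr (!s) 0] :=
  calc [cu 0] ++ shift 1 (curl s)
    _ ≈[0, 2] [cu 0, cu 2, cr s 1, ca 2] := (curl_eqv s).context 1 [cu 0] [] 0
    _ ≈[0, 2] [cu 0, cu 0, cr s 1, ca 2] := cup_cup.context 0 [] [cr s 1, ca 2] 0
    _ ≈[0, 2] [cu 0, cu 1, cr (!s) 0, ca 2] := (cup_cross_left s).context 0 [cu 0] [ca 2] 1
    _ ≈[0, 2] [cu 0, cu 1, ca 2, cr (!s) 0] :=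
      (exchange (P := tangle) (cross !s) cap 0 0).context 0 [cu 0, cu 1] [] 0
    _ ≈[0, 2] [cu 0, cr (!s) 0] := zigzag_left.context 1 [cu 0] [cr (!s) 0] 0

/-- A diagram on one strand slides through a crossing. -/
theorem slide_left {w : List (ℕ × TangleGen)} (h : tangle.Typed 1 w 1) (s : Bool) :
    w ++ [cr s 0] ≈[2, 2] [cr s 0] ++ shift 1 w := by
  have hu : w ++ [cr true 0] ≈[2, 2] [cr true 0] ++ shift 1 w := eqv_under h
  have ho : shift 1 w ++ [cr true 0] ≈[2, 2] [cr true 0] ++ w := eqv_over h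
  cases s with
  | true => exact hu
  | false =>
    have t (s : Bool) : tangle.Typed 2 [cr s 0] 2 := by decide +revert
    have e1 : [cr false 0, cr true 0] ++ (w ++ [cr false 0]) ≈[2, 2] w ++ [cr false 0] :=
      (cross_cancel false).append (.refl ((h.right 1).append (t false)))
    have e2 : [cr false 0] ++ ([cr true 0] ++ w) ++ [cr false 0] ≈[2, 2]
        [cr false 0] ++ (shift 1 w ++ [cr true 0]) ++ [cr false 0] :=
      ((Eqv.refl (t false)).append ho.symm).append (.refl (t false))
    have e3 : ([cr false 0] ++ shift 1 w) ++ [cr true 0, cr false 0] ≈[2, 2]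
        ([cr false 0] ++ shift 1 w) ++ [] :=
      (Eqv.refl ((t false).append (h.left 1))).append (cross_cancel true)
    refine e1.symm.trans (.trans ?_ (by simpa using e3))
    simpa using e2

theorem slide_right {w : List (ℕ × TangleGen)} (h : tangle.Typed 1 w 1) (s : Bool) :
    shift 1 w ++ [cr s 0] ≈[2, 2] [cr s 0] ++ w := by
  have t (s : Bool) : tangle.Typed 2 [cr s 0] 2 := by decide +revert
  have e1 : [cr s 0, cr (!s) 0] ++ (shift 1 w ++ [cr s 0]) ≈[2, 2] shift 1 w ++ [cr s 0] :=
    (cross_cancel s).append (.refl ((h.left 1).append (t s)))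
  have e2 : [cr s 0] ++ ([cr (!s) 0] ++ shift 1 w) ++ [cr s 0] ≈[2, 2]
      [cr s 0] ++ (w ++ [cr (!s) 0]) ++ [cr s 0] :=
    ((Eqv.refl (t s)).append (slide_left h (!s)).symm).append (.refl (t s))
  have e3 : ([cr s 0] ++ w) ++ [cr (!s) 0, cr s 0] ≈[2, 2] ([cr s 0] ++ w) ++ [] :=
    (Eqv.refl ((t s).append (h.right 1))).append (by simpa using cross_cancel (!s))
  refine e1.symm.trans (.trans ?_ (by simpa using e3))
  simpa using e2

/-- Two curls of opposite framings cancel: the second one is moved to the other side of the strand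
and then along the first one. -/
theorem curl_curl (s : Bool) : curl s ++ curl (!s) ≈[1, 1] [] :=
  calc [cu 0, cr s 1, ca 0] ++ curl (!s)
    _ ≈[1, 1] [cu 0, cr s 1] ++ shift 2 (curl (!s)) ++ [ca 0] :=
      (exchange_left cap (typed_curl (!s))).context 0 [cu 0, cr s 1] [] 0
    _ ≈[1, 1] [cu 0] ++ shift 1 (curl (!s)) ++ [cr s 1, ca 0] :=
      (slide_left (typed_curl (!s)) s).symm.context 1 [cu 0] [ca 0] 0
    _ ≈[1, 1] [cu 0, cr (!!s) 0, cr s 1, ca 0] :=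
      (cup_curl_right (!s)).context 0 [] [cr s 1, ca 0] 1
    _ ≈[1, 1] [cu 0, cr (!!s) 0, cr (!s) 0, ca 1] :=
      (cross_cap_right s).context 0 [cu 0, cr (!!s) 0] [] 0
    _ ≈[1, 1] [cu 0, ca 1] := by
      rw [Bool.not_not]
      exact (cross_cancel s).context 0 [cu 0] [ca 1] 1
    _ ≈[1, 1] [] := zigzag_left

/-! ### The images of the relations of Hopf diagrams -/

theorem typed_antipodeWord : tangle.Typed 2 antipodeWord 2 := by decide

theorem typed_antipodeInvWord : tangle.Typed 2 antipodeInvWord 2 := by decide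

theorem antipodeInv_antipode : antipodeInvWord ++ antipodeWord ≈[2, 2] [] :=
  calc antipodeInvWord ++ antipodeWord
    _ ≈[2, 2] curl false ++ curl true := (cross_cancel false).context 0 (curl false) (curl true) 0
    _ ≈[2, 2] [] := (curl_curl false).context 0 [] [] 1

theorem antipode_antipodeInv : antipodeWord ++ antipodeInvWord ≈[2, 2] [] :=
  calc antipodeWord ++ antipodeInvWord
    _ ≈[2, 2] [cr true 0, cr false 0] := (curl_curl true).context 0 [cr true 0] [cr false 0] 1
    _ ≈[2, 2] [] := cross_cancel true

theorem antipode_cap : antipodeWord ++ [ca 0] ≈[2, 0] [ca 0] :=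
  calc antipodeWord ++ [ca 0]
    _ ≈[2, 0] [cr true 0, cr false 0, ca 0] := (curl_cap true).context 0 [cr true 0] [] 0
    _ ≈[2, 0] [ca 0] := (cross_cancel true).context 0 [] [ca 0] 0

theorem theta_eqv (s : Bool) : rule (.theta s) ≈[2, 0] [cr (!s) 0, ca 0] :=
  ((curl_eqv s).symm.context 1 [] [ca 0] 0).trans (curl_cap_right s)

theorem antipode_theta (s : Bool) :
    antipodeWord ++ rule (.theta s) ≈[2, 0] rule (.theta s) := by
  refine .trans ?_ (theta_eqv s).symm
  calc antipodeWord ++ rule (.theta s)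
    _ ≈[2, 0] antipodeWord ++ [cr (!s) 0, ca 0] := (theta_eqv s).context 0 antipodeWord [] 0
    _ ≈[2, 0] [cr true 0, cr (!s) 0] ++ shift 1 (curl true) ++ [ca 0] :=
      (slide_left (typed_curl true) (!s)).context 0 [cr true 0] [ca 0] 0
    _ ≈[2, 0] [cr true 0, cr (!s) 0, cr false 0, ca 0] :=
      (curl_cap_right true).context 0 [cr true 0, cr (!s) 0] [] 0
    _ ≈[2, 0] [cr (!s) 0, ca 0] := by
      cases s
      · exact (cross_cancel true).context 0 [cr true 0] [ca 0] 0
      · exact (cross_cancel true).context 0 [] [cr false 0, ca 0] 0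

/-- The positive crossing of two pairs of strands. -/
abbrev pairCross : List (ℕ × TangleGen) := braidWord (cross true) 2 2

theorem typed_pairCross : tangle.Typed 4 pairCross 4 := by decide

/-- Two words of the positive half twist of four strands. -/
theorem halfTwist : pairCross ++ [cr true 0, cr true 2] ≈[4, 4]
    [cr true 1, cr true 0, cr true 1, cr true 2, cr true 1, cr true 0] :=
  calc [cr true 1, cr true 2, cr true 0, cr true 1, cr true 0, cr true 2]
    _ ≈[4, 4] [cr true 1, cr true 0, cr true 2, cr true 1, cr true 0, cr true 2] :=
      (exchange (P := tangle) (cross true) (cross true) 0 0).symm.context 0 [cr true 1]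
        [cr true 1, cr true 0, cr true 2] 0
    _ ≈[4, 4] [cr true 1, cr true 0, cr true 2, cr true 1, cr true 2, cr true 0] :=
      (exchange (P := tangle) (cross true) (cross true) 0 0).context 0
        [cr true 1, cr true 0, cr true 2, cr true 1] [] 0
    _ ≈[4, 4] [cr true 1, cr true 0, cr true 1, cr true 2, cr true 1, cr true 0] :=
      triple.symm.context 1 [cr true 1, cr true 0] [cr true 0] 0

/-- The half twist of four strands commutes with the crossing of the two inner strands. -/
theorem halfTwist_cross : pairCross ++ [cr true 0, cr true 2, cr true 1] ≈[4, 4]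
    [cr true 1] ++ pairCross ++ [cr true 0, cr true 2] :=
  calc pairCross ++ [cr true 0, cr true 2, cr true 1]
    _ ≈[4, 4] [cr true 1, cr true 0, cr true 1, cr true 2, cr true 1, cr true 0, cr true 1] :=
      halfTwist.context 0 [] [cr true 1] 0
    _ ≈[4, 4] [cr true 1, cr true 0, cr true 1, cr true 2, cr true 0, cr true 1, cr true 0] :=
      triple.symm.context 0 [cr true 1, cr true 0, cr true 1, cr true 2] [] 1
    _ ≈[4, 4] [cr true 1, cr true 0, cr true 1, cr true 0, cr true 2, cr true 1, cr true 0] :=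
      (exchange (P := tangle) (cross true) (cross true) 0 0).symm.context 0
        [cr true 1, cr true 0, cr true 1] [cr true 1, cr true 0] 0
    _ ≈[4, 4] [cr true 1, cr true 1, cr true 0, cr true 1, cr true 2, cr true 1, cr true 0] :=
      triple.context 0 [cr true 1] [cr true 2, cr true 1, cr true 0] 1
    _ ≈[4, 4] [cr true 1] ++ pairCross ++ [cr true 0, cr true 2] :=
      halfTwist.symm.context 0 [cr true 1] [] 0

/-- A half twist of four strands above a cup between the inner two turns the cup over, and moves it
between the two outer strands. -/
theorem cup_halfTwist : [cu 1] ++ pairCross ++ [cr true 0, cr true 2] ≈[2, 4]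
    [cr true 0, cu 1, cr true 1] := by
  have tw : tangle.Typed 0 [cu 0, cr true 0] 2 := by decide
  have ho : [cu 1, cr true 1] ++ [cr true 0, cr true 1] ≈[1, 3] [cu 0, cr true 0] := eqv_over tw
  have hu : [cu 0, cr true 0] ++ [cr true 1, cr true 0] ≈[1, 3] [cu 1, cr true 1] := eqv_under tw
  have he : [cu 0, cr true 0, cr true 2] ≈[2, 4] [cr true 0, cu 0, cr true 0] :=
    exchange_right tw (cross true)
  calc [cu 1] ++ pairCross ++ [cr true 0, cr true 2]
    _ ≈[2, 4] [cu 1, cr true 1, cr true 0, cr true 1, cr true 2, cr true 1, cr true 0] :=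
      halfTwist.context 0 [cu 1] [] 0
    _ ≈[2, 4] [cu 0, cr true 0, cr true 2, cr true 1, cr true 0] :=
      ho.context 0 [] [cr true 2, cr true 1, cr true 0] 1
    _ ≈[2, 4] [cr true 0, cu 0, cr true 0, cr true 1, cr true 0] :=
      he.context 0 [] [cr true 1, cr true 0] 0
    _ ≈[2, 4] [cr true 0, cu 1, cr true 1] := hu.context 0 [cr true 0] [] 1

/-- `S ⊗ S` written with the two crossings first. -/
theorem antipode_antipode : antipodeWord ++ shift 2 antipodeWord ≈[4, 4]
    [cr true 0, cr true 2] ++ curl true ++ shift 2 (curl true) :=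
  (exchange_right ((typed_curl true).right 1) (cross true)).context 0 [cr true 0]
    (shift 2 (curl true)) 0

theorem antipode_comul : antipodeWord ++ [cu 1] ≈[2, 4]
    [cu 1] ++ pairCross ++ antipodeWord ++ shift 2 antipodeWord := by
  refine Eqv.symm ?_
  have h1 : curl true ++ shift 2 (curl true) ≈[3, 3] shift 2 (curl true) ++ curl true :=
    interchange ((typed_curl true).right 1) (typed_curl true)
  have h2 : curl true ++ [cu 1] ≈[1, 3] [cu 1] ++ curl true :=
    exchange_right (typed_curl true) cup
  calc [cu 1] ++ pairCross ++ antipodeWord ++ shift 2 antipodeWord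
    _ ≈[2, 4] [cu 1] ++ pairCross ++ [cr true 0, cr true 2] ++ curl true ++ shift 2 (curl true) :=
      antipode_antipode.context 0 ([cu 1] ++ pairCross) [] 0
    _ ≈[2, 4] [cr true 0, cu 1, cr true 1] ++ curl true ++ shift 2 (curl true) :=
      cup_halfTwist.context 0 [] (curl true ++ shift 2 (curl true)) 0
    _ ≈[2, 4] [cr true 0, cu 1, cr true 1] ++ shift 2 (curl true) ++ curl true :=
      h1.context 0 [cr true 0, cu 1, cr true 1] [] 1
    _ ≈[2, 4] [cr true 0, cu 1] ++ shift 1 (curl true) ++ [cr true 1] ++ curl true :=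
      (slide_left (typed_curl true) true).symm.context 1 [cr true 0, cu 1] (curl true) 1
    _ ≈[2, 4] [cr true 0, cu 1, cr false 1, cr true 1] ++ curl true :=
      (cup_curl true).context 1 [cr true 0] ([cr true 1] ++ curl true) 1
    _ ≈[2, 4] [cr true 0, cu 1] ++ curl true :=
      (cross_cancel false).context 1 [cr true 0, cu 1] (curl true) 1
    _ ≈[2, 4] antipodeWord ++ [cu 1] := h2.symm.context 0 [cr true 0] [] 1

/-- The second crossing of the clasp, moved along the lower cap to the two strands on the left. -/
theorem clasp_eqv_left : claspWord ≈[4, 0] [cr true 1, cr false 0, ca 1, ca 0] :=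
  (cross_cap_right true).context 0 [cr true 1] [ca 0] 1

theorem clasp_eqv_right : claspWord ≈[4, 0] [cr true 1, cr false 2, ca 1, ca 0] :=
  calc claspWord
    _ ≈[4, 0] [cr true 1, cr true 1, ca 2, ca 0] := cap_cap.context 0 [cr true 1, cr true 1] [] 0
    _ ≈[4, 0] [cr true 1, cr false 2, ca 1, ca 0] :=
      (cross_cap_left true).context 1 [cr true 1] [ca 0] 0

/-- Below the first pair, `S` turns the positive clasp into the negative one. -/
theorem antipode_clasp_left :
    antipodeWord ++ claspWord ≈[4, 0] [cr false 1, cr false 1, ca 0, ca 0] := by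
  have h : curl true ++ [cr true 1] ≈[3, 3] [cr true 1] ++ curl true :=
    exchange_right (typed_curl true) (cross true)
  calc antipodeWord ++ claspWord
    _ ≈[4, 0] antipodeWord ++ [cr true 1, cr false 0, ca 1, ca 0] :=
      clasp_eqv_left.context 0 antipodeWord [] 0
    _ ≈[4, 0] [cr true 0, cr true 1] ++ curl true ++ [cr false 0, ca 1, ca 0] :=
      h.context 0 [cr true 0] [cr false 0, ca 1, ca 0] 1
    _ ≈[4, 0] [cr true 0, cr true 1, cr false 0] ++ shift 1 (curl true) ++ [ca 1, ca 0] :=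
      (slide_left (typed_curl true) false).context 0 [cr true 0, cr true 1] [ca 1, ca 0] 2
    _ ≈[4, 0] [cr true 0, cr true 1, cr false 0, cr false 1, ca 1, ca 0] :=
      (curl_cap true).context 1 [cr true 0, cr true 1, cr false 0] [ca 0] 1
    _ ≈[4, 0] [cr false 1, cr true 0, cr true 1, cr false 1, ca 1, ca 0] :=
      over_neg.symm.context 0 [] [cr false 1, ca 1, ca 0] 1
    _ ≈[4, 0] [cr false 1, cr true 0, ca 1, ca 0] :=
      (cross_cancel true).context 1 [cr false 1, cr true 0] [ca 1, ca 0] 1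
    _ ≈[4, 0] [cr false 1, cr false 1, ca 0, ca 0] :=
      (cross_cap_left true).context 0 [cr false 1] [ca 0] 1

theorem antipode_clasp_right :
    shift 2 antipodeWord ++ claspWord ≈[4, 0] [cr false 1, cr false 1, ca 0, ca 0] := by
  have h : curl true ++ [cr false 1] ≈[3, 3] [cr false 1] ++ curl true :=
    exchange_right (typed_curl true) (cross false)
  calc shift 2 antipodeWord ++ claspWord
    _ ≈[4, 0] shift 2 antipodeWord ++ [cr true 1, cr false 2, ca 1, ca 0] :=
      clasp_eqv_right.context 0 (shift 2 antipodeWord) [] 0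
    _ ≈[4, 0] [cr true 2, cr true 1] ++ shift 1 (curl true) ++ [cr false 2, ca 1, ca 0] :=
      (slide_right (typed_curl true) true).context 1 [cr true 2] [cr false 2, ca 1, ca 0] 1
    _ ≈[4, 0] [cr true 2, cr true 1, cr false 2] ++ shift 1 (curl true) ++ [ca 1, ca 0] :=
      h.context 1 [cr true 2, cr true 1] [ca 1, ca 0] 0
    _ ≈[4, 0] [cr true 2, cr true 1, cr false 2, cr false 1, ca 1, ca 0] :=
      (curl_cap true).context 1 [cr true 2, cr true 1, cr false 2] [ca 0] 1
    _ ≈[4, 0] [cr false 1, cr true 2, cr true 1, cr false 1, ca 1, ca 0] :=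
      under_neg.symm.context 1 [] [cr false 1, ca 1, ca 0] 0
    _ ≈[4, 0] [cr false 1, cr true 2, ca 1, ca 0] :=
      (cross_cancel true).context 1 [cr false 1, cr true 2] [ca 1, ca 0] 1
    _ ≈[4, 0] [cr false 1, cr false 1, ca 2, ca 0] :=
      (cross_cap_right true).context 1 [cr false 1] [ca 0] 0
    _ ≈[4, 0] [cr false 1, cr false 1, ca 0, ca 0] :=
      cap_cap.symm.context 0 [cr false 1, cr false 1] [] 0

theorem antipode_clasp : antipodeWord ++ claspWord ≈[4, 0] shift 2 antipodeWord ++ claspWord :=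
  antipode_clasp_left.trans antipode_clasp_right.symm

theorem pairCross_cap_cap : pairCross ++ [ca 0, ca 0] ≈[4, 0] [ca 0, ca 0] := by
  have h : [ca 2] ≈[4, 2] pairCross ++ [ca 0] :=
    braid_natural_right (P := tangle) 2 (w := [ca 0]) (a := 2) (b := 0) (by decide)
  calc pairCross ++ [ca 0, ca 0]
    _ ≈[4, 0] [ca 2, ca 0] := h.symm.context 0 [] [ca 0] 0
    _ ≈[4, 0] [ca 0, ca 0] := cap_cap.symm

/-- The clasp is not changed if its two components exchange their places and both are turned over:
the half twist involved commutes with the full twist of the clasp and is absorbed by the caps. -/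
theorem pairCross_antipode_clasp :
    pairCross ++ antipodeWord ++ shift 2 antipodeWord ++ claspWord ≈[4, 0] claspWord := by
  have h1 : curl true ++ shift 2 (curl true) ≈[4, 4] shift 2 (curl true) ++ curl true :=
    interchange ((typed_curl true).right 1) ((typed_curl true).right 1)
  have h2 : curl true ++ [cr true 1] ≈[3, 3] [cr true 1] ++ curl true :=
    exchange_right (typed_curl true) (cross true)
  have h3 : [ca 0] ++ antipodeWord ≈[4, 2] shift 2 antipodeWord ++ [ca 0] :=
    exchange_left cap typed_antipodeWord
  have hc : curl true ++ shift 2 (curl true) ++ [cr true 1, cr true 1] ≈[4, 4]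
      [cr true 1, cr true 1] ++ curl true ++ shift 2 (curl true) :=
    calc curl true ++ shift 2 (curl true) ++ [cr true 1, cr true 1]
      _ ≈[4, 4] curl true ++ [cr true 1] ++ shift 1 (curl true) ++ [cr true 1] :=
        (slide_right (typed_curl true) true).context 1 (curl true) [cr true 1] 1
      _ ≈[4, 4] curl true ++ [cr true 1, cr true 1] ++ shift 2 (curl true) :=
        (slide_left (typed_curl true) true).context 1 (curl true ++ [cr true 1]) [] 1
      _ ≈[4, 4] [cr true 1] ++ curl true ++ [cr true 1] ++ shift 2 (curl true) :=
        h2.context 0 [] ([cr true 1] ++ shift 2 (curl true)) 1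
      _ ≈[4, 4] [cr true 1, cr true 1] ++ curl true ++ shift 2 (curl true) :=
        h2.context 0 [cr true 1] (shift 2 (curl true)) 1
  calc pairCross ++ antipodeWord ++ shift 2 antipodeWord ++ claspWord
    _ ≈[4, 0] pairCross ++ [cr true 0, cr true 2] ++ curl true ++ shift 2 (curl true) ++
        claspWord := antipode_antipode.context 0 pairCross claspWord 0
    _ ≈[4, 0] pairCross ++ [cr true 0, cr true 2, cr true 1, cr true 1] ++ curl true ++
        shift 2 (curl true) ++ [ca 0, ca 0] :=
      hc.context 0 (pairCross ++ [cr true 0, cr true 2]) [ca 0, ca 0] 0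
    _ ≈[4, 0] [cr true 1] ++ pairCross ++ [cr true 0, cr true 2, cr true 1] ++ curl true ++
        shift 2 (curl true) ++ [ca 0, ca 0] :=
      halfTwist_cross.context 0 []
        ([cr true 1] ++ curl true ++ shift 2 (curl true) ++ [ca 0, ca 0]) 0
    _ ≈[4, 0] [cr true 1, cr true 1] ++ pairCross ++ [cr true 0, cr true 2] ++ curl true ++
        shift 2 (curl true) ++ [ca 0, ca 0] :=
      halfTwist_cross.context 0 [cr true 1]
        (curl true ++ shift 2 (curl true) ++ [ca 0, ca 0]) 0
    _ ≈[4, 0] [cr true 1, cr true 1] ++ pairCross ++ antipodeWord ++ shift 2 antipodeWord ++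
        [ca 0, ca 0] :=
      antipode_antipode.symm.context 0 ([cr true 1, cr true 1] ++ pairCross) [ca 0, ca 0] 0
    _ ≈[4, 0] [cr true 1, cr true 1] ++ pairCross ++ antipodeWord ++ [ca 0] ++ antipodeWord ++
        [ca 0] :=
      h3.symm.context 0 ([cr true 1, cr true 1] ++ pairCross ++ antipodeWord) [ca 0] 0
    _ ≈[4, 0] [cr true 1, cr true 1] ++ pairCross ++ [ca 0] ++ antipodeWord ++ [ca 0] :=
      antipode_cap.context 0 ([cr true 1, cr true 1] ++ pairCross) (antipodeWord ++ [ca 0]) 2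
    _ ≈[4, 0] [cr true 1, cr true 1] ++ pairCross ++ [ca 0, ca 0] :=
      antipode_cap.context 0 ([cr true 1, cr true 1] ++ pairCross ++ [ca 0]) [] 0
    _ ≈[4, 0] claspWord := pairCross_cap_cap.context 0 [cr true 1, cr true 1] [] 0

theorem antipode_pairCross :
    antipodeWord ++ pairCross ≈[4, 4] pairCross ++ shift 2 antipodeWord :=
  braid_natural_left (P := tangle) 2 typed_antipodeWord

theorem pairCross_antipode :
    shift 2 antipodeWord ++ pairCross ≈[4, 4] pairCross ++ antipodeWord :=
  braid_natural_right (P := tangle) 2 typed_antipodeWord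

theorem antipode_antipode_pairCross_clasp :
    antipodeWord ++ antipodeWord ++ pairCross ++ claspWord ≈[4, 0] claspWord :=
  have h : antipodeWord ++ shift 2 antipodeWord ≈[4, 4] shift 2 antipodeWord ++ antipodeWord :=
    interchange typed_antipodeWord typed_antipodeWord
  calc antipodeWord ++ antipodeWord ++ pairCross ++ claspWord
    _ ≈[4, 0] antipodeWord ++ pairCross ++ shift 2 antipodeWord ++ claspWord :=
      antipode_pairCross.context 0 antipodeWord claspWord 0
    _ ≈[4, 0] antipodeWord ++ pairCross ++ antipodeWord ++ claspWord :=
      antipode_clasp.symm.context 0 (antipodeWord ++ pairCross) [] 0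
    _ ≈[4, 0] pairCross ++ shift 2 antipodeWord ++ antipodeWord ++ claspWord :=
      antipode_pairCross.context 0 [] (antipodeWord ++ claspWord) 0
    _ ≈[4, 0] pairCross ++ antipodeWord ++ shift 2 antipodeWord ++ claspWord :=
      h.symm.context 0 pairCross claspWord 0
    _ ≈[4, 0] claspWord := pairCross_antipode_clasp

theorem antipodeInv_clasp_left :
    antipodeInvWord ++ antipodeInvWord ++ claspWord ≈[4, 0] pairCross ++ claspWord :=
  calc antipodeInvWord ++ antipodeInvWord ++ claspWord
    _ ≈[4, 0] antipodeInvWord ++ antipodeInvWord ++ antipodeWord ++ antipodeWord ++ pairCross ++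
        claspWord :=
      antipode_antipode_pairCross_clasp.symm.context 0 (antipodeInvWord ++ antipodeInvWord) [] 0
    _ ≈[4, 0] antipodeInvWord ++ antipodeWord ++ pairCross ++ claspWord :=
      antipodeInv_antipode.context 0 antipodeInvWord (antipodeWord ++ pairCross ++ claspWord) 2
    _ ≈[4, 0] pairCross ++ claspWord :=
      antipodeInv_antipode.context 0 [] (pairCross ++ claspWord) 2

theorem antipodeInv_clasp_right :
    shift 2 antipodeInvWord ++ antipodeInvWord ++ claspWord ≈[4, 0] pairCross ++ claspWord :=
  calc shift 2 antipodeInvWord ++ antipodeInvWord ++ claspWord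
    _ ≈[4, 0] shift 2 antipodeInvWord ++ antipodeInvWord ++ pairCross ++ antipodeWord ++
        shift 2 antipodeWord ++ claspWord :=
      pairCross_antipode_clasp.symm.context 0 (shift 2 antipodeInvWord ++ antipodeInvWord) [] 0
    _ ≈[4, 0] shift 2 antipodeInvWord ++ antipodeInvWord ++ pairCross ++ antipodeWord ++
        antipodeWord ++ claspWord :=
      antipode_clasp.symm.context 0
        (shift 2 antipodeInvWord ++ antipodeInvWord ++ pairCross ++ antipodeWord) [] 0
    _ ≈[4, 0] shift 2 antipodeInvWord ++ antipodeInvWord ++ shift 2 antipodeWord ++ pairCross ++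
        antipodeWord ++ claspWord :=
      pairCross_antipode.symm.context 0 (shift 2 antipodeInvWord ++ antipodeInvWord)
        (antipodeWord ++ claspWord) 0
    _ ≈[4, 0] shift 2 antipodeInvWord ++ shift 2 antipodeWord ++ antipodeInvWord ++ pairCross ++
        antipodeWord ++ claspWord :=
      (interchange typed_antipodeInvWord typed_antipodeWord).context 0 (shift 2 antipodeInvWord)
        (pairCross ++ antipodeWord ++ claspWord) 0
    _ ≈[4, 0] antipodeInvWord ++ pairCross ++ antipodeWord ++ claspWord :=
      antipodeInv_antipode.context 2 [] (antipodeInvWord ++ pairCross ++ antipodeWord ++ claspWord)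
        0
    _ ≈[4, 0] antipodeInvWord ++ pairCross ++ shift 2 antipodeWord ++ claspWord :=
      antipode_clasp.context 0 (antipodeInvWord ++ pairCross) [] 0
    _ ≈[4, 0] antipodeInvWord ++ antipodeWord ++ pairCross ++ claspWord :=
      antipode_pairCross.symm.context 0 antipodeInvWord claspWord 0
    _ ≈[4, 0] pairCross ++ claspWord :=
      antipodeInv_antipode.context 0 [] (pairCross ++ claspWord) 2

theorem antipode_omega_left : antipodeWord ++ antipodeInvWord ++ claspWord ≈[4, 0] claspWord :=
  antipode_antipodeInv.context 0 [] claspWord 2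

theorem antipode_omega_right :
    shift 2 antipodeWord ++ antipodeInvWord ++ claspWord ≈[4, 0] claspWord :=
  calc shift 2 antipodeWord ++ antipodeInvWord ++ claspWord
    _ ≈[4, 0] antipodeInvWord ++ shift 2 antipodeWord ++ claspWord :=
      (interchange typed_antipodeInvWord typed_antipodeWord).symm.context 0 [] claspWord 0
    _ ≈[4, 0] antipodeInvWord ++ antipodeWord ++ claspWord :=
      antipode_clasp.symm.context 0 antipodeInvWord [] 0
    _ ≈[4, 0] claspWord := antipodeInv_antipode.context 0 [] claspWord 2

/-! ### The rule on morphisms of Hopf diagrams -/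

theorem phiWord_append (u v : List (ℕ × HopfGen)) :
    phiWord (u ++ v) = phiWord u ++ phiWord v := by
  simp [phiWord]

theorem phiWord_shift (k : ℕ) (w : List (ℕ × HopfGen)) :
    phiWord (shift k w) = shift (2 * k) (phiWord w) := by
  induction w with
  | nil => rfl
  | cons s w ih =>
    have h (s : ℕ × HopfGen) (w : List (ℕ × HopfGen)) :
        phiWord (s :: w) = shift (2 * s.1) (rule s.2) ++ phiWord w := rfl
    rw [shift_cons, h, h, ih, shift_append, shift_shift, Nat.mul_add]

theorem phiWord_gen (k : ℕ) (g : HopfGen) : phiWord [(k, g)] = shift (2 * k) (rule g) := by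
  simp [phiWord]

theorem phiWord_passLeft (n : ℕ) :
    phiWord (passLeft (.tau true) n) = braidWord (cross true) (2 * n) 2 := by
  induction n with
  | zero => rfl
  | succ n ih =>
    rw [passLeft_add, phiWord_append, ih, Nat.mul_add, braidWord_add_left, phiWord_shift]
    rfl

theorem phiWord_passRight (n : ℕ) :
    phiWord (passRight (.tau true) n) ≈[2 + 2 * n, 2 * n + 2] braidWord (cross true) 2 (2 * n) := by
  induction n with
  | zero => exact .refl (by decide)
  | succ n ih =>
    have e : phiWord (passRight (.tau true) (n + 1)) =
        phiWord (passRight (.tau true) n) ++ shift (2 * n) (braidWord (cross true) 2 2) := by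
      rw [passRight_succ, phiWord_append, phiWord_gen]; rfl
    have h1 := ih.right 2
    have h2 : tangle.Typed (2 * n + 2 + 2) (shift (2 * n) (braidWord (cross true) 2 2))
        (2 * n + 2 + 2) := typed_pairCross.left (2 * n)
    rw [e]
    exact ((h1.append (.refl h2)).cast (by ring) (by ring)).trans
      ((braidWord_add_right (P := tangle) 2 (2 * n) 2).symm.cast (by ring) (by ring))

/-- The number of outputs is determined by the word and the number of inputs. -/
theorem Presentation.Typed.unique {P : Presentation} {m n n' : ℕ} {w : P.Word}
    (h : P.Typed m w n) (h' : P.Typed m w n') : n = n' := by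
  induction w generalizing m with
  | nil => exact Eq.trans (Eq.symm h) h'
  | cons s w ih =>
    obtain ⟨q, e, h⟩ := h
    obtain ⟨q', e', h'⟩ := h'
    obtain rfl : q = q' := by omega
    exact ih h h'

theorem Presentation.Typed.unique_left {P : Presentation} {m m' n : ℕ} {w : P.Word}
    (h : P.Typed m w n) (h' : P.Typed m' w n) : m = m' := by
  induction w generalizing m m' with
  | nil => exact Eq.trans h (Eq.symm h')
  | cons s w ih =>
    obtain ⟨q, e, h⟩ := h
    obtain ⟨q', e', h'⟩ := h'
    have := ih h h'
    omega

instance decHopf (m n : ℕ) (w : List (ℕ × HopfGen)) : Decidable (hopf.Typed m w n) :=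
  decTyped (P := hopf) m w n

/-- Each defining relation of Hopf diagrams becomes an isotopy; moreover, a relation between
diagrams of type `a → b` is only applied to `a` neighbouring strands. Both sides are needed for
this, as a word alone may fit into fewer strands than the other side of the relation. -/
theorem phiWord_rel {l r : List (ℕ × HopfGen)} (h : HopfRel l r) {k m n : ℕ}
    (hl : hopf.Typed m (shift k l) n) (hr : hopf.Typed m (shift k r) n) :
    ∃ a b, k + a ≤ m ∧ hopf.Typed a l b ∧ phiWord l ≈[2 * a, 2 * b] phiWord r := by
  cases h with
  | tau_inv s =>
    refine ⟨2, 2, (typed_cons.1 hl).1, by clear hl hr; decide +revert, ?_⟩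
    obtain ⟨-, h1, h2⟩ := revNeg_inv (P := tangle) (typed_braidWord 2 2) mem_braidWord
    cases s with
    | true => exact h1
    | false => exact h2
  | natural_right g =>
    refine ⟨1 + g.src, g.tgt + 1, ?_, by clear hl hr; cases g <;> decide +revert, ?_⟩
    · have : k + 1 + g.src ≤ m := (typed_cons.1 hl).1
      omega
    · rw [phiWord_append, phiWord_append, phiWord_gen, phiWord_gen, shift_zero]
      have h0 := typed_rule g
      have h1 := Eqv.append (.refl (h0.left 2)) (phiWord_passRight g.tgt)
      have h2 := Eqv.append (phiWord_passRight g.src) (.refl (h0.right 2))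
      exact ((h1.trans (braid_natural_right (P := tangle) 2 h0)).trans h2.symm).cast
        (by ring) (by ring)
  | natural_left g =>
    refine ⟨g.src + 1, 1 + g.tgt, ?_, by clear hl hr; cases g <;> decide +revert, ?_⟩
    · cases g <;> exact (typed_cons.1 hr).1
    · rw [phiWord_append, phiWord_append, phiWord_gen, phiWord_gen, shift_zero, phiWord_passLeft,
        phiWord_passLeft]
      exact (braid_natural_left (P := tangle) 2 (typed_rule g)).cast (by ring) (by ring)
  | coassoc => exact ⟨1, 3, (typed_cons.1 hl).1, by decide, tangle_coassoc⟩
  | counit_right => exact ⟨1, 1, (typed_cons.1 hl).1, by decide, tangle_comul_counit⟩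
  | counit_left => exact ⟨1, 1, (typed_cons.1 hl).1, by decide, tangle_counit_comul⟩
  | antipode_inv => exact ⟨1, 1, (typed_cons.1 hl).1, by decide, antipodeInv_antipode⟩
  | inv_antipode => exact ⟨1, 1, (typed_cons.1 hl).1, by decide, antipode_antipodeInv⟩
  | antipode_comul => exact ⟨1, 2, (typed_cons.1 hl).1, by decide, antipode_comul⟩
  | antipode_counit => exact ⟨1, 0, (typed_cons.1 hl).1, by decide, antipode_cap⟩
  | antipode_theta s =>
    refine ⟨1, 0, (typed_cons.1 hl).1, by clear hl hr; decide +revert, ?_⟩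
    have := antipode_theta s
    simpa [phiWord, shift_zero, rule] using this
  | antipode_omega_left =>
    exact ⟨2, 0, (typed_cons.1 hr).1, by decide, antipode_omega_left⟩
  | antipode_omega_right =>
    exact ⟨2, 0, (typed_cons.1 hl).1, by decide, antipode_omega_right⟩
  | inv_omega_left => exact ⟨2, 0, (typed_cons.1 hr).1, by decide, antipodeInv_clasp_left⟩
  | inv_omega_right => exact ⟨2, 0, (typed_cons.1 hr).1, by decide, antipodeInv_clasp_right⟩

theorem phiWord_move {l r : hopf.Word} (h : hopf.Move l r) {k m n : ℕ}
    (hl : hopf.Typed m (shift k l) n) (hr : hopf.Typed m (shift k r) n) :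
    phiWord (shift k l) ≈[2 * m, 2 * n] phiWord (shift k r) := by
  obtain ⟨a, b, hm, hab, e⟩ : ∃ a b, k + a ≤ m ∧ hopf.Typed a l b ∧
      phiWord l ≈[2 * a, 2 * b] phiWord r := by
    cases h with
    | rel h => exact phiWord_rel h hl hr
    | exchange g h d =>
      refine ⟨g.src + d + h.src, g.tgt + d + h.tgt, ?_, ⟨d + h.src, by simp [hopf]; omega, 0, by
        simp [hopf]; omega, rfl⟩, ?_⟩
      · have : k + (g.src + d) + h.src ≤ m := (typed_cons.1 hr).1
        omega
      · have this : Isotopic _ _ (rule g ++ shift (2 * g.tgt + 2 * d) (rule h))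
            (shift (2 * g.src + 2 * d) (rule h) ++ rule g) :=
          interchange ((typed_rule g).right (2 * d)) (typed_rule h)
        have e : phiWord [(0, g), (g.tgt + d, h)] =
            rule g ++ shift (2 * g.tgt + 2 * d) (rule h) := by
          simp [phiWord, Nat.mul_add]
        have e' : phiWord [(g.src + d, h), (0, g)] =
            shift (2 * g.src + 2 * d) (rule h) ++ rule g := by
          simp [phiWord, Nat.mul_add]
        rw [← e, ← e'] at this
        exact this.cast (by ring) (by ring)
  obtain ⟨q, rfl⟩ := Nat.exists_eq_add_of_le hm
  obtain rfl := ((hab.left k).right q).unique hl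
  rw [show phiWord (shift k l) = _ from phiWord_shift k l,
    show phiWord (shift k r) = _ from phiWord_shift k r]
  exact ((e.left (2 * k)).right (2 * q)).cast (by ring) (by ring)

theorem phiWord_step {m n : ℕ} {D D' : hopf.Diagram m n} (h : hopf.Step D D') :
    phiWord D.word ≈[2 * m, 2 * n] phiWord D'.word := by
  obtain ⟨k, u, v, l, r, h, e, e'⟩ := h
  have t := D.typed
  have t' := D'.typed
  rw [e, List.append_assoc] at t
  rw [e', List.append_assoc] at t'
  obtain ⟨a, hu, t⟩ := typed_append.1 t
  obtain ⟨b, hl, hv⟩ := typed_append.1 t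
  obtain ⟨a', hu', t'⟩ := typed_append.1 t'
  obtain ⟨b', hr, hv'⟩ := typed_append.1 t'
  obtain rfl := hu.unique hu'
  obtain rfl := hv.unique_left hv'
  have key (u w v : List (ℕ × HopfGen)) :
      phiWord (u ++ w ++ v) = phiWord u ++ phiWord w ++ phiWord v := by
    rw [phiWord_append, phiWord_append]
  rw [e, e', show phiWord (u ++ shift k l ++ v) = _ from key _ _ _,
    show phiWord (u ++ shift k r ++ v) = _ from key _ _ _]
  exact ((Eqv.refl (typed_phiWord hu)).append (phiWord_move h hl hr)).append
    (.refl (typed_phiWord hv))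

/-- The map sending the class of a Hopf diagram `D` to the isotopy class of `φ_D`. -/
def phiHom (m n : ℕ) : hopf.Hom m n → tangle.Hom (2 * m) (2 * n) :=
  Quot.lift (fun D => cls (phi D)) fun _ _ h => (phiWord_step h).2.2

/-! ### Components of the images of Hopf diagrams -/

/-- The arc of the layer `(k, g)` which starts at the position `p` below the layer: the position of
its other end, and whether this is above the layer. -/
def arcUp (k : ℕ) (g : TangleGen) (p : ℕ) : ℕ × Bool :=
  if p < k then (p, true)
  else if k + g.src ≤ p then (k + g.tgt + (p - (k + g.src)), true)
  else match g with
    | cup => (p, true)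
    | cap => (2 * k + 1 - p, false)
    | cross _ => (2 * k + 1 - p, true)

/-- The arc of the layer `(k, g)` which starts at the position `p` above the layer: the position of
its other end, and whether this is above the layer. -/
def arcDown (k : ℕ) (g : TangleGen) (p : ℕ) : ℕ × Bool :=
  if p < k then (p, false)
  else if k + g.tgt ≤ p then (k + g.src + (p - (k + g.tgt)), false)
  else match g with
    | cup => (2 * k + 1 - p, true)
    | cap => (p, false)
    | cross _ => (2 * k + 1 - p, false)

/-- The point reached from the point `(i, p)` by following its component through at most `f` layers,
upwards at first if `up = true` and downwards at first otherwise. -/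
def follow (w : List (ℕ × TangleGen)) : (f i p : ℕ) → (up : Bool) → ℕ × ℕ
  | 0, i, p, _ => (i, p)
  | f + 1, i, p, true =>
    match w[i]? with
    | none => (i, p)
    | some (k, g) =>
      follow w f (bif (arcUp k g p).2 then i + 1 else i) (arcUp k g p).1 (arcUp k g p).2
  | _ + 1, 0, p, false => (0, p)
  | f + 1, i + 1, p, false =>
    match w[i]? with
    | none => (i + 1, p)
    | some (k, g) =>
      follow w f (bif (arcDown k g p).2 then i + 1 else i) (arcDown k g p).1 (arcDown k g p).2

theorem joined_arcUp {w : List (ℕ × TangleGen)} {i k : ℕ} {g : TangleGen}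
    (h : w[i]? = some (k, g)) (p : ℕ) :
    Joined w (i, p) (bif (arcUp k g p).2 then i + 1 else i, (arcUp k g p).1) := by
  unfold arcUp
  have e1 : 2 * k + 1 - k = k + 1 := by omega
  have e2 : 2 * k + 1 - (k + 1) = k := by omega
  split_ifs with h1 h2
  · exact .of_link h (.left g h1)
  · obtain ⟨q, rfl⟩ := Nat.exists_eq_add_of_le h2
    simpa using Joined.of_link h (.right g q)
  · cases g with
    | cup => simp [TangleGen.src] at h2; omega
    | cap =>
      obtain rfl | rfl : p = k ∨ p = k + 1 := by simp [TangleGen.src] at h2; omega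
      · simpa [e1, e2] using Joined.of_link h .cap
      · simpa [e1, e2] using (Joined.of_link h .cap).symm
    | cross s =>
      obtain rfl | rfl : p = k ∨ p = k + 1 := by simp [TangleGen.src] at h2; omega
      · simpa [e1, e2] using Joined.of_link h (.crossRight s)
      · simpa [e1, e2] using Joined.of_link h (.crossLeft s)

theorem joined_arcDown {w : List (ℕ × TangleGen)} {i k : ℕ} {g : TangleGen}
    (h : w[i]? = some (k, g)) (p : ℕ) :
    Joined w (i + 1, p) (bif (arcDown k g p).2 then i + 1 else i, (arcDown k g p).1) := by
  unfold arcDown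
  have e1 : 2 * k + 1 - k = k + 1 := by omega
  have e2 : 2 * k + 1 - (k + 1) = k := by omega
  split_ifs with h1 h2
  · exact .symm (.of_link h (.left g h1))
  · obtain ⟨q, rfl⟩ := Nat.exists_eq_add_of_le h2
    simpa using (Joined.of_link h (.right g q)).symm
  · cases g with
    | cap => simp [TangleGen.tgt] at h2; omega
    | cup =>
      obtain rfl | rfl : p = k ∨ p = k + 1 := by simp [TangleGen.tgt] at h2; omega
      · simpa [e1, e2] using Joined.of_link h .cup
      · simpa [e1, e2] using (Joined.of_link h .cup).symm
    | cross s =>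
      obtain rfl | rfl : p = k ∨ p = k + 1 := by simp [TangleGen.tgt] at h2; omega
      · simpa [e1, e2] using (Joined.of_link h (.crossLeft s)).symm
      · simpa [e1, e2] using (Joined.of_link h (.crossRight s)).symm

theorem joined_follow (w : List (ℕ × TangleGen)) (f i p : ℕ) (up : Bool) :
    Joined w (i, p) (follow w f i p up) := by
  induction f generalizing i p up with
  | zero => exact .refl _
  | succ f ih =>
    cases up with
    | true =>
      rw [follow]
      split
      · exact .refl _
      · next k g h => exact (joined_arcUp h p).trans (ih _ _ _)
    | false =>
      cases i with
      | zero => exact .refl _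
      | succ i =>
        rw [follow]
        split
        · exact .refl _
        · next k g h => exact (joined_arcDown h p).trans (ih _ _ _)

theorem typed_tgt_le {m n : ℕ} {w : List (ℕ × TangleGen)} (h : tangle.Typed m w n) :
    n ≤ m + 2 * w.length := by
  induction w generalizing m with
  | nil => exact le_of_eq (Eq.symm h)
  | cons s w ih =>
    obtain ⟨k, g⟩ := s
    obtain ⟨r, rfl, h⟩ := h
    have h1 := ih h
    have h2 : tangle.tgt g ≤ 2 := by cases g <;> simp [tangle, TangleGen.tgt]
    rw [List.length_cons]
    omega

/-- A criterion for handles that can be evaluated: follow the components from finitely many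
points. The points further to the right lie on vertical strands beside the diagram. -/
theorem isHandle_of_follow {n : ℕ} {w : List (ℕ × TangleGen)} (f : ℕ) (t : tangle.Typed (2 * n) w 0)
    (h : ∀ k < n, follow w f 0 (2 * k) true = (0, 2 * k + 1))
    (h' : ∀ i < w.length + 1, ∀ p < 2 * n + 2 * w.length, (follow w f i p false).1 = 0) :
    IsHandle n w := by
  refine ⟨fun k hk => h k hk ▸ joined_follow w f 0 (2 * k) true, fun i hi p => ?_⟩
  by_cases hp : p < 2 * n + 2 * w.length
  · have e := joined_follow w f i p false
    rw [show follow w f i p false = (0, (follow w f i p false).2) from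
      Prod.ext (h' i (by omega) p hp) rfl] at e
    exact ⟨_, e⟩
  · rw [← List.take_append_drop i w] at t
    obtain ⟨a, t, -⟩ := typed_append.1 t
    have ha := typed_tgt_le t
    have hl : (w.take i).length = i := by simpa using hi
    obtain ⟨q, rfl⟩ : ∃ q, p = a + q := Nat.exists_eq_add_of_le (by omega)
    have e := ((Joined.through t q).append_left (w.drop i)).symm
    rw [List.take_append_drop, hl] at e
    exact ⟨_, e⟩

/-- If the pairs of top strands of the image of a generator are closed by caps, the result is a
handle. -/
theorem isHandle_rule (g : HopfGen) :
    IsHandle g.src (rule g ++ List.replicate g.tgt (0, cap)) := by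
  cases g with
  | omega s => cases s <;> exact isHandle_of_follow 40 (by decide) (by decide) (by decide)
  | theta s => cases s <;> exact isHandle_of_follow 40 (by decide) (by decide) (by decide)
  | tau s => cases s <;> exact isHandle_of_follow 40 (by decide) (by decide) (by decide)
  | _ => exact isHandle_of_follow 40 (by decide) (by decide) (by decide)

/-- Handles may be capped off piecewise: a diagram `u` which becomes a handle when its pairs of top
strands are closed by caps stays one when it is closed by another handle `v` instead. -/
theorem IsHandle.comp {a b k r : ℕ} {u v : List (ℕ × TangleGen)}
    (t : tangle.Typed (2 * a) u (2 * b)) (hu : IsHandle a (u ++ List.replicate b (0, cap)))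
    (hv : IsHandle (k + b + r) v) : IsHandle (k + a + r) (shift (2 * k) u ++ v) := by
  have hl : (shift (2 * k) u).length = u.length := by simp [shift]
  -- the pairs of strands above `u` are joined by `v`
  have top : ∀ j < k + b + r, Joined (shift (2 * k) u ++ v) (u.length, 2 * j)
      (u.length, 2 * j + 1) := fun j hj => by
    have := (hv.1 j hj).append_right (shift (2 * k) u)
    rwa [hl] at this
  have left : ∀ p < 2 * k, ∀ i ≤ u.length, Joined (shift (2 * k) u ++ v) (0, p) (i, p) :=
    fun p hp i hi => (Joined.shift_left hp hi).append_left v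
  have right : ∀ q, Joined (shift (2 * k) u ++ v) (0, 2 * k + (2 * a + q))
      (u.length, 2 * k + (2 * b + q)) := fun q =>
    ((Joined.through t q).shift_right (2 * k)).append_left v
  -- the caps are collapsed to the level above `u`
  have core : ∀ {x y : ℕ × ℕ}, Joined (u ++ List.replicate b (0, cap)) x y →
      Joined (shift (2 * k) u ++ v) (min x.1 u.length, 2 * k + (x.2 + 2 * (x.1 - u.length)))
        (min y.1 u.length, 2 * k + (y.2 + 2 * (y.1 - u.length))) := by
    intro x y h
    refine Joined.map (v := u ++ List.replicate b (0, cap))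
      (fun x => (min x.1 u.length, 2 * k + (x.2 + 2 * (x.1 - u.length))))
      (fun i l g x y h1 h2 => ?_) h
    by_cases hi : i < u.length
    · rw [List.getElem?_append_left hi] at h1
      have h3 : x.1 ≤ u.length ∧ y.1 ≤ u.length := by cases h2 <;> simp <;> omega
      have h4 : Joined u (x.1, x.2) (y.1, y.2) := .of_link h1 h2
      have := (h4.shift_right (2 * k)).append_left v
      simpa [Nat.sub_eq_zero_of_le h3.1, Nat.sub_eq_zero_of_le h3.2, h3.1, h3.2] using this
    · obtain ⟨j, rfl⟩ := Nat.exists_eq_add_of_le (Nat.le_of_not_lt hi)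
      rw [List.getElem?_append_right (by omega), List.getElem?_replicate] at h1
      split_ifs at h1 with hj
      obtain ⟨rfl, rfl⟩ : 0 = l ∧ cap = g := by simpa using h1
      cases h2 with
      | left _ hp => omega
      | right _ p =>
        simp only [TangleGen.src, TangleGen.tgt]
        convert Joined.refl _ using 2
        · omega
        · omega
      | cap =>
        convert top (k + j) (by omega) using 2 <;> simp <;> omega
  have bottom : ∀ i ≤ u.length, ∀ p, ∃ q, Joined (shift (2 * k) u ++ v) (i, p) (0, q) := by
    intro i hi p
    by_cases hp : p < 2 * k
    · exact ⟨p, (left p hp i hi).symm⟩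
    · obtain ⟨p, rfl⟩ := Nat.exists_eq_add_of_le (Nat.le_of_not_lt hp)
      obtain ⟨q, hq⟩ := hu.2 i (by simp; omega) p
      have := core hq
      simp only [Nat.min_eq_left hi, Nat.sub_eq_zero_of_le hi, Nat.zero_sub, Nat.zero_min] at this
      exact ⟨_, this⟩
  refine ⟨fun j hj => ?_, fun i hi p => ?_⟩
  · by_cases h1 : j < k
    · exact ((left _ (by omega) _ le_rfl).trans (top j (by omega))).trans
        (left _ (by omega) _ le_rfl).symm
    by_cases h2 : j < k + a
    · obtain ⟨j, rfl⟩ := Nat.exists_eq_add_of_le (Nat.le_of_not_lt h1)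
      have := core (hu.1 j (by omega))
      simpa [Nat.mul_add, Nat.add_assoc] using this
    · obtain ⟨j, rfl⟩ := Nat.exists_eq_add_of_le (Nat.le_of_not_lt h2)
      have h3 := (right (2 * j)).trans (.trans (by
        have := top (k + b + j) (by omega)
        simpa [Nat.mul_add, Nat.add_assoc] using this) (right (2 * j + 1)).symm)
      simpa [Nat.mul_add, Nat.add_assoc] using h3
  · by_cases h : i ≤ u.length
    · exact bottom i h p
    · obtain ⟨i, rfl⟩ := Nat.exists_eq_add_of_le (Nat.le_of_not_le h)
      obtain ⟨q, hq⟩ := hv.2 i (by simp [hl] at hi; omega) p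
      have h1 := hq.append_right (shift (2 * k) u)
      rw [hl] at h1
      obtain ⟨q', hq'⟩ := bottom u.length le_rfl q
      exact ⟨q', h1.trans hq'⟩

theorem isHandle_phiWord {n : ℕ} {w : hopf.Word} (t : hopf.Typed n w 0) :
    IsHandle n (phiWord w) := by
  induction w generalizing n with
  | nil =>
    obtain rfl : n = 0 := t
    exact ⟨fun k hk => absurd hk (Nat.not_lt_zero k), rooted_nil⟩
  | cons s w ih =>
    obtain ⟨k, g⟩ := s
    obtain ⟨r, rfl, t⟩ := t
    exact (isHandle_rule g).comp (typed_rule g) (ih t)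

/-! ### The string link of a handle -/

theorem openWord_ne_cap (n : ℕ) : ∀ s ∈ openWord n, s.2 ≠ .cap := by
  have hb : ∀ m : ℕ, ∀ s ∈ braidWord (TangleGen.cross true) m 1, s.2 = .cross true :=
    fun m => mem_braidWord (P := tangle)
  induction n with
  | zero => simp [openWord]
  | succ n ih =>
    intro s hs
    simp only [openWord, shift, List.mem_append, List.mem_map, List.mem_singleton] at hs
    rcases hs with (hs | rfl) | ⟨t, ht, rfl⟩
    · exact ih s hs
    · simp
    · simp [hb _ t ht]

theorem joined_openWord (n : ℕ) : ∀ k < n,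
    Joined (openWord n) (0, k) ((openWord n).length, n + (2 * k + 1)) ∧
    Joined (openWord n) ((openWord n).length, k) ((openWord n).length, n + 2 * k) := by
  induction n with
  | zero => simp
  | succ n ih =>
    set A := openWord n with hA
    set B := shift n (braidWord (TangleGen.cross true) (2 * n) 1) with hB
    have hlen : (openWord (n + 1)).length = A.length + 1 + B.length := by
      simp [openWord, hA, hB, Nat.add_assoc, Nat.add_comm 1]
    have hw : openWord (n + 1) = (A ++ [(3 * n, .cup)]) ++ B := rfl
    have hA1 : ∀ {a b}, Joined A a b → Joined (openWord (n + 1)) a b := fun h => by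
      rw [hw]; exact (h.append_left _).append_left _
    have hB1 : ∀ {p q}, Joined B (0, p) (B.length, q) →
        Joined (openWord (n + 1)) (A.length + 1, p) ((openWord (n + 1)).length, q) := fun h => by
      have := h.append_right (A ++ [(3 * n, .cup)])
      rw [hlen, hw]
      simpa using this
    have hcup : (openWord (n + 1))[A.length]? = some (3 * n, .cup) := by
      rw [hw]; simp
    have bl : B.length = (braidWord (TangleGen.cross true) (2 * n) 1).length := by
      simp [hB, shift]
    obtain ⟨b1, b2⟩ := joined_braidWord (2 * n) 1
    -- the strands `t_j`, then those of the first `n` pairs, then the two branches of the cup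
    have s0 : ∀ p < n, Joined B (0, p) (B.length, p) := fun p hp => by
      rw [bl]; exact .shift_left hp le_rfl
    have s1 : ∀ p < 2 * n, Joined B (0, n + p) (B.length, n + (p + 1)) := fun p hp => by
      rw [bl]; exact (b1 p hp).shift_right _
    have s2 : Joined B (0, n + (2 * n + 0)) (B.length, n + 0) := by
      rw [bl]; exact (b2 0 (by omega)).shift_right _
    have s3 : ∀ q, Joined B (0, n + (2 * n + 1 + q)) (B.length, n + (1 + 2 * n + q)) := fun q => by
      rw [bl]; exact (Joined.through (typed_braidWord (P := tangle) (2 * n) 1) q).shift_right _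
    have hleft : ∀ p < n + 2 * n, Joined (openWord (n + 1)) (A.length, p) (A.length + 1, p) :=
      fun p hp => .of_link hcup (.left _ (by omega))
    have hpair : ∀ p < 2 * n, Joined (openWord (n + 1)) (A.length, n + p)
        ((openWord (n + 1)).length, n + (p + 1)) := fun p hp =>
      (hleft _ (by omega)).trans (hB1 (s1 p hp))
    intro k hk
    by_cases h : k < n
    · obtain ⟨h1, h2⟩ := ih k h
      refine ⟨?_, ?_⟩
      · have := (hA1 h1).trans (hpair _ (by omega))
        convert this using 2; omega
      · have := ((hleft _ (by omega)).trans (hB1 (s0 k h))).symm.trans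
          ((hA1 h2).trans (hpair _ (by omega)))
        convert this using 2; omega
    · obtain rfl : k = n := by omega
      have c : Joined (openWord (k + 1)) (A.length + 1, 3 * k) (A.length + 1, 3 * k + 1) :=
        .of_link hcup .cup
      have d : Joined (openWord (k + 1)) (A.length, 3 * k + 0) (A.length + 1, 3 * k + 2 + 0) :=
        .of_link hcup (.right _ 0)
      have e := hA1 (Joined.through (typed_openWord k) 0)
      have f0 := hB1 s2
      have f1 := hB1 (s3 0)
      have f2 := hB1 (s3 1)
      simp only [Nat.add_zero] at d e f0 f1
      rw [show k + 2 * k = 3 * k by omega] at e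
      rw [show k + 2 * k = 3 * k by omega] at f0
      rw [show k + (2 * k + 1) = 3 * k + 1 by omega] at f1
      rw [show k + (2 * k + 1 + 1) = 3 * k + 2 by omega] at f2
      refine ⟨?_, ?_⟩
      · convert (e.trans d).trans f2 using 2; omega
      · convert (f0.symm.trans c).trans f1 using 2; omega

theorem IsHandle.isStringLink {n : ℕ} {w : List (ℕ × TangleGen)} (h : IsHandle n w) :
    IsStringLink n (toStringLinkWord n w) := by
  set A := openWord n with hA
  have hw : toStringLinkWord n w = A ++ shift n w := rfl
  have hs : (shift n w).length = w.length := by simp [shift]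
  have c := joined_openWord n
  have hl : ∀ {a b}, Joined A a b → Joined (toStringLinkWord n w) a b := fun h => h.append_left _
  have pair : ∀ k < n, Joined (toStringLinkWord n w) (A.length, n + 2 * k)
      (A.length, n + (2 * k + 1)) := fun k hk =>
    ((h.1 k hk).shift_right n).append_right A
  have strand : ∀ k < n, Joined (toStringLinkWord n w) (0, k) (A.length, k) := fun k hk =>
    (hl (c k hk).1).trans ((pair k hk).symm.trans (hl (c k hk).2).symm)
  have top : ∀ p, ∃ q, Joined (toStringLinkWord n w) (A.length, p) (0, q) := by
    intro p
    by_cases h1 : p < n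
    · exact ⟨_, (strand p h1).symm⟩
    by_cases h2 : p < n + 2 * n
    · obtain ⟨r, rfl⟩ := Nat.exists_eq_add_of_le (Nat.le_of_not_lt h1)
      obtain ⟨k, rfl | rfl⟩ := Nat.even_or_odd' r
      · exact ⟨_, (pair k (by omega)).trans (hl (c k (by omega)).1).symm⟩
      · exact ⟨_, (hl (c k (by omega)).1).symm⟩
    · obtain ⟨r, rfl⟩ := Nat.exists_eq_add_of_le (Nat.le_of_not_lt h2)
      exact ⟨_, (hl (Joined.through (typed_openWord n) r)).symm⟩
  refine ⟨fun k hk => ?_, fun i hi p => ?_⟩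
  · have := (Joined.shift_left (w := w) hk le_rfl).append_right A
    rw [hw, List.length_append, hs]
    exact (strand k hk).trans this
  · by_cases h' : i ≤ A.length
    · obtain ⟨q, hq⟩ := joined_top (openWord_ne_cap n) h' p
      obtain ⟨r, hr⟩ := top q
      exact ⟨r, (hl hq).trans hr⟩
    · obtain ⟨j, rfl⟩ := Nat.exists_eq_add_of_le (Nat.le_of_not_le h')
      rw [hw, List.length_append] at hi
      obtain ⟨q, hq⟩ := (h.2.shift n) j (by omega) p
      obtain ⟨r, hr⟩ := top q
      exact ⟨r, (hq.append_right A).trans hr⟩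

/-! ### String links of products of handles -/

local notation "br" => braidWord (cross true)

theorem typed_br (m n : ℕ) : IsTangle (m + n) (br m n) (n + m) :=
  typed_braidWord (P := tangle) m n

theorem typed_cu (k r : ℕ) : IsTangle (k + r) [cu k] (k + 2 + r) :=
  typed_gen (P := tangle) k cup r

/-- A cup on the left of a strand which then passes behind `b` strands on its left. -/
theorem cup_passLeft (b : ℕ) : shift b [cu 0] ++ br b 3 ≈[b + 1, 3 + b] br b 1 ++ [cu 0] :=
  braid_natural_right (P := tangle) b (w := [cu 0]) (a := 1) (b := 3) (by decide)

/-- A strand on the right of `b` strands turns into three strands by a cup inserted on its left, the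
left branch of which is brought to the left, behind the `b` strands. -/
def splitWord (b : ℕ) : List (ℕ × TangleGen) := [cu b] ++ br b 1

theorem isTangle_splitWord (b : ℕ) : IsTangle (b + 1) (splitWord b) (1 + b + 2) :=
  Typed.append (P := tangle) (typed_cu b 1)
    (((typed_br b 1).right (P := tangle) 2).cast (Nat.add_right_comm b 1 2) rfl)

/-- Splitting a strand to the right of `a + b` strands twice, and bringing the new branches to the
left. -/
theorem cup_cup_passLeft (a b : ℕ) :
    [cu (a + b)] ++ shift a (br b 1) ++ shift a [cu 0] ++ br a 1 ≈[a + b + 1, 1 + a + 2 + b + 2]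
      [cu (a + b)] ++ br (a + b) 1 ++ [cu (a + b + 2)] ++ shift (a + 1) (br b 2) := by
  have t1 : IsTangle (a + b + 1) [cu (a + b)] (a + b + 3) := typed_cu (a + b) 1
  have t2 : IsTangle (a + b + 5) (shift a (br b 3)) (a + 1 + b + 4) :=
    (((typed_br b 3).left a).right 2).cast (by omega) (by omega)
  have t3 : IsTangle (a + 1 + b + 4) (br a 1) (1 + a + 2 + b + 2) :=
    ((typed_br a 1).right (b + 4)).cast (by omega) (by omega)
  have t4 : IsTangle (a + b + 5) (shift a (br b 1)) (a + 1 + b + 4) :=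
    (((typed_br b 1).left a).right 4).cast (by omega) (by omega)
  have t5 : IsTangle (a + 1 + b + 4) (shift (a + 1) (br b 2)) (a + 1 + b + 4) :=
    (((typed_br b 2).left (a + 1)).right 2).cast (by omega) (by omega)
  have e1 : shift a (br b 1 ++ [cu 0]) ≈[a + b + 3, a + 1 + b + 4]
      shift a (shift b [cu 0] ++ br b 3) :=
    (((cup_passLeft b).symm.left a).right 2).cast (by omega) (by omega)
  have e2 : [cu (a + b), cu (a + b + 2)] ≈[a + b + 1, a + b + 5] [cu (a + b), cu (a + b)] :=
    ((cup_cup.left (a + b)).right 1).cast (by omega) (by omega)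
  have e3 : br (a + b) 1 ++ [cu (1 + (a + b) + 1)] ≈[a + b + 3, a + 1 + b + 4]
      [cu (a + b + 1 + 1)] ++ br (a + b) 1 :=
    ((exchange_right ((typed_br (a + b) 1).right 1) cup).right 1).cast
      (by simp [tangle, TangleGen.src]) (by simp [tangle, TangleGen.tgt]; omega)
  have e4 : br a 1 ++ shift (1 + a) (br b 2) ≈[a + 1 + b + 4, 1 + a + 2 + b + 2]
      shift (a + 1) (br b 2) ++ br a 1 :=
    ((interchange (typed_br a 1) (typed_br b 2)).right 2).cast (by omega) (by omega)
  have e5 : shift a (br b 3) ≈[a + b + 5, a + 1 + b + 4] shift a (br b 1 ++ shift 1 (br b 2)) :=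
    (((braidWord_add_right (P := tangle) b 1 2).left a).right 2).cast (by omega) (by omega)
  have s1 : [cu (a + b)] ++ (shift a (br b 1) ++ shift a [cu 0]) ++ br a 1
      ≈[a + b + 1, 1 + a + 2 + b + 2] [cu (a + b), cu (a + b)] ++ shift a (br b 3) ++ br a 1 := by
    have := ((Isotopic.refl t1).append e1).append (.refl t3)
    simpa using this
  have s2 : [cu (a + b), cu (a + b)] ++ shift a (br b 3) ++ br a 1 ≈[a + b + 1, 1 + a + 2 + b + 2]
      [cu (a + b), cu (a + b + 2)] ++ (shift a (br b 1) ++ shift (a + 1) (br b 2)) ++ br a 1 := by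
    have := (e2.symm.append e5).append (.refl t3)
    simpa using this
  have s3 : [cu (a + b), cu (a + b + 2)] ++ shift a (br b 1) ++
        (shift (a + 1) (br b 2) ++ br a 1) ≈[a + b + 1, 1 + a + 2 + b + 2]
      [cu (a + b), cu (a + b + 2)] ++ shift a (br b 1) ++
        (br a 1 ++ shift (a + 1) (br b 2)) := by
    have := ((Isotopic.refl e2.1).append (Isotopic.refl t4)).append e4.symm
    simpa [Nat.add_comm 1 a] using this
  have s4 : [cu (a + b), cu (a + b + 2)] ++ br (a + b) 1 ++ shift (a + 1) (br b 2)
      ≈[a + b + 1, 1 + a + 2 + b + 2]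
      [cu (a + b)] ++ br (a + b) 1 ++ [cu (a + b + 2)] ++ shift (a + 1) (br b 2) := by
    have t5' : IsTangle (a + 1 + b + 4) (shift (a + 1) (br b 2)) (1 + a + 2 + b + 2) :=
      t5.cast rfl (by omega)
    have := ((Isotopic.refl t1).append e3.symm).append (.refl t5')
    simpa [show 1 + (a + b) + 1 = a + b + 2 by omega] using this
  have h := braidWord_add_left (cross true) a b 1
  rw [h] at s4 ⊢
  simp only [List.append_assoc] at s1 s2 s3 s4 ⊢
  exact ((s1.trans s2).trans s3).trans s4

theorem IsTangle.left {m n : ℕ} {w : List (ℕ × TangleGen)} (h : IsTangle m w n) (k : ℕ)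
    {m' n' : ℕ} (hm : k + m = m' := by omega) (hn : k + n = n' := by omega) :
    IsTangle m' (shift k w) n' :=
  (Typed.left (P := tangle) h k).cast hm hn

theorem IsTangle.right {m n : ℕ} {w : List (ℕ × TangleGen)} (h : IsTangle m w n) (k : ℕ)
    {m' n' : ℕ} (hm : m + k = m' := by omega) (hn : n + k = n' := by omega) :
    IsTangle m' w n' :=
  (Typed.right (P := tangle) h k).cast hm hn

theorem Isotopic.left {m n : ℕ} {w w' : List (ℕ × TangleGen)} (h : Isotopic m n w w') (k : ℕ)
    {m' n' : ℕ} (hm : k + m = m' := by omega) (hn : k + n = n' := by omega) :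
    Isotopic m' n' (shift k w) (shift k w') :=
  (Eqv.left h k).cast hm hn

theorem Isotopic.right {m n : ℕ} {w w' : List (ℕ × TangleGen)} (h : Isotopic m n w w') (k : ℕ)
    {m' n' : ℕ} (hm : m + k = m' := by omega) (hn : n + k = n' := by omega) :
    Isotopic m' n' w w' :=
  (Eqv.right h k).cast hm hn

theorem isotopic_interchange {a b c d : ℕ} {u v : List (ℕ × TangleGen)} (hu : IsTangle a u b)
    (hv : IsTangle c v d) : u ++ shift b v ≈[a + c, b + d] shift a v ++ u :=
  Eqv.interchange hu hv

theorem isTangle_openWord (n : ℕ) : IsTangle n (openWord n) (n + 2 * n) := typed_openWord n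

theorem openWord_succ (n : ℕ) :
    openWord (n + 1) = openWord n ++ shift n (splitWord (2 * n)) := by
  simp [openWord, splitWord, show 3 * n = n + 2 * n by omega]

/-- Opening neighbouring families of strands one after the other. -/
theorem openWord_add (m k : ℕ) :
    openWord (m + k) ≈[m + k, m + k + 2 * (m + k)]
      openWord m ++ shift (m + 2 * m) (openWord k) ++ shift m (br (2 * m) k) := by
  induction k with
  | zero =>
    have := Isotopic.refl (isTangle_openWord m)
    simpa [openWord, braidWord_zero] using this
  | succ k ih =>
    have e1 : br (2 * m) k ++ shift (k + 2 * m) (splitWord (2 * k))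
        ≈[2 * m + k + (2 * k + 1), k + 2 * m + (1 + 2 * k + 2)]
        shift (2 * m + k) (splitWord (2 * k)) ++ br (2 * m) k :=
      isotopic_interchange (typed_br (2 * m) k) (isTangle_splitWord (2 * k))
    have e2 : br (2 * m) (k + 1) ≈[2 * m + (k + 1), k + 1 + 2 * m]
        br (2 * m) k ++ shift k (br (2 * m) 1) := braidWord_succ_right (P := tangle) (2 * m) k
    have ta : IsTangle (m + (k + 1)) (openWord m ++ shift (m + 2 * m) (openWord k))
        (m + 2 * m + (k + 2 * k) + 1) :=
      Typed.append (P := tangle) ((isTangle_openWord m).right (k + 1) (n' := m + 2 * m + k + 1))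
        (((isTangle_openWord k).left (m + 2 * m) rfl rfl).right 1)
    have tb : IsTangle (m + (k + 2 * m + (1 + 2 * k + 2))) (shift (m + k) (br (2 * m) 1))
        (m + (k + 1) + 2 * (m + (k + 1))) :=
      ((typed_br (2 * m) 1).left (m + k) rfl rfl).right (2 * k + 2)
    have tc : IsTangle (m + k + 2 * (m + k) + 1) (shift (m + k) (splitWord (2 * (m + k))))
        (m + k + 1 + 2 * (m + k + 1)) :=
      (isTangle_splitWord (2 * (m + k))).left (m + k)
    have s1 : openWord (m + (k + 1)) ≈[m + (k + 1), m + (k + 1) + 2 * (m + (k + 1))]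
        openWord m ++ shift (m + 2 * m) (openWord k) ++ shift m (br (2 * m) k) ++
          shift (m + k) (splitWord (2 * (m + k))) := by
      have := (ih.right 1 (m' := m + k + 1) rfl).append (.refl tc)
      rw [← Nat.add_assoc m k 1, openWord_succ]
      simpa using this
    have s2 := ((Isotopic.refl ta).append (e1.left m (m' := m + 2 * m + (k + 2 * k) + 1)
      (n' := m + (k + 2 * m + (1 + 2 * k + 2))))).append (.refl tb)
    have s3 : openWord m ++ shift (m + 2 * m) (openWord (k + 1)) ++ shift m (br (2 * m) (k + 1))
        ≈[m + (k + 1), m + (k + 1) + 2 * (m + (k + 1))]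
        openWord m ++ shift (m + 2 * m) (openWord (k + 1)) ++
          shift m (br (2 * m) k ++ shift k (br (2 * m) 1)) :=
      ((Isotopic.refl ((isTangle_openWord m).right (k + 1)
          (n' := m + 2 * m + (k + 1)))).append
        (.refl ((isTangle_openWord (k + 1)).left (m + 2 * m) rfl
          (n' := m + (2 * m + (k + 1)) + 2 * (k + 1))))).append
        ((e2.left m rfl rfl).right (2 * (k + 1)))
    refine (s1.trans ?_).trans s3.symm
    have p1 : m + k + 2 * (m + k) = m + (k + (2 * m + 2 * k)) := by omega
    have p2 : m + (2 * m + k) + 2 * k = m + (2 * m + (k + 2 * k)) := by omega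
    have p3 : m + (k + 2 * m) + 2 * k = m + (k + (2 * m + 2 * k)) := by omega
    simpa [openWord_succ, splitWord, Nat.mul_add 2 m k, braidWord_add_left, p1, p2, p3,
      Nat.add_assoc] using s2

/-- A diagram slides in front of the branch of a strand which is split on its right. -/
theorem splitWord_natural {a b : ℕ} {w : List (ℕ × TangleGen)} (h : IsTangle a w b) :
    splitWord a ++ shift 1 w ≈[a + 1, 1 + b + 2] w ++ splitWord b := by
  have e1 : w ++ br b 1 ≈[a + 1, 1 + b] br a 1 ++ shift 1 w := braid_natural_left (P := tangle) 1 h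
  have e2 : w ++ [cu b] ≈[a, b + 2] [cu a] ++ w := exchange_right h cup
  have s1 := (Isotopic.refl (typed_cu a 1)).append
    (e1.symm.right 2 (m' := a + 2 + 1) (n' := 1 + b + 2))
  have s2 := (e2.symm.right 1 (m' := a + 1) (n' := b + 2 + 1)).append
    (.refl ((typed_br b 1).right 2 (m' := b + 2 + 1) (n' := 1 + b + 2)))
  have s3 : [cu a] ++ w ++ br b 1 ≈[a + 1, 1 + b + 2] w ++ splitWord b := by
    simpa [splitWord] using s2
  refine .trans ?_ s3
  simpa [splitWord] using s1

theorem splitWord_splitWord (a b : ℕ) :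
    shift a (splitWord b) ++ splitWord a ≈[a + b + 1, 1 + a + 2 + b + 2]
      splitWord (a + b) ++ [cu (a + b + 2)] ++ shift (a + 1) (br b 2) := by
  simpa [splitWord] using cup_cup_passLeft a b

theorem isTangle_comulWord (n : ℕ) : IsTangle (2 * n) (comulWord n) (2 * n + 2 * n) :=
  typed_comulWord n

/-- The strands `1, …, n` form a right comodule over the coalgebra of `n` pairs of strands:
coassociativity. -/
theorem openWord_coassoc (n : ℕ) :
    openWord n ++ openWord n ≈[n, n + 2 * n + 2 * n] openWord n ++ shift n (comulWord n) := by
  induction n with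
  | zero => exact .refl rfl
  | succ n ih =>
    set O := openWord n
    set C := comulWord n
    have ta : IsTangle (n + 1) O (n + 2 * n + 1) := (isTangle_openWord n).right 1
    have ta' : IsTangle (n + 2 * n + 1) O (n + (2 * n + 2 * n + 1)) :=
      (isTangle_openWord n).right (2 * n + 1)
    have tv : IsTangle (n + 2 * n + (1 + 2 * n + 2)) (shift n (splitWord (2 * n)))
        (n + 1 + 2 * (n + 1) + 2 * (n + 1)) :=
      ((isTangle_splitWord (2 * n)).left n rfl rfl).right (2 * n + 2)
    have tz : IsTangle (1 + (2 * n + 2 * n) + 2)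
        ([cu (2 * n + 2 * n + 2)] ++ shift (2 * n + 1) (br (2 * n) 2))
        (1 + 2 * n + 2 + 2 * n + 2) :=
      Typed.append (P := tangle) (a := 2 * n + 2 * n + 2 + 2 + 1)
        ((typed_cu (2 * n + 2 * n + 2) 1).cast (by omega) rfl)
        (((typed_br (2 * n) 2).left (2 * n + 1) rfl rfl).right 2)
    have e1 : O ++ shift (n + 2 * n) (splitWord (2 * n))
        ≈[n + (2 * n + 1), n + 2 * n + (1 + 2 * n + 2)]
        shift n (splitWord (2 * n)) ++ O :=
      isotopic_interchange (isTangle_openWord n) (isTangle_splitWord (2 * n))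
    have e2 := splitWord_natural (isTangle_comulWord n)
    have s1 : O ++ shift n (splitWord (2 * n)) ++ (O ++ shift n (splitWord (2 * n)))
        ≈[n + 1, n + 1 + 2 * (n + 1) + 2 * (n + 1)]
        O ++ O ++ shift n (shift (2 * n) (splitWord (2 * n)) ++ splitWord (2 * n)) := by
      have := ((Isotopic.refl ta).append e1.symm).append (.refl tv)
      simpa using this
    have s2 : O ++ O ++ shift n (shift (2 * n) (splitWord (2 * n)) ++ splitWord (2 * n))
        ≈[n + 1, n + 1 + 2 * (n + 1) + 2 * (n + 1)]
        O ++ O ++ shift n (splitWord (2 * n + 2 * n) ++ [cu (2 * n + 2 * n + 2)] ++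
          shift (2 * n + 1) (br (2 * n) 2)) :=
      ((Isotopic.refl ta).append (.refl ta')).append
        ((splitWord_splitWord (2 * n) (2 * n)).left n)
    have s3 : O ++ O ++ shift n (splitWord (2 * n + 2 * n) ++ [cu (2 * n + 2 * n + 2)] ++
          shift (2 * n + 1) (br (2 * n) 2)) ≈[n + 1, n + 1 + 2 * (n + 1) + 2 * (n + 1)]
        O ++ shift n C ++ shift n (splitWord (2 * n + 2 * n) ++ [cu (2 * n + 2 * n + 2)] ++
          shift (2 * n + 1) (br (2 * n) 2)) :=
      (ih.right 1 (m' := n + 1) (n' := n + (2 * n + 2 * n + 1))).append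
        (.refl ((splitWord_splitWord (2 * n) (2 * n)).2.1.left n (P := tangle) |>.cast rfl
          (by omega)))
    have s4 : O ++ shift n (C ++ splitWord (2 * n + 2 * n)) ++ shift n ([cu (2 * n + 2 * n + 2)] ++
          shift (2 * n + 1) (br (2 * n) 2)) ≈[n + 1, n + 1 + 2 * (n + 1) + 2 * (n + 1)]
        O ++ shift n (splitWord (2 * n) ++ shift 1 C) ++ shift n ([cu (2 * n + 2 * n + 2)] ++
          shift (2 * n + 1) (br (2 * n) 2)) :=
      ((Isotopic.refl ta).append (e2.symm.left n)).append (.refl (tz.left n rfl))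
    rw [openWord_succ]
    refine s1.trans (s2.trans (s3.trans ?_))
    have p1 : n + 1 + (4 * n + 1) = n + (2 * n + 2 * n + 2) := by omega
    have p2 : n + 1 + 2 * n = n + (2 * n + 1) := by omega
    simpa [comulWord, C, O, p1, p2] using s4

theorem isTangle_caps (n : ℕ) : IsTangle (2 * n) (List.replicate n (ca 0)) 0 := by
  induction n with
  | zero => rfl
  | succ n ih =>
    exact ⟨2 * n, by simp [tangle, TangleGen.src]; ring,
      ih.right 0 (by simp [tangle, TangleGen.tgt])⟩

/-- The string link of the trivial handle is trivial. -/
theorem toStringLinkWord_caps (n : ℕ) :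
    toStringLinkWord n (List.replicate n (ca 0)) ≈[n, n] [] := by
  induction n with
  | zero => exact .refl rfl
  | succ n ih =>
    have ta : IsTangle (n + 1) (openWord n) (n + (2 * n + 1)) := (isTangle_openWord n).right 1
    have tc : IsTangle (n + 3) [ca (n + 1)] (n + 1) :=
      ⟨0, rfl, rfl⟩
    have e := splitWord_natural (isTangle_caps n)
    have s1 : openWord n ++ shift n (splitWord (2 * n) ++ shift 1 (List.replicate n (ca 0))) ++
        [ca (n + 1)] ≈[n + 1, n + 1]
        openWord n ++ shift n (List.replicate n (ca 0) ++ splitWord 0) ++ [ca (n + 1)] :=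
      ((Isotopic.refl ta).append (e.left n)).append (.refl tc)
    have s2 : openWord n ++ shift n (List.replicate n (ca 0)) ++ shift n [cu 0, ca 1]
        ≈[n + 1, n + 1] [] :=
      (ih.right 1 rfl rfl).append (zigzag_left.left n rfl rfl)
    rw [toStringLinkWord, openWord_succ, List.replicate_succ']
    refine Isotopic.trans ?_ s2
    simpa [splitWord, braidWord] using s1

/-- Juxtaposition of handles becomes juxtaposition of string links. -/
theorem toStringLinkWord_append {m n : ℕ} {u v : List (ℕ × TangleGen)} (hu : IsTangle (2 * m) u 0)
    (hv : IsTangle (2 * n) v 0) :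
    toStringLinkWord (m + n) (u ++ v) ≈[m + n, m + n]
      toStringLinkWord m u ++ shift m (toStringLinkWord n v) := by
  have tu : IsTangle (m + n + 2 * (m + n)) (shift (m + n) u) (m + n + 2 * n) :=
    (hu.left (m + n) rfl rfl).right (2 * n)
  have tv : IsTangle (m + n + 2 * n) (shift (m + n) v) (m + n) := hv.left (m + n)
  have tm : IsTangle (m + n) (openWord m) (m + (2 * m + n)) := (isTangle_openWord m).right n
  have tn : IsTangle (m + (2 * m + n)) (shift (m + 2 * m) (openWord n))
      (m + (2 * m + n + 2 * n)) := (isTangle_openWord n).left (m + 2 * m)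
  have e1 : u ++ br 0 n ≈[2 * m + n, n + 0] br (2 * m) n ++ shift n u :=
    braid_natural_left (P := tangle) n hu
  have e2 : u ++ shift 0 (openWord n) ≈[2 * m + n, 0 + (n + 2 * n)]
      shift (2 * m) (openWord n) ++ u := isotopic_interchange hu (isTangle_openWord n)
  have s1 := ((openWord_add m n).append (.refl tu)).append (.refl tv)
  have s2 := ((Isotopic.refl tm).append (.refl tn)).append
    ((e1.symm.left m rfl rfl).right (2 * n) (n' := m + n + 2 * n)) |>.append (.refl tv)
  have s3 := ((Isotopic.refl tm).append (e2.symm.left m rfl rfl)).append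
    (.refl (hv.left (m + n) (m' := m + (0 + (n + 2 * n))) (n' := m + n)))
  simp only [shift_append, shift_shift, braidWord, List.append_nil, List.append_assoc,
    shift_zero] at s1 s2 s3
  simp only [toStringLinkWord, shift_append, shift_shift, List.append_assoc]
  exact s1.trans (s2.trans s3)

/-- The convolution product of handles becomes the composition of string links. -/
theorem toStringLinkWord_comulWord {n : ℕ} {u v : List (ℕ × TangleGen)} (hu : IsTangle (2 * n) u 0)
    (hv : IsTangle (2 * n) v 0) :
    toStringLinkWord n (comulWord n ++ (u ++ v)) ≈[n, n]
      toStringLinkWord n v ++ toStringLinkWord n u := by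
  have ta := isTangle_openWord n
  have tu : IsTangle (n + 2 * n) (shift n u) n := hu.left n
  have tv : IsTangle (n + 2 * n + 2 * n) (shift (n + 2 * n) v) (n + 2 * n) := hv.left (n + 2 * n)
  have tuv : IsTangle (2 * n + 2 * n) (u ++ v) 0 :=
    Typed.append (P := tangle) (hu.right (2 * n) rfl rfl) (hv.right 0)
  have e1 : u ++ shift 0 v ≈[2 * n + 2 * n, 0 + 0] shift (2 * n) v ++ u :=
    isotopic_interchange hu hv
  have e2 : openWord n ++ shift (n + 2 * n) v ≈[n + 2 * n, n + 2 * n + 0]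
      shift n v ++ openWord n := isotopic_interchange ta hv
  have s1 := (openWord_coassoc n).symm.append (.refl (tuv.left n (n' := n)))
  have s2 := ((Isotopic.refl ta).append (.refl (ta.right (2 * n) rfl rfl))).append
    (e1.left n (m' := n + 2 * n + 2 * n) (n' := n))
  have s3 := ((Isotopic.refl ta).append e2).append (.refl tu)
  simp only [shift_append, shift_shift, List.append_assoc, shift_zero] at s1 s2 s3
  simp only [toStringLinkWord, shift_append, List.append_assoc]
  exact s1.trans (s2.trans s3)

/-! ### Strict monoidal functors from families of monoid homomorphisms -/

namespace EndoCat

variable {M N : ℕ → Type} [∀ n, Monoid (M n)] [∀ n, Monoid (N n)]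

namespace Hom

/-- The action of a family of homomorphisms on morphisms. -/
def map (f : ∀ n, M n →* N n) {m n : ℕ} : Hom M m n → Hom N m n
  | .of a => .of (f _ a)

theorem map_ofEq (f : ∀ n, M n →* N n) {m n : ℕ} (h : m = n) :
    (Hom.ofEq h : Hom M m n).map f = Hom.ofEq h := by
  subst h
  exact congrArg Hom.of (map_one (f m))

theorem map_comp (f : ∀ n, M n →* N n) {m n k : ℕ} (g : Hom M m n) (h : Hom M n k) :
    (g.comp h).map f = (g.map f).comp (h.map f) := by
  obtain ⟨a⟩ := g
  obtain ⟨b⟩ := h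
  exact congrArg Hom.of (map_mul (f _) b a)

theorem map_map {L : ℕ → Type} [∀ n, Monoid (L n)] (f : ∀ n, L n →* M n) (g : ∀ n, M n →* N n)
    {m n : ℕ} (h : Hom L m n) : (h.map f).map g = h.map fun n => (g n).comp (f n) := by
  obtain ⟨a⟩ := h
  rfl

theorem map_tensor [TensorMonoids M] [TensorMonoids N] {f : ∀ n, M n →* N n}
    (hf : ∀ {m n : ℕ} (a : M m) (b : M n),
      f (m + n) (TensorMonoids.tmul a b) = TensorMonoids.tmul (f m a) (f n b))
    {a b c d : ℕ} (g : Hom M a b) (h : Hom M c d) :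
    (g.tensor h).map f = (g.map f).tensor (h.map f) := by
  obtain ⟨x⟩ := g
  obtain ⟨y⟩ := h
  exact congrArg Hom.of (hf x y)

theorem id_comp_comp_id {m n : ℕ} (g : Hom N m n) :
    (Hom.id m).comp (g.comp (Hom.id n)) = g :=
  (Hom.id_comp _).trans (Hom.comp_id g)

end Hom

/-- The functor which is the identity on the objects and applies the homomorphism `f n` to the
endomorphisms of `n`. -/
def functor (f : ∀ n, M n →* N n) : EndoCat M ⥤ EndoCat N where
  obj n := (show ℕ from n)
  map g := Hom.map f g
  map_id n := Hom.map_ofEq f (Eq.refl (show ℕ from n))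
  map_comp g h := Hom.map_comp f g h

theorem functor_sends (f : ∀ n, M n →* N n) {n : ℕ} {a : M n} {b : N n} (h : f n a = b) :
    Sends (functor f) a b := by
  subst h
  exact ⟨rfl, (Hom.id_comp_comp_id (Hom.of (f n a))).symm⟩

/-- If the homomorphisms respect the tensor products, the functor is strict monoidal. -/
theorem functor_isStrictMonoidal [TensorMonoids M] [TensorMonoids N] (f : ∀ n, M n →* N n)
    (hf : ∀ {m n : ℕ} (a : M m) (b : M n),
      f (m + n) (TensorMonoids.tmul a b) = TensorMonoids.tmul (f m a) (f n b)) :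
    IsStrictMonoidal (functor f) where
  obj _ := rfl
  monoidal := by
    have hid (n : ℕ) : (Hom.id n : Hom M n n).map f = Hom.id n := Hom.map_ofEq f (Eq.refl n)
    have hl {a b : ℕ} (g : Hom M a b) (c : ℕ) :
        ((g.map f).tensor (Hom.id c)).comp (Hom.id (b + c)) =
          (Hom.id (a + c)).comp ((g.tensor (Hom.id c)).map f) := by
      rw [Hom.comp_id, Hom.id_comp, Hom.map_tensor hf, hid]
    have hr {a b : ℕ} (c : ℕ) (g : Hom M a b) :
        ((Hom.id c).tensor (g.map f)).comp (Hom.id (c + b)) =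
          (Hom.id (c + a)).comp (((Hom.id c).tensor g).map f) := by
      rw [Hom.comp_id, Hom.id_comp, Hom.map_tensor hf, hid]
    have ha (a b c : ℕ) : ((Hom.id (a + b)).tensor (Hom.id c)).comp ((Hom.id (a + b + c)).comp
          ((Hom.ofEq (Nat.add_assoc a b c)).map f)) =
        (Hom.ofEq (Nat.add_assoc a b c) : Hom N _ _).comp
          (((Hom.id a).tensor (Hom.id (b + c))).comp (Hom.id (a + (b + c)))) := by
      rw [Hom.tensor_id, Hom.tensor_id, Hom.id_comp, Hom.id_comp, Hom.comp_id, Hom.comp_id,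
        Hom.map_ofEq]
    have hlu (a : ℕ) : (Hom.ofEq (Nat.zero_add a) : Hom N _ _) =
        ((Hom.id 0).tensor (Hom.id a)).comp
          ((Hom.id (0 + a)).comp ((Hom.ofEq (Nat.zero_add a)).map f)) := by
      rw [Hom.tensor_id, Hom.id_comp, Hom.id_comp, Hom.map_ofEq]
    have hru (a : ℕ) : (Hom.ofEq (Nat.add_zero a) : Hom N _ _) =
        ((Hom.id a).tensor (Hom.id 0)).comp
          ((Hom.id (a + 0)).comp ((Hom.ofEq (Nat.add_zero a)).map f)) := by
      rw [Hom.tensor_id, Hom.id_comp, Hom.id_comp, Hom.map_ofEq]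
    let S : (functor f).CoreMonoidal :=
      { εIso := Iso.refl _
        μIso := fun _ _ => Iso.refl _
        μIso_hom_natural_left := fun g c => hl g c
        μIso_hom_natural_right := fun c g => hr c g
        associativity := fun a b c => ha a b c
        left_unitality := fun a => hlu a
        right_unitality := fun a => hru a }
    exact ⟨S.toMonoidal, ⟨rfl, rfl⟩, fun _ _ => ⟨rfl, rfl⟩⟩

theorem functor_comp {L : ℕ → Type} [∀ n, Monoid (L n)] (f : ∀ n, L n →* M n)
    (g : ∀ n, M n →* N n) :
    functor f ⋙ functor g = functor fun n => (g n).comp (f n) :=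
  CategoryTheory.Functor.ext (fun _ => rfl) fun _ _ h =>
    (Hom.map_map f g h).trans (Hom.id_comp_comp_id _).symm

end EndoCat

/-! ### The functors -/

/-- The unit of the convolution product on the `n`-th power of a coalgebra whose counit is a
generator `g`. -/
theorem one_eq_replicate {P : Presentation} [Braids P] {c : ℕ} [ComonObj (C := P.Cat) c]
    {g : P.Gen} (t : P.Typed (c * 1) [(0, g)] 0)
    (h : (1 : ConvEnd P c 1) = ConvEnd.ofDiagram ⟨[(0, g)], t⟩) (n : ℕ) :
    ∃ t, (1 : ConvEnd P c n) = ConvEnd.ofDiagram ⟨List.replicate n (0, g), t⟩ := by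
  induction n with
  | zero => exact ⟨Nat.mul_zero c, ConvEnd.one_zero⟩
  | succ n ih =>
    obtain ⟨t', e⟩ := ih
    have e' := ConvEnd.tmul_cls ⟨List.replicate n (0, g), t'⟩ ⟨[(0, g)], t⟩
    rw [← e, ← h, ConvEnd.one_tmul_one] at e'
    have t'' := ConvEnd.typed_tmul ⟨List.replicate n (0, g), t'⟩ ⟨[(0, g)], t⟩
    rw [← List.replicate_succ'] at t''
    exact ⟨t'', e'.trans (cls_eq List.replicate_succ'.symm)⟩

/-- The word of the coproduct of `n` neighbouring strands of a Hopf diagram. -/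
def hopfComulWord : ℕ → List (ℕ × HopfGen)
  | 0 => []
  | n + 1 => hopfComulWord n ++ [(2 * n, .comul)] ++ shift n (braidWord (.tau true) n 1)

theorem typed_hopfComulWord (n : ℕ) : hopf.Typed n (hopfComulWord n) (n + n) := by
  induction n with
  | zero => rfl
  | succ n ih =>
    refine Typed.append (a := n + (n + 1) + 1) (Typed.append (a := n + n + 1) (ih.right 1) ?_) ?_
    · exact (typed_gen (P := hopf) (2 * n) .comul 0).cast (by simp [hopf, HopfGen.src]; omega)
        (by simp [hopf, HopfGen.tgt]; omega)
    · exact (((typed_braidWord (P := hopf) n 1).left n).right 1).cast (by omega) (by omega)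

theorem phiWord_hopfComulWord (n : ℕ) : phiWord (hopfComulWord n) = comulWord n := by
  induction n with
  | zero => rfl
  | succ n ih =>
    rw [hopfComulWord, comulWord, phiWord_append, phiWord_append, ih, phiWord_gen, phiWord_shift,
      braidWord_one, phiWord_passLeft]
    simp [rule, show 2 * (2 * n) = 4 * n by omega]

/-- The object `*` of the category of Hopf diagrams. -/
def strand : hopf.Cat := (1 : ℕ)

instance : ComonObj strand := inferInstanceAs (ComonObj (C := hopf.Cat) (1 : ℕ))

theorem hopf_comul_succ (n : ℕ) : (ComonObj.comul (X := pow hopf 1 (n + 1)) :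
      pow hopf 1 (n + 1) ⟶ pow hopf 1 (n + 1) ⊗ pow hopf 1 (n + 1)) =
      (ComonObj.comul (X := pow hopf 1 n) ⊗ₘ ComonObj.comul (X := strand)) ≫
        tensorμ (pow hopf 1 n) (pow hopf 1 n) strand strand :=
  Comon.tensorObj_comul (pow hopf 1 n) strand

theorem hopf_comul_eq (n : ℕ) : (ComonObj.comul (X := pow hopf 1 n) :
    pow hopf 1 n ⟶ pow hopf 1 n ⊗ pow hopf 1 n) =
      cls (P := hopf) ⟨hopfComulWord n, (typed_hopfComulWord n).cast (Nat.one_mul n).symm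
        (congrArg₂ (· + ·) (Nat.one_mul n).symm (Nat.one_mul n).symm)⟩ := by
  induction n with
  | zero => rfl
  | succ n ih =>
    rw [hopf_comul_succ, ih]
    have e (w : List (ℕ × HopfGen)) :
        (w ++ shift (1 * n + 1 * n) [(0, HopfGen.comul)]) ++ ([] ++ ([] ++
          (shift (1 * n) (braidWord (HopfGen.tau true) (1 * n) 1) ++ ([] ++ [])))) =
        w ++ [(2 * n, .comul)] ++ shift n (braidWord (.tau true) n 1) := by
      simp [Nat.two_mul]
    exact cls_eq (P := hopf) (e (hopfComulWord n))

theorem tangle_one_eq (n : ℕ) : ∃ t, (1 : ConvEnd tangle 2 n) =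
    ConvEnd.ofDiagram ⟨List.replicate n (0, TangleGen.cap), t⟩ :=
  one_eq_replicate (P := tangle) (c := 2) (g := TangleGen.cap) ⟨0, rfl, rfl⟩ ConvEnd.one_def n

theorem hopf_one_eq (n : ℕ) : ∃ t, (1 : ConvEnd hopf 1 n) =
    ConvEnd.ofDiagram ⟨List.replicate n (0, HopfGen.counit), t⟩ :=
  one_eq_replicate (P := hopf) (c := 1) (g := HopfGen.counit) ⟨0, rfl, rfl⟩ ConvEnd.one_def n

/-- The diagram of a convolution product of Hopf diagrams. -/
theorem hopf_ofDiagram_mul {n : ℕ} {u v : List (ℕ × HopfGen)} (hu : hopf.Typed (1 * n) u 0)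
    (hv : hopf.Typed (1 * n) v 0) :
    ∃ h : hopf.Typed (1 * n) (hopfComulWord n ++ (u ++ v)) 0,
      (ConvEnd.ofDiagram ⟨u, hu⟩ * ConvEnd.ofDiagram ⟨v, hv⟩ : ConvEnd hopf 1 n) =
        ConvEnd.ofDiagram ⟨hopfComulWord n ++ (u ++ v), h⟩ := by
  have hc : hopf.Typed (1 * n) (hopfComulWord n) (1 * n + 1 * n) :=
    (typed_hopfComulWord n).cast (Nat.one_mul n).symm
      (congrArg₂ (· + ·) (Nat.one_mul n).symm (Nat.one_mul n).symm)
  have h : hopf.Typed (1 * n) (hopfComulWord n ++ (u ++ v)) 0 :=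
    hc.append (((hu.right (1 * n)).cast rfl (Nat.zero_add _)).append hv)
  have e : hopfComulWord n ++ (u ++ v) = hopfComulWord n ++ ((u ++ shift 0 v) ++ []) := by simp
  have h' : hopf.Typed (1 * n) (hopfComulWord n ++ ((u ++ shift 0 v) ++ [])) 0 := e ▸ h
  refine ⟨h, ?_⟩
  rw [ConvEnd.mul_def, hopf_comul_eq]
  exact cls_eq (P := hopf) (D := ⟨_, h'⟩) e.symm

/-- The diagram `φ_D` of a Hopf diagram from the `n`-th power of the object `1` to the unit. -/
def phiDiagram {n : ℕ} (D : hopf.Diagram (1 * n) 0) : tangle.Diagram (2 * n) 0 :=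
  ⟨phiWord D.word, typed_phiWord (D.typed.cast (Nat.one_mul n) rfl)⟩

/-- The map `D ↦ φ_D` from classes of Hopf diagrams to isotopy classes of tangles. -/
def phiClass {n : ℕ} : ConvEnd hopf 1 n → ConvEnd tangle 2 n :=
  Quot.lift (fun D => ConvEnd.ofDiagram (phiDiagram D)) fun _ _ h =>
    hom_ext_word (P := tangle) ((phiWord_step h).cast (congrArg (2 * ·) (Nat.one_mul n)) rfl)

theorem phiClass_mem {n : ℕ} (a : ConvEnd hopf 1 n) : phiClass a ∈ handles n := by
  obtain ⟨D, rfl⟩ := ConvEnd.ofDiagram_surj a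
  exact ⟨phiDiagram D, rfl, isHandle_phiWord (D.typed.cast (Nat.one_mul n) rfl)⟩

theorem phiClass_one (n : ℕ) : phiClass (1 : ConvEnd hopf 1 n) = 1 := by
  obtain ⟨t, e⟩ := hopf_one_eq n
  obtain ⟨t', e'⟩ := tangle_one_eq n
  have h : phiWord (List.replicate n (0, HopfGen.counit)) = List.replicate n (0, .cap) := by
    simp [phiWord, rule, List.flatMap_replicate]
  rw [e, e']
  exact cls_eq (P := tangle) h

theorem phiClass_mul {n : ℕ} (a b : ConvEnd hopf 1 n) :
    phiClass (a * b) = phiClass a * phiClass b := by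
  obtain ⟨D, rfl⟩ := ConvEnd.ofDiagram_surj a
  obtain ⟨E, rfl⟩ := ConvEnd.ofDiagram_surj b
  obtain ⟨t, e⟩ := hopf_ofDiagram_mul D.typed E.typed
  obtain ⟨t', e'⟩ := ofDiagram_mul (phiDiagram D).typed (phiDiagram E).typed
  refine (congrArg phiClass e).trans (Eq.trans ?_ e'.symm)
  have h (u v : List (ℕ × HopfGen)) :
      phiWord (hopfComulWord n ++ (u ++ v)) = comulWord n ++ (phiWord u ++ phiWord v) := by
    rw [phiWord_append, phiWord_append, phiWord_hopfComulWord]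
  exact cls_eq (P := tangle) (h D.word E.word)

theorem phiClass_tmul {m n : ℕ} (a : ConvEnd hopf 1 m) (b : ConvEnd hopf 1 n) :
    phiClass (ConvEnd.tmul a b) = ConvEnd.tmul (phiClass a) (phiClass b) := by
  obtain ⟨D, rfl⟩ := ConvEnd.ofDiagram_surj a
  obtain ⟨E, rfl⟩ := ConvEnd.ofDiagram_surj b
  refine (congrArg phiClass (ConvEnd.tmul_cls D E)).trans
    (Eq.trans ?_ (ConvEnd.tmul_cls (phiDiagram D) (phiDiagram E)).symm)
  exact cls_eq (P := tangle) (phiWord_append D.word E.word)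

/-- The homomorphisms which define the functor `φ`. -/
def phiHandles (n : ℕ) : ConvEnd hopf 1 n →* handles n where
  toFun a := ⟨phiClass a, phiClass_mem a⟩
  map_one' := Subtype.ext (phiClass_one n)
  map_mul' a b := Subtype.ext (phiClass_mul a b)

/-- The map `T ↦ G_T` on isotopy classes of tangles. -/
def openClass {n : ℕ} (a : ConvEnd tangle 2 n) : End (tobj n) :=
  Hom.comp (P := tangle) (cls ⟨openWord n, typed_openWord n⟩) (Hom.whiskerLeft (P := tangle) n a)

theorem openClass_mem {n : ℕ} {a : ConvEnd tangle 2 n} (h : a ∈ handles n) :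
    openClass a ∈ stringLinks n := by
  obtain ⟨T, rfl, hT⟩ := h
  exact ⟨toStringLink T, rfl, hT.isStringLink⟩

theorem openClass_one (n : ℕ) : openClass (1 : ConvEnd tangle 2 n) = 1 := by
  obtain ⟨t, e⟩ := tangle_one_eq n
  rw [e]
  exact hom_ext_word (P := tangle) (toStringLinkWord_caps n)

theorem openClass_mul {n : ℕ} (a b : ConvEnd tangle 2 n) :
    openClass (a * b) = openClass a * openClass b := by
  obtain ⟨D, rfl⟩ := ConvEnd.ofDiagram_surj a
  obtain ⟨E, rfl⟩ := ConvEnd.ofDiagram_surj b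
  obtain ⟨t, e⟩ := ofDiagram_mul D.typed E.typed
  refine (congrArg openClass e).trans ?_
  exact hom_ext_word (P := tangle) (E := (toStringLink E).comp (toStringLink D))
    (toStringLinkWord_comulWord D.typed E.typed)

theorem openClass_tmul {m n : ℕ} (a : ConvEnd tangle 2 m) (b : ConvEnd tangle 2 n) :
    openClass (ConvEnd.tmul a b) =
      Hom.comp (P := tangle) (Hom.whiskerRight (openClass a) n)
        (Hom.whiskerLeft m (openClass b)) := by
  obtain ⟨D, rfl⟩ := ConvEnd.ofDiagram_surj a
  obtain ⟨E, rfl⟩ := ConvEnd.ofDiagram_surj b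
  refine (congrArg openClass (ConvEnd.tmul_cls D E)).trans ?_
  exact hom_ext_word (P := tangle)
    (E := ((toStringLink D).whiskerRight n).comp ((toStringLink E).whiskerLeft m))
    (toStringLinkWord_append D.typed E.typed)

/-- The homomorphisms which define the functor `G`. -/
def openHandles (n : ℕ) : handles n →* stringLinks n where
  toFun a := ⟨openClass a.1, openClass_mem a.2⟩
  map_one' := Subtype.ext (openClass_one n)
  map_mul' a b := Subtype.ext (openClass_mul a.1 b.1)

theorem phiHandles_tmul {m n : ℕ} (a : ConvEnd hopf 1 m) (b : ConvEnd hopf 1 n) :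
    phiHandles (m + n) (TensorMonoids.tmul a b) =
      TensorMonoids.tmul (M := fun n => handles n) (phiHandles m a) (phiHandles n b) :=
  Subtype.ext (phiClass_tmul a b)

theorem openHandles_tmul {m n : ℕ} (a : handles m) (b : handles n) :
    openHandles (m + n) (TensorMonoids.tmul (M := fun n => handles n) a b) =
      TensorMonoids.tmul (M := fun n => stringLinks n) (openHandles m a) (openHandles n b) :=
  Subtype.ext (openClass_tmul a.1 b.1)

end HopfDiag

open CategoryTheory MonoidalCategory HopfDiag Presentation

theorem proposition3p1 :
    (∀ (m n : ℕ) (D D' : hopf.Diagram m n), cls D = cls D' → cls (phi D) = cls (phi D')) ∧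
    ∃ (hφ : ∀ (n : ℕ) (D : hopf.Diagram n 0), IsHandle n (phi D).word)
      (hG : ∀ (n : ℕ) (T : tangle.Diagram (2 * n) 0), IsHandle n T.word →
        IsStringLink n (toStringLink T).word)
      (φ : DiagS ⥤ RHand) (G : RHand ⥤ RSL) (ψ : DiagS ⥤ RSL),
      (IsStrictMonoidal φ ∧
        ∀ (n : ℕ) (D : hopf.Diagram n 0), Sends φ (hopfClass D) (handleClass (phi D) (hφ n D))) ∧
      (IsStrictMonoidal G ∧
        ∀ (n : ℕ) (T : tangle.Diagram (2 * n) 0) (hT : IsHandle n T.word),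
          Sends G (handleClass T hT) (slClass (toStringLink T) (hG n T hT))) ∧
      (IsStrictMonoidal ψ ∧
        ∀ (n : ℕ) (D : hopf.Diagram n 0),
          Sends ψ (hopfClass D) (slClass (toStringLink (phi D)) (hG n (phi D) (hφ n D)))) ∧
      φ ⋙ G = ψ := by
  refine ⟨fun m n D D' h => congrArg (phiHom m n) h, fun n D => isHandle_phiWord D.typed,
    fun n T hT => hT.isStringLink, EndoCat.functor phiHandles, EndoCat.functor openHandles,
    EndoCat.functor fun n => (openHandles n).comp (phiHandles n),
    ⟨EndoCat.functor_isStrictMonoidal _ phiHandles_tmul, fun n D => EndoCat.functor_sends _ rfl⟩,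
    ⟨EndoCat.functor_isStrictMonoidal _ openHandles_tmul,
      fun n T hT => EndoCat.functor_sends _ rfl⟩,
    ⟨EndoCat.functor_isStrictMonoidal _ fun a b => ?_, fun n D => EndoCat.functor_sends _ rfl⟩,
    EndoCat.functor_comp _ _⟩
  exact (congrArg (openHandles _) (phiHandles_tmul a b)).trans (openHandles_tmul _ _)
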